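/- **Setting.** Let $r\ge 1$, let $\mathcal X=\mathbb R^{d_1\times r}$ carry the Frobenius norm and $\mathcal Y=\mathbb R^{d_2}$ the Euclidean norm, and let $\mathcal M=\{x\in\mathcal X: x^\top x=I_r\}$ be the Stiefel manifold. Put $c(x)=x^\top x-I_r$, $A(x)=x(\tfrac32 I_r-\tfrac12x^\top x)$, and write $\nabla A(x)[u]=u(\tfrac32 I_r-\tfrac12x^\top x)-x\,\mathrm{sym}(x^\top u)$, $\nabla c(x)[u]=2xu$, where $\mathrm{sym}(m)=\tfrac12(m+m^\top)$. Let $h:\mathcal Y\to\mathbb R\cup\{+\infty\}$ be proper, closed and convex, with closed bounded domain $Y=\{h<\infty\}$, and locally Lipschitz on $Y$. Fix $C>\tfrac12+\sup_{x\in\mathcal M}\|x\|$ and let $X=\{x\in\mathcal X:\|x\|\le C\}$, $\bar X=A(X)$. Let $f:\mathcal X\times\mathcal Y\to\mathbb R$ be differentiable on an open set containing $\bar X\times Y$, with $f(x,\cdot)$ concave on $Y$ for every $x\in\bar X$, and with $$\|\nabla_xf(x_1,y_1)-\nabla_xf(x_2,y_2)\|\le L_{xx}\|x_1-x_2\|+L_{xy}\|y_1-y_2\|,\qquad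 \|\nabla_yf(x_1,y_1)-\nabla_yf(x_2,y_2)\|\le L_{yx}\|x_1-x_2\|+L_{yy}\|y_1-y_2\|$$ for all $x_1,x_2\in\bar X$, $y_1,y_2\in Y$. For $\rho>0$ let $\tilde f(x,y)=f(A(x),y)+\frac\rho4\|c(x)\|^2$, let $l_{xx},l_{xy},l_{yx}\ge 0$ and $l_{yy}=L_{yy}$ be constants for which the same two inequalities (with $l$'s in place of $L$'s) hold for $\tilde f$ on $X\times Y$, and let $l=\max\{l_{xx},l_{xy},l_{yx},l_{yy}\}$. For $x\in\mathcal M$ let $\operatorname{grad}_xf(x,y)=\nabla_xf(x,y)-x\,\mathrm{sym}(x^\top\nabla_xf(x,y))$. **Algorithm (sm-MGDA).** Starting from $(x_0,y_0,z_0)$, for $t=0,1,2,\dots$ $$x_{t+1}=\mathcal P_X\Big(x_t-\tau_{1,t}\big(\nabla A(x_t)[\nabla_xf(A(x_t),y_t)]+\tfrac\rho2\nabla c(x_t)[c(x_t)]+p(x_t-z_t)\big)\Big),$$ $$y_{t+1}=\mathrm{prox}_{\tau_2h}\Big(y_t+\tau_2\big(\nabla_yf(A(x_{t+1}),y_t)-\theta_ty_t\big)\Big),\qquad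 z_{t+1}=z_t+\beta(x_{t+1}-z_t).$$ Each iteration evaluates two partial gradients of $f$. The parameters are $p=0$, $\beta=1$, $\tau_2>0$ with $\tau_2\le\frac1{10\,l_{yy}}$ (no upper bound if $l_{yy}=0$), and $$\tau_{1,t}=\frac{2}{2\tau_2l^2(1+b\sqrt{t+1})-l},\qquad \theta_t=\frac{19}{20}\cdot\frac1{\tau_2}\cdot\frac1{(t+1)^{1/4}},\qquad b>\max\Big\{\frac2{\tau_2l}-1,\ \frac{32\cdot20^2}{19^2}\Big\}.$$ **Theorem.** There are $\bar\rho>0$ and $K_0>0$, depending only on $f$, $h$, $C$ and the constants $L_{xx},L_{xy},L_{yx},L_{yy}$, and for each such $\tau_2$ and each $b$ there is $K>0$, depending in addition only on $\tau_2$ and $b$, such that for all $\rho>\bar\rho$, all $l$ as above, and all initial points $(x_0,y_0,x_0)$ with $x_0\in\mathcal M$, $y_0\in Y$, the following holds. 1. For every $\epsilon>0$ the algorithm reaches, within $K\,l^4\epsilon^{-4}(1+|\log\epsilon|)^2$ gradient evaluations, an iterate $(x_\epsilon,y_\epsilon)$ with $x_\epsilon\in X$ whose projection $\mathcal P_{\mathcal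 M}(x_\epsilon)$ is uniquely defined and satisfies $$\|x_\epsilon-\mathcal P_{\mathcal M}(x_\epsilon)\|\le\frac3\rho\epsilon,\quad \|\operatorname{grad}_xf(\mathcal P_{\mathcal M}(x_\epsilon),y_\epsilon)\|\le K_0\epsilon,\quad \mathrm{dist}\big(0,-\nabla_yf(\mathcal P_{\mathcal M}(x_\epsilon),y_\epsilon)+\partial h(y_\epsilon)\big)\le K_0\epsilon.$$ 2. Every limit point $(x^*,y^*)$ of the sequence $\{(x_t,y_t)\}_{t\ge0}$ satisfies $x^*\in\mathcal M$, $\operatorname{grad}_xf(x^*,y^*)=0$ and $0\in-\nabla_yf(x^*,y^*)+\partial h(y^*)$. -/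

import Mathlib

noncomputable section

namespace SmMGDA

/-- The space of real `d × r` matrices with the Frobenius inner product and norm. -/
abbrev MatSpace (d r : ℕ) : Type := EuclideanSpace ℝ (Fin d × Fin r)

/-- The matrix with the entries of `x`. -/
def toMat {d r : ℕ} (x : MatSpace d r) : Matrix (Fin d) (Fin r) ℝ :=
  Matrix.of fun i j => x (i, j)

/-- A matrix, seen as a point of the Euclidean space `MatSpace d r`. -/
def ofMat {d r : ℕ} (m : Matrix (Fin d) (Fin r) ℝ) : MatSpace d r :=
  WithLp.toLp 2 fun ij => m ij.1 ij.2

/-- The symmetric part of a square matrix. -/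
def symPart {r : ℕ} (m : Matrix (Fin r) (Fin r) ℝ) : Matrix (Fin r) (Fin r) ℝ :=
  (1 / 2 : ℝ) • (m + m.transpose)

/-- The constraint function `c(x) = xᵀ x - I`. -/
def constr {d r : ℕ} (x : MatSpace d r) : MatSpace r r :=
  ofMat ((toMat x).transpose * toMat x - 1)

/-- The Stiefel manifold `{x : c(x) = 0}`. -/
def stiefel (d r : ℕ) : Set (MatSpace d r) := {x | constr x = 0}

/-- The constraint dissolving map `A(x) = x (3/2 I - 1/2 xᵀ x)`. -/
def dissolve {d r : ℕ} (x : MatSpace d r) : MatSpace d r :=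
  ofMat (toMat x *
    ((3 / 2 : ℝ) • (1 : Matrix (Fin r) (Fin r) ℝ)
      - (1 / 2 : ℝ) • ((toMat x).transpose * toMat x)))

/-- `∇A(x)[u]`, the adjoint of the derivative of `A` at `x` applied to `u`:
`u (3/2 I - 1/2 xᵀ x) - x sym(xᵀ u)`. -/
def dissolveAdj {d r : ℕ} (x u : MatSpace d r) : MatSpace d r :=
  ofMat (toMat u *
      ((3 / 2 : ℝ) • (1 : Matrix (Fin r) (Fin r) ℝ)
        - (1 / 2 : ℝ) • ((toMat x).transpose * toMat x))
    - toMat x * symPart ((toMat x).transpose * toMat u))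

/-- `∇c(x)[u]`, the adjoint of the derivative of `c` at `x` applied to a symmetric `u`:
`2 x u`. -/
def constrAdj {d r : ℕ} (x : MatSpace d r) (u : MatSpace r r) : MatSpace d r :=
  ofMat ((2 : ℝ) • (toMat x * toMat u))

/-- The partial gradient of `f` with respect to its first argument. -/
def gradX {E F : Type*} [NormedAddCommGroup E] [InnerProductSpace ℝ E] [CompleteSpace E]
    (f : E → F → ℝ) (x : E) (y : F) : E :=
  gradient (fun x' => f x' y) x

/-- The partial gradient of `f` with respect to its second argument. -/
def gradY {E F : Type*} [NormedAddCommGroup F] [InnerProductSpace ℝ F] [CompleteSpace F]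
    (f : E → F → ℝ) (x : E) (y : F) : F :=
  gradient (fun y' => f x y') y

/-- The partial Riemannian gradient of `f` at a point `x` of the Stiefel manifold:
`∇ₓ f - x sym(xᵀ ∇ₓ f)`. -/
def riemGradX {d r : ℕ} {F : Type*} (f : MatSpace d r → F → ℝ)
    (x : MatSpace d r) (y : F) : MatSpace d r :=
  ofMat (toMat (gradX f x y)
    - toMat x * symPart ((toMat x).transpose * toMat (gradX f x y)))

/-- The penalty function `f(A(x), y) + ρ/4 ‖c(x)‖²`. -/
def penalized {d r : ℕ} {F : Type*} (f : MatSpace d r → F → ℝ) (ρ : ℝ)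
    (x : MatSpace d r) (y : F) : ℝ :=
  f (dissolve x) y + ρ / 4 * ‖constr x‖ ^ 2

/-- The partial gradients of `f` are Lipschitz on `S × T`, with the given constants. -/
structure GradLipschitzOn {E F : Type*}
    [NormedAddCommGroup E] [InnerProductSpace ℝ E] [CompleteSpace E]
    [NormedAddCommGroup F] [InnerProductSpace ℝ F] [CompleteSpace F]
    (f : E → F → ℝ) (S : Set E) (T : Set F) (Lxx Lxy Lyx Lyy : ℝ) : Prop where
  nonneg : 0 ≤ Lxx ∧ 0 ≤ Lxy ∧ 0 ≤ Lyx ∧ 0 ≤ Lyy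
  lip_x : ∀ x₁ ∈ S, ∀ x₂ ∈ S, ∀ y₁ ∈ T, ∀ y₂ ∈ T,
    ‖gradX f x₁ y₁ - gradX f x₂ y₂‖ ≤ Lxx * ‖x₁ - x₂‖ + Lxy * ‖y₁ - y₂‖
  lip_y : ∀ x₁ ∈ S, ∀ x₂ ∈ S, ∀ y₁ ∈ T, ∀ y₂ ∈ T,
    ‖gradY f x₁ y₁ - gradY f x₂ y₂‖ ≤ Lyx * ‖x₁ - x₂‖ + Lyy * ‖y₁ - y₂‖

/-- The domain `{y : h(y) < ∞}` of an extended-real-valued function. -/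
def effDom {F : Type*} (h : F → EReal) : Set F := {y | h y < ⊤}

/-- `h` is a proper closed convex function with values in `ℝ ∪ {+∞}`, its domain is closed and
bounded, and `h` is locally Lipschitz on its domain. -/
structure IsRegularizer {F : Type*} [NormedAddCommGroup F] [InnerProductSpace ℝ F]
    (h : F → EReal) : Prop where
  ne_bot : ∀ y, h y ≠ ⊥
  proper : (effDom h).Nonempty
  lsc : LowerSemicontinuous h
  convex_epi : Convex ℝ {q : F × ℝ | h q.1 ≤ (q.2 : EReal)}
  closed_dom : IsClosed (effDom h)
  bounded_dom : Bornology.IsBounded (effDom h)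
  locallyLipschitz : LocallyLipschitzOn (effDom h) fun y => (h y).toReal

/-- The convex subdifferential `∂h(y)`; it is empty when `h y = ⊤` and `h` is proper. -/
def subdiff {F : Type*} [NormedAddCommGroup F] [InnerProductSpace ℝ F]
    (h : F → EReal) (y : F) : Set F :=
  {g | ∀ w, h y + ((inner ℝ g (w - y) : ℝ) : EReal) ≤ h w}

/-- The set `-∇_y f(x, y) + ∂h(y)`. -/
def dualResidual {E F : Type*}
    [NormedAddCommGroup F] [InnerProductSpace ℝ F] [CompleteSpace F]
    (f : E → F → ℝ) (h : F → EReal) (x : E) (y : F) : Set F :=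
  (fun g => -gradY f x y + g) '' subdiff h y

/-- The points of `S` nearest to `v`, i.e. the (set-valued) metric projection of `v` onto `S`. -/
def nearestPts {E : Type*} [NormedAddCommGroup E] (S : Set E) (v : E) : Set E :=
  {q | q ∈ S ∧ ∀ q' ∈ S, ‖v - q‖ ≤ ‖v - q'‖}

/-- The projection of `v` onto `S`: the nearest point of `S`, when there is a unique one. -/
def proj {E : Type*} [NormedAddCommGroup E] (S : Set E) (v : E) : E :=
  Classical.epsilon fun q => q ∈ nearestPts S v

/-- The proximal map `prox_{τ h}(v) = argmin_u h(u) + ‖u - v‖² / (2 τ)`. -/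
def prox {F : Type*} [NormedAddCommGroup F] (h : F → EReal) (τ : ℝ) (v : F) : F :=
  Classical.epsilon fun u =>
    ∀ w, h u + ((‖u - v‖ ^ 2 / (2 * τ) : ℝ) : EReal) ≤
      h w + ((‖w - v‖ ^ 2 / (2 * τ) : ℝ) : EReal)

/-- The parameters of the algorithm. -/
structure Params where
  ρ : ℝ
  C : ℝ
  τ₁ : ℕ → ℝ
  τ₂ : ℝ
  θ : ℕ → ℝ
  p : ℝ
  β : ℝ

/-- The state of the algorithm: the three iterates, and the number of evaluations of partial
gradients of `f` so far. -/
structure State (E F : Type*) where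
  x : E
  y : F
  z : E
  evals : ℕ

/-- One iteration: a projected gradient step in `x` on the ball of radius `C`, a proximal gradient
step in `y`, and an averaging step in `z`. It evaluates `∇ₓ f` once and `∇_y f` once. -/
def step {d r : ℕ} {F : Type*} [NormedAddCommGroup F] [InnerProductSpace ℝ F] [CompleteSpace F]
    (f : MatSpace d r → F → ℝ) (h : F → EReal) (P : Params) (t : ℕ)
    (s : State (MatSpace d r) F) : State (MatSpace d r) F :=
  let g := dissolveAdj s.x (gradX f (dissolve s.x) s.y)
    + (P.ρ / 2) • constrAdj s.x (constr s.x)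
  let x' := proj (Metric.closedBall 0 P.C) (s.x - P.τ₁ t • (g + P.p • (s.x - s.z)))
  let y' := prox h P.τ₂ (s.y + P.τ₂ • (gradY f (dissolve x') s.y - P.θ t • s.y))
  let z' := s.z + P.β • (x' - s.z)
  { x := x', y := y', z := z', evals := s.evals + 2 }

/-- The state after `t` iterations, from the given starting point. -/
def run {d r : ℕ} {F : Type*} [NormedAddCommGroup F] [InnerProductSpace ℝ F] [CompleteSpace F]
    (f : MatSpace d r → F → ℝ) (h : F → EReal) (P : Params)
    (x₀ : MatSpace d r) (y₀ : F) (z₀ : MatSpace d r) : ℕ → State (MatSpace d r) F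
  | 0 => { x := x₀, y := y₀, z := z₀, evals := 0 }
  | t + 1 => step f h P t (run f h P x₀ y₀ z₀ t)

/-- The parameters for the merely concave case: `p = 0`, `β = 1`,
`θ_t = (19/20) (1/τ₂) (t+1)^(-1/4)`, `τ_{1,t} = 2 / (2 τ₂ l² (1 + b √(t+1)) - l)`. -/
def concaveParams (ρ C τ₂ b l : ℝ) : Params where
  ρ := ρ
  C := C
  τ₁ := fun t => 2 / (2 * τ₂ * l ^ 2 * (1 + b * Real.sqrt ((t : ℝ) + 1)) - l)
  τ₂ := τ₂
  θ := fun t => 19 / 20 * (1 / τ₂) * (1 / ((t : ℝ) + 1) ^ (1 / 4 : ℝ))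
  p := 0
  β := 1

end SmMGDA

end

/-! ### Frobenius algebra of matrices and of the maps `constr` and `dissolve`. -/

noncomputable section

namespace SmMGDA

open Matrix

section MatrixAlgebra

variable {d d' r s : ℕ}

/-! Write `F` for the penalty function `f(A(x), y) + ρ/4 ‖c(x)‖²`. With `p = 0` the `z` iterates
play no role, and the algorithm is alternating projected gradient descent in `x` and proximal
gradient ascent in `y` for `F - h`, with a vanishing regularization `-θ_t/2 ‖y‖²`. The proof has a
geometric half and an analytic half.

Geometry. The vector `∇A(x)[g]` is tangent to the Stiefel manifold up to an error of order `c(x)`,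
whereas the penalty gradient pulls `c(x)` towards zero at rate `2 τ ρ`. Hence, if `τ ρ ≤ 1/2`, a
gradient step preserves the tube `‖c(x)‖ ≤ B/ρ` (`norm_constr_gradient_step_le`). The tube lies
inside the ball of radius `C`, so the projection onto the ball never acts. The condition on `τ`
holds because the Lipschitz constant `l` is itself at least `4/3 ρ` (`IsProblem.penalty_le`). Inside
the tube, testing `∇ₓF` against `x c(x)` gives `‖c(x)‖ ≤ 3/ρ ‖∇ₓF‖` (`norm_constr_le_of_gradient`),
and the polar decomposition gives a unique nearest point of the manifold at distance at most
`‖c(x)‖` (`exists_unique_nearest_stiefel`). Small residuals for `F` therefore transfer to the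
manifold (`IsProblem.exists_projection`).

Complexity. Let `Φ_t(x)` be the maximum over `y` of `F(x, y) - h(y) - θ_t/2 ‖y‖²`, and let `z_t` now
denote the maximizer at `x_{t+1}`. An inexact gradient step decreases `Φ` up to an error in
`‖y_{t+1} - z_{t+1}‖`; a proximal step contracts the distance to `z_t` by a factor governed by `α
θ_t`; and `z_t` moves by at most a multiple of the `x` step plus the relative change of `θ`. For a
suitable weight `w_t` these combine into a potential `Φ_t + w_t ‖y_{t+1} - z_t‖²`, with telescoping
corrections, whose decrease controls both squared residuals (`StepBounds.potential_step`). The total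
decrease is bounded independently of `ρ` and `l`, and the step size is of order `1/(l² α b √t)`, so
some iteration between `N` and `2N` has `‖∇ₓF‖² ≲ l²/√N` and `‖y_t - z_t‖² ≲ 1/√N`
(`DescentSystem.exists_small`). Taking `N` of order `l⁴ ε⁻⁴` gives the first claim, in fact without
the logarithm.

Limit points. The decrease argument yields only a subsequence with small residuals, but every limit
point must be stationary. For this the energy `‖∇Φ_t(x_{t+1})‖²/2 + 2 l² ‖y_{t+1} - z_t‖²` is used.
Since `Φ_t` is weakly convex, with an additional gain `θ ‖z_{t+1} - z_t‖²` from strong concavity in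
`y`, a step along an approximate negative gradient raises the energy by at most a summable amount
(`StepBounds.energy_step`). A nonnegative sequence with summable increases that is frequently small
tends to zero, so all residuals vanish along the whole sequence (`DescentSystem.tendsto_energy`). -/

@[simp] lemma toMat_ofMat (m : Matrix (Fin d) (Fin r) ℝ) : toMat (ofMat m) = m := rfl

@[simp] lemma ofMat_toMat (x : MatSpace d r) : ofMat (toMat x) = x := rfl

lemma ofMat_add (m n : Matrix (Fin d) (Fin r) ℝ) : ofMat (m + n) = ofMat m + ofMat n := rfl

lemma ofMat_sub (m n : Matrix (Fin d) (Fin r) ℝ) : ofMat (m - n) = ofMat m - ofMat n := rfl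

lemma ofMat_neg (m : Matrix (Fin d) (Fin r) ℝ) : ofMat (-m) = -ofMat m := rfl

lemma ofMat_smul (a : ℝ) (m : Matrix (Fin d) (Fin r) ℝ) : ofMat (a • m) = a • ofMat m := rfl

lemma ofMat_zero : ofMat (0 : Matrix (Fin d) (Fin r) ℝ) = 0 := rfl

lemma toMat_add (x y : MatSpace d r) : toMat (x + y) = toMat x + toMat y := rfl

lemma toMat_sub (x y : MatSpace d r) : toMat (x - y) = toMat x - toMat y := rfl

lemma toMat_smul (a : ℝ) (x : MatSpace d r) : toMat (a • x) = a • toMat x := rfl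

/-- The Frobenius norm of a matrix. -/
def frob (m : Matrix (Fin d) (Fin r) ℝ) : ℝ := ‖ofMat m‖

lemma frob_toMat (x : MatSpace d r) : frob (toMat x) = ‖x‖ := rfl

lemma frob_nonneg (m : Matrix (Fin d) (Fin r) ℝ) : 0 ≤ frob m := norm_nonneg _

lemma frob_add_le (m n : Matrix (Fin d) (Fin r) ℝ) : frob (m + n) ≤ frob m + frob n := by
  unfold frob; rw [ofMat_add]; exact norm_add_le _ _

lemma frob_sub_le (m n : Matrix (Fin d) (Fin r) ℝ) : frob (m - n) ≤ frob m + frob n := by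
  unfold frob; rw [ofMat_sub]; exact norm_sub_le _ _

lemma frob_neg (m : Matrix (Fin d) (Fin r) ℝ) : frob (-m) = frob m := by
  unfold frob; rw [ofMat_neg, norm_neg]

lemma frob_smul (a : ℝ) (m : Matrix (Fin d) (Fin r) ℝ) : frob (a • m) = |a| * frob m := by
  unfold frob; rw [ofMat_smul, norm_smul, Real.norm_eq_abs]

lemma eq_zero_of_frob_eq_zero {m : Matrix (Fin d) (Fin r) ℝ} (h : frob m = 0) : m = 0 := by
  have : ofMat m = 0 := norm_eq_zero.1 h
  rw [← toMat_ofMat m, this]; rfl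

lemma inner_ofMat (m n : Matrix (Fin d) (Fin r) ℝ) :
    inner ℝ (ofMat m) (ofMat n) = (mᵀ * n).trace := by
  simp only [PiLp.inner_apply, ofMat, Matrix.trace, Matrix.mul_apply, Matrix.diag_apply,
    Matrix.transpose_apply, Fintype.sum_prod_type]
  rw [Finset.sum_comm]
  simp [mul_comm]

lemma inner_eq_trace (x y : MatSpace d r) :
    inner ℝ x y = ((toMat x)ᵀ * toMat y).trace := inner_ofMat (toMat x) (toMat y)

lemma frob_sq (m : Matrix (Fin d) (Fin r) ℝ) : frob m ^ 2 = (mᵀ * m).trace := by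
  unfold frob; rw [← real_inner_self_eq_norm_sq, inner_ofMat]

lemma abs_trace_transpose_mul_le (m n : Matrix (Fin d) (Fin r) ℝ) :
    |(mᵀ * n).trace| ≤ frob m * frob n := by
  rw [← inner_ofMat]; exact abs_real_inner_le_norm _ _

lemma frob_transpose (m : Matrix (Fin d) (Fin r) ℝ) : frob mᵀ = frob m := by
  have h : frob mᵀ ^ 2 = frob m ^ 2 := by
    rw [frob_sq, frob_sq, transpose_transpose, trace_mul_comm]
  exact (pow_left_inj₀ (frob_nonneg _) (frob_nonneg _) two_ne_zero).1 h

lemma frob_sq_eq_sum (m : Matrix (Fin d) (Fin r) ℝ) : frob m ^ 2 = ∑ i, ∑ j, m i j ^ 2 := by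
  unfold frob
  rw [EuclideanSpace.norm_sq_eq, Fintype.sum_prod_type]
  simp [ofMat]

/-- Cauchy–Schwarz in each entry of the product, then summation over the entries. -/
lemma frob_mul_le (m : Matrix (Fin d) (Fin r) ℝ) (n : Matrix (Fin r) (Fin s) ℝ) :
    frob (m * n) ≤ frob m * frob n := by
  refine le_of_sq_le_sq ?_ (mul_nonneg (frob_nonneg _) (frob_nonneg _))
  rw [mul_pow, ← frob_transpose n, frob_sq_eq_sum, frob_sq_eq_sum, frob_sq_eq_sum,
    Finset.sum_mul_sum]
  refine Finset.sum_le_sum fun i _ => Finset.sum_le_sum fun j _ => ?_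
  rw [Matrix.mul_apply]
  exact Finset.sum_mul_sq_le_sq_mul_sq _ _ _

lemma frob_symPart_le (m : Matrix (Fin r) (Fin r) ℝ) : frob (symPart m) ≤ frob m := by
  unfold symPart
  rw [frob_smul]
  have := frob_add_le m mᵀ
  rw [frob_transpose] at this
  rw [abs_of_pos (by norm_num)]
  linarith

lemma symPart_transpose (m : Matrix (Fin r) (Fin r) ℝ) : (symPart m)ᵀ = symPart m := by
  unfold symPart; rw [transpose_smul, transpose_add, transpose_transpose, add_comm]

/-- The matrix of `c(x)`. -/
lemma toMat_constr (x : MatSpace d r) : toMat (constr x) = (toMat x)ᵀ * toMat x - 1 := rfl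

lemma gram_eq (x : MatSpace d r) : (toMat x)ᵀ * toMat x = 1 + toMat (constr x) := by
  rw [toMat_constr]; abel

lemma constr_transpose (x : MatSpace d r) : (toMat (constr x))ᵀ = toMat (constr x) := by
  simp [toMat_constr]

lemma frob_constr (x : MatSpace d r) : frob (toMat (constr x)) = ‖constr x‖ := rfl

lemma mem_stiefel_iff (x : MatSpace d r) : x ∈ stiefel d r ↔ (toMat x)ᵀ * toMat x = 1 := by
  constructor
  · intro h
    have h : constr x = 0 := h
    rw [gram_eq, h]; exact add_zero _
  · intro h
    change constr x = 0
    unfold constr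
    rw [h, sub_self]; rfl

lemma norm_sq_eq (x : MatSpace d r) : ‖x‖ ^ 2 = r + (toMat (constr x)).trace := by
  rw [← frob_toMat, frob_sq, gram_eq, trace_add, trace_one, Fintype.card_fin]

lemma abs_trace_le (m : Matrix (Fin r) (Fin r) ℝ) : |m.trace| ≤ √r * frob m := by
  have h := abs_trace_transpose_mul_le (1 : Matrix (Fin r) (Fin r) ℝ) m
  have h1 : frob (1 : Matrix (Fin r) (Fin r) ℝ) = √r := by
    rw [← Real.sqrt_sq (frob_nonneg _), frob_sq]; simp
  rwa [transpose_one, one_mul, h1] at h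

lemma norm_of_mem_stiefel {x : MatSpace d r} (hx : x ∈ stiefel d r) : ‖x‖ = √r := by
  have h := norm_sq_eq x
  have hx : constr x = 0 := hx
  rw [hx] at h
  rw [← Real.sqrt_sq (norm_nonneg x), h]
  congr 1
  change (r : ℝ) + (0 : Matrix (Fin r) (Fin r) ℝ).trace = r
  simp

/-- Since `‖x‖² = r + tr c(x)`, a small constraint violation keeps `x` within the margin `1/2` that
`C` leaves above the norm `√r` of the manifold. -/
lemma norm_le_of_norm_constr_le {x : MatSpace d r} (hx : ‖constr x‖ ≤ 1 / 4) :
    ‖x‖ ≤ √r + 1 / 2 := by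
  refine le_of_sq_le_sq ?_ (by positivity)
  rw [norm_sq_eq]
  have h := (le_abs_self _).trans (abs_trace_le (toMat (constr x)))
  rw [frob_constr] at h
  have h0 := Real.sqrt_nonneg (r : ℝ)
  have h2 := Real.sq_sqrt (Nat.cast_nonneg r : (0 : ℝ) ≤ r)
  nlinarith

lemma toMat_dissolve (x : MatSpace d r) :
    toMat (dissolve x) = toMat x - (1 / 2 : ℝ) • (toMat x * toMat (constr x)) := by
  rw [toMat_constr]
  unfold dissolve
  rw [toMat_ofMat, Matrix.mul_sub, Matrix.mul_sub]
  simp only [Matrix.mul_smul, Matrix.mul_one]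
  module

lemma dissolve_of_mem_stiefel {x : MatSpace d r} (hx : x ∈ stiefel d r) : dissolve x = x := by
  have hx : constr x = 0 := hx
  rw [← ofMat_toMat (dissolve x), toMat_dissolve, hx]
  change ofMat (toMat x - (1 / 2 : ℝ) • (toMat x * 0)) = x
  simp

lemma toMat_dissolveAdj (x u : MatSpace d r) :
    toMat (dissolveAdj x u) = toMat u - (1 / 2 : ℝ) • (toMat u * toMat (constr x))
      - toMat x * symPart ((toMat x)ᵀ * toMat u) := by
  rw [toMat_constr]
  unfold dissolveAdj
  rw [toMat_ofMat, Matrix.mul_sub, Matrix.mul_sub]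
  simp only [Matrix.mul_smul, Matrix.mul_one]
  module

/-- The derivative of `A` at `x`, applied to `u`. -/
def dissolveDeriv (x u : MatSpace d r) : MatSpace d r :=
  ofMat (toMat u - (1 / 2 : ℝ) • (toMat u * toMat (constr x))
      - toMat x * symPart ((toMat x)ᵀ * toMat u))

lemma trace_mul_symPart (m n : Matrix (Fin r) (Fin r) ℝ) :
    (mᵀ * symPart n).trace = ((symPart m)ᵀ * n).trace := by
  have h : (mᵀ * nᵀ).trace = (m * n).trace := by
    rw [← transpose_mul, trace_transpose, trace_mul_comm]
  simp only [symPart, mul_smul_comm, mul_add, trace_smul, trace_add, transpose_smul,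
    transpose_add, transpose_transpose, smul_mul_assoc, add_mul, h]

/-- The derivative of `A` is self-adjoint for the Frobenius product, because `c(x)` is symmetric and
`symPart` is self-adjoint; this is why `dissolveAdj` and `dissolveDeriv` share one formula. -/
lemma inner_dissolveAdj (x g u : MatSpace d r) :
    inner ℝ (dissolveAdj x g) u = inner ℝ g (dissolveDeriv x u) := by
  rw [inner_eq_trace, inner_eq_trace, toMat_dissolveAdj]
  unfold dissolveDeriv
  rw [toMat_ofMat]
  set X := toMat x
  set G := toMat g
  set U := toMat u
  set c := toMat (constr x) with hc
  have hct : cᵀ = c := constr_transpose x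
  simp only [transpose_sub, transpose_smul, transpose_mul, hct, Matrix.sub_mul, Matrix.mul_sub,
    trace_sub, Matrix.smul_mul, Matrix.mul_smul, trace_smul]
  have e1 : (c * Gᵀ * U).trace = (Gᵀ * (U * c)).trace := by
    rw [Matrix.mul_assoc, trace_mul_comm, Matrix.mul_assoc]
  have e2 : ((symPart (Xᵀ * G))ᵀ * Xᵀ * U).trace = (Gᵀ * (X * symPart (Xᵀ * U))).trace := by
    rw [Matrix.mul_assoc, ← trace_mul_symPart, transpose_mul, transpose_transpose,
      Matrix.mul_assoc]
  rw [e1, e2]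

end MatrixAlgebra

end SmMGDA

end

/-! ### Derivatives of `c` and `A`, and the gradient of the penalty function. -/

noncomputable section

namespace SmMGDA

open Matrix

section Derivatives

variable {d r s : ℕ}

lemma isBoundedBilinearMap_mul :
    IsBoundedBilinearMap ℝ
      (fun p : MatSpace d r × MatSpace r s => ofMat (toMat p.1 * toMat p.2)) where
  add_left x y z := by rw [toMat_add, Matrix.add_mul, ofMat_add]
  smul_left a x y := by rw [toMat_smul, Matrix.smul_mul, ofMat_smul]
  add_right x y z := by rw [toMat_add, Matrix.mul_add, ofMat_add]
  smul_right a x y := by rw [toMat_smul, Matrix.mul_smul, ofMat_smul]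
  bound := ⟨1, one_pos, fun x y => by
    rw [one_mul]; exact frob_mul_le (toMat x) (toMat y)⟩

/-- Transposition as a continuous linear map. -/
def transposeL : MatSpace d r →L[ℝ] MatSpace r d :=
  LinearMap.toContinuousLinearMap
    { toFun := fun x => ofMat (toMat x)ᵀ
      map_add' := fun _ _ => rfl
      map_smul' := fun _ _ => rfl }

lemma hasFDerivAt_constr (x : MatSpace d r) :
    ∃ L : MatSpace d r →L[ℝ] MatSpace r r,
      (∀ u, L u = ofMat ((2 : ℝ) • symPart ((toMat x)ᵀ * toMat u))) ∧
        HasFDerivAt constr L x := by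
  have hp : HasFDerivAt (fun y : MatSpace d r => (transposeL y, y))
      (transposeL.prod (ContinuousLinearMap.id ℝ (MatSpace d r))) x :=
    transposeL.hasFDerivAt.prodMk (hasFDerivAt_id x)
  have h := HasFDerivAt.comp (f := fun y : MatSpace d r => (transposeL y, y)) x
    ((isBoundedBilinearMap_mul (d := r) (r := d) (s := r)).hasFDerivAt (transposeL x, x)) hp
  have h' := h.sub_const (ofMat (1 : Matrix (Fin r) (Fin r) ℝ))
  refine ⟨_, fun u => ?_, h'⟩
  change ofMat ((toMat x)ᵀ * toMat u) + ofMat ((toMat u)ᵀ * toMat x) = _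
  rw [← ofMat_add]
  congr 1
  unfold symPart
  rw [transpose_mul, transpose_transpose, smul_smul]
  norm_num

lemma hasFDerivAt_dissolve (x : MatSpace d r) :
    ∃ L : MatSpace d r →L[ℝ] MatSpace d r,
      (∀ u, L u = dissolveDeriv x u) ∧ HasFDerivAt dissolve L x := by
  obtain ⟨L, hL, hc⟩ := hasFDerivAt_constr x
  have hp := (hasFDerivAt_id x).prodMk hc
  have h := HasFDerivAt.comp (f := fun y : MatSpace d r => (y, constr y)) x
    ((isBoundedBilinearMap_mul (d := d) (r := r) (s := r)).hasFDerivAt (x, constr x)) hp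
  have h' := (hasFDerivAt_id x).sub (h.const_smul (1 / 2 : ℝ))
  have he : (dissolve : MatSpace d r → MatSpace d r)
      = fun y => y - (1 / 2 : ℝ) • ofMat (toMat y * toMat (constr y)) := by
    funext y
    rw [← ofMat_toMat (dissolve y), toMat_dissolve]; rfl
  refine ⟨_, fun u => ?_, by rw [he]; exact h'⟩
  change u - (1 / 2 : ℝ) • (ofMat (toMat x * toMat (L u)) + ofMat (toMat u * toMat (constr x))) = _
  rw [hL, toMat_ofMat, Matrix.mul_smul]
  unfold dissolveDeriv
  simp only [ofMat_sub, ofMat_smul, ofMat_toMat]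
  module

lemma differentiable_dissolve : Differentiable ℝ (dissolve : MatSpace d r → MatSpace d r) :=
  fun x => let ⟨_, _, h⟩ := hasFDerivAt_dissolve x; h.differentiableAt

lemma differentiable_constr : Differentiable ℝ (constr : MatSpace d r → MatSpace r r) :=
  fun x => let ⟨_, _, h⟩ := hasFDerivAt_constr x; h.differentiableAt

lemma hasGradientAt_comp_dissolve {φ : MatSpace d r → ℝ} {g x : MatSpace d r}
    (h : HasGradientAt φ g (dissolve x)) :
    HasGradientAt (fun y => φ (dissolve y)) (dissolveAdj x g) x := by
  obtain ⟨L, hL, hA⟩ := hasFDerivAt_dissolve x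
  rw [hasGradientAt_iff_hasFDerivAt] at h ⊢
  refine (h.comp x hA).congr_fderiv (ContinuousLinearMap.ext fun u => Eq.symm ?_)
  change inner ℝ (dissolveAdj x g) u = inner ℝ g (L u)
  rw [hL, inner_dissolveAdj]

/-- The formula `2 x u` is the adjoint of the derivative of `c` only on symmetric `u`, so the
symmetry of `c(x)` enters here. -/
lemma inner_constrAdj (x u : MatSpace d r) :
    inner ℝ (constrAdj x (constr x)) u
      = inner ℝ (constr x) (ofMat ((2 : ℝ) • symPart ((toMat x)ᵀ * toMat u))) := by
  have hct := constr_transpose x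
  have hs : symPart (toMat (constr x)) = toMat (constr x) := by
    unfold symPart; rw [hct, ← two_smul ℝ (toMat (constr x)), smul_smul]; norm_num
  rw [inner_eq_trace, inner_eq_trace, toMat_ofMat, Matrix.mul_smul, trace_smul,
    trace_mul_symPart, hs, hct]
  unfold constrAdj
  rw [toMat_ofMat, transpose_smul, transpose_mul, hct, Matrix.smul_mul, trace_smul,
    Matrix.mul_assoc]

lemma hasGradientAt_norm_sq_constr (x : MatSpace d r) :
    HasGradientAt (fun y : MatSpace d r => ‖constr y‖ ^ 2)
      ((2 : ℝ) • constrAdj x (constr x)) x := by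
  obtain ⟨L, hL, hc⟩ := hasFDerivAt_constr x
  rw [hasGradientAt_iff_hasFDerivAt]
  refine hc.norm_sq.congr_fderiv (ContinuousLinearMap.ext fun u => Eq.symm ?_)
  change inner ℝ ((2 : ℝ) • constrAdj x (constr x)) u = _
  rw [inner_smul_left, inner_constrAdj]
  simp [hL]

/-- The formula for the partial gradient in `x` of the penalty function. -/
lemma hasGradientAt_penalized {F : Type*} (f : MatSpace d r → F → ℝ) (ρ : ℝ)
    {x : MatSpace d r} {y : F}
    (h : DifferentiableAt ℝ (fun x' => f x' y) (dissolve x)) :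
    HasGradientAt (fun x' => penalized f ρ x' y)
      (dissolveAdj x (gradX f (dissolve x) y) + (ρ / 2) • constrAdj x (constr x)) x := by
  have h1 := hasGradientAt_comp_dissolve h.hasGradientAt
  have h2 := hasGradientAt_norm_sq_constr x
  rw [hasGradientAt_iff_hasFDerivAt] at *
  refine (h1.add (h2.const_mul (ρ / 4))).congr_fderiv
    (ContinuousLinearMap.ext fun u => Eq.symm ?_)
  change inner ℝ (_ + _) u = inner ℝ _ u + (ρ / 4) * inner ℝ ((2 : ℝ) • _) u
  rw [inner_add_left, inner_smul_left, inner_smul_left]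
  simp only [conj_trivial, gradX]
  ring

lemma toMat_constrAdj (x : MatSpace d r) (ρ : ℝ) :
    toMat ((ρ / 2) • constrAdj x (constr x)) = ρ • (toMat x * toMat (constr x)) := by
  rw [toMat_smul]; unfold constrAdj; rw [toMat_ofMat, smul_smul]; congr 1; ring

end Derivatives

end SmMGDA

end

/-! ### The tube around the Stiefel manifold. -/

noncomputable section

namespace SmMGDA

open Matrix

section StiefelGeometry

variable {d r : ℕ}

lemma norm_dissolveAdj_le (x g : MatSpace d r) :
    ‖dissolveAdj x g‖ ≤ ‖g‖ * (1 + ‖constr x‖ / 2 + ‖x‖ ^ 2) := by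
  rw [← frob_toMat (dissolveAdj x g), toMat_dissolveAdj]
  have h1 := frob_sub_le (toMat g - (1 / 2 : ℝ) • (toMat g * toMat (constr x)))
    (toMat x * symPart ((toMat x)ᵀ * toMat g))
  have h2 := frob_sub_le (toMat g) ((1 / 2 : ℝ) • (toMat g * toMat (constr x)))
  have h3 := frob_mul_le (toMat g) (toMat (constr x))
  have h4 := frob_mul_le (toMat x) (symPart ((toMat x)ᵀ * toMat g))
  have h5 := frob_symPart_le ((toMat x)ᵀ * toMat g)
  have h6 := frob_mul_le (toMat x)ᵀ (toMat g)
  rw [frob_smul, abs_of_pos (by norm_num : (0 : ℝ) < 1 / 2)] at h2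
  rw [frob_transpose] at h6
  simp only [frob_toMat] at *
  have h7 := mul_le_mul_of_nonneg_left (h5.trans h6) (norm_nonneg x)
  nlinarith

/-- An exact expansion whose point is the term linear in `τ`: with `V = ∇A(x)[g]`, the matrix `XᵀV +
VᵀX` vanishes on the manifold, and off it every one of its terms carries a factor `C = c(x)`. The
only contribution free of `C` is then the second-order `τ² VᵀV`. -/
lemma constr_gradient_step (x g : MatSpace d r) (τ ρ : ℝ) {X V C M N : Matrix _ _ ℝ}
    (hX : X = toMat x) (hV : V = toMat (dissolveAdj x g)) (hC : C = toMat (constr x))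
    (hM : M = Xᵀ * toMat g) (hN : N = Xᵀ * V) :
    toMat (constr (x - τ • (dissolveAdj x g + (ρ / 2) • constrAdj x (constr x))))
      = (1 - 2 * (τ * ρ)) • C - (2 * (τ * ρ) - (τ * ρ) ^ 2) • (C * C)
        + (τ * ρ) ^ 2 • (C * C * C)
        + τ • ((1 / 2 : ℝ) • (M * C + C * Mᵀ) + (C * symPart M + symPart M * C))
        + (τ * (τ * ρ)) • (C * N + Nᵀ * C) + τ ^ 2 • (Vᵀ * V) := by
  have hg : Xᵀ * X = 1 + C := by rw [hX, hC]; exact gram_eq x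
  have hCt : Cᵀ = C := by rw [hC]; exact constr_transpose x
  -- From `XᵀX = 1 + C`; modulo `C`, `N` is the skew part of `M`, which is the tangency of `V`.
  have hN' : N = M - (1 / 2 : ℝ) • (M * C) - (1 + C) * symPart M := by
    rw [hN, hV, toMat_dissolveAdj, ← hX, ← hC, ← hM, Matrix.mul_sub, Matrix.mul_sub,
      Matrix.mul_smul, ← Matrix.mul_assoc, ← Matrix.mul_assoc, hg, ← hM]
  have hsum : N + Nᵀ
      = -((1 / 2 : ℝ) • (M * C + C * Mᵀ) + (C * symPart M + symPart M * C)) := by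
    have hs : M + Mᵀ = (2 : ℝ) • symPart M := by
      unfold symPart; rw [smul_smul]; norm_num
    have hst := symPart_transpose M
    have hMt : Mᵀ = (2 : ℝ) • symPart M - M := by rw [← hs]; abel
    rw [hN']
    simp only [transpose_sub, transpose_smul, transpose_mul, transpose_add, transpose_one, hst,
      hCt, hMt]
    simp only [Matrix.add_mul, Matrix.mul_add, Matrix.one_mul, Matrix.mul_one, Matrix.mul_sub,
      Matrix.mul_smul]
    module
  have hx' : toMat (x - τ • (dissolveAdj x g + (ρ / 2) • constrAdj x (constr x)))
      = X - (τ * ρ) • (X * C) - τ • V := by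
    rw [toMat_sub, toMat_smul, toMat_add, toMat_constrAdj, ← hX, ← hV, ← hC]
    module
  have hNt : Nᵀ = Vᵀ * X := by rw [hN, transpose_mul, transpose_transpose]
  have e1 : Xᵀ * (X * C) = C + C * C := by
    rw [← Matrix.mul_assoc, hg, Matrix.add_mul, Matrix.one_mul]
  have e2 : Vᵀ * (X * C) = Nᵀ * C := by rw [hNt, Matrix.mul_assoc]
  have hK : (1 / 2 : ℝ) • (M * C + C * Mᵀ) + (C * symPart M + symPart M * C) = -(N + Nᵀ) := by
    rw [hsum, neg_neg]
  rw [toMat_constr, hx', hK]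
  simp only [transpose_sub, transpose_smul, transpose_mul, hCt, Matrix.sub_mul, Matrix.mul_sub,
    Matrix.smul_mul, Matrix.mul_smul, Matrix.mul_assoc, e1, e2, hg, ← hN, ← hNt,
    Matrix.mul_add, Matrix.mul_one]
  module

lemma frob_combination_le (M₁ M₂ M₃ M₄ M₅ M₆ : Matrix (Fin d) (Fin r) ℝ) {a b c e f g : ℝ}
    (ha : 0 ≤ a) (hb : 0 ≤ b) (hc : 0 ≤ c) (he : 0 ≤ e) (hf : 0 ≤ f) (hg : 0 ≤ g) :
    frob (a • M₁ - b • M₂ + c • M₃ + e • M₄ + f • M₅ + g • M₆)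
      ≤ a * frob M₁ + b * frob M₂ + c * frob M₃ + e * frob M₄ + f * frob M₅ + g * frob M₆ := by
  have t1 := frob_add_le (a • M₁ - b • M₂ + c • M₃ + e • M₄ + f • M₅) (g • M₆)
  have t2 := frob_add_le (a • M₁ - b • M₂ + c • M₃ + e • M₄) (f • M₅)
  have t3 := frob_add_le (a • M₁ - b • M₂ + c • M₃) (e • M₄)
  have t4 := frob_add_le (a • M₁ - b • M₂) (c • M₃)
  have t5 := frob_sub_le (a • M₁) (b • M₂)
  rw [frob_smul, abs_of_nonneg hg] at t1
  rw [frob_smul, abs_of_nonneg hf] at t2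
  rw [frob_smul, abs_of_nonneg he] at t3
  rw [frob_smul, abs_of_nonneg hc] at t4
  rw [frob_smul, frob_smul, abs_of_nonneg ha, abs_of_nonneg hb] at t5
  linarith

/-- With `k = τ ρ` and `β = B/ρ` one has `τ B = k β`, so every forcing term is proportional to `k`.
The contraction `1 - 2k` loses at most `k/2` to the terms proportional to `c`, and the remaining
forcing is at most `k β/16`, so the radius `β` is preserved. -/
lemma tube_estimate {c τ ρ B f₂ f₃ f₄ f₅ f₆ : ℝ} (hB : 0 < B) (hρ0 : 0 < ρ) (hτ : 0 ≤ τ)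
    (hk : τ * ρ ≤ 1 / 2) (hc0 : 0 ≤ c) (hx : c ≤ B / ρ) (hBρ : B / ρ ≤ 1 / 8)
    (h20 : 0 ≤ f₂) (h2 : f₂ ≤ c * c) (h3 : f₃ ≤ c * c * c) (h4 : f₄ ≤ B * c) (h5 : f₅ ≤ B * c)
    (h6 : f₆ ≤ B * B) :
    (1 - 2 * (τ * ρ)) * c + (2 * (τ * ρ) - (τ * ρ) ^ 2) * f₂ + (τ * ρ) ^ 2 * f₃ + τ * f₄
      + τ * (τ * ρ) * f₅ + τ ^ 2 * f₆ ≤ B / ρ := by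
  have q0 : τ * B = τ * ρ * (B / ρ) := by field_simp
  have q1 : 0 ≤ B / ρ := by positivity
  have hk0 : 0 ≤ τ * ρ := by positivity
  generalize τ * ρ = k at *
  generalize B / ρ = β at *
  have hc8 : c ≤ 1 / 8 := hx.trans hBρ
  have hkc : 0 ≤ k * c := mul_nonneg hk0 hc0
  have hkB : 0 ≤ k * β := mul_nonneg hk0 q1
  have hcc : c * c ≤ c * (1 / 8) := mul_le_mul_of_nonneg_left hc8 hc0
  have m1 : (2 * k - k ^ 2) * f₂ ≤ 2 * k * (c * (1 / 8)) :=
    mul_le_mul (by linarith [sq_nonneg k]) (h2.trans hcc) h20 (by linarith)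
  have m2 : k ^ 2 * f₃ ≤ k * (1 / 2) * (c * (1 / 8)) := by
    have a1 : k ^ 2 ≤ k * (1 / 2) := by rw [sq]; exact mul_le_mul_of_nonneg_left hk hk0
    have a2 : c * c * c ≤ c * (1 / 8) := by
      have : c * c * c ≤ c * c * 1 := mul_le_mul_of_nonneg_left (by linarith) (by positivity)
      linarith
    calc k ^ 2 * f₃ ≤ k ^ 2 * (c * c * c) := mul_le_mul_of_nonneg_left h3 (sq_nonneg k)
      _ ≤ _ := mul_le_mul a1 a2 (by positivity) (by positivity)
  have m3 := mul_le_mul_of_nonneg_left h4 hτ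
  have m4 := mul_le_mul_of_nonneg_left h5 (mul_nonneg hτ hk0)
  have m5 := mul_le_mul_of_nonneg_left h6 (sq_nonneg τ)
  have n3 : τ * (B * c) ≤ k * (1 / 8) * c := by
    rw [← mul_assoc, q0]
    exact mul_le_mul_of_nonneg_right (mul_le_mul_of_nonneg_left hBρ hk0) hc0
  have n4 : τ * k * (B * c) ≤ k * (1 / 8) * c * (1 / 2) := by
    have : τ * k * (B * c) = τ * (B * c) * k := by ring
    rw [this]
    exact mul_le_mul n3 hk hk0 (by positivity)
  have n5 : τ ^ 2 * (B * B) ≤ k * β * (1 / 16) := by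
    have : τ ^ 2 * (B * B) = (k * β) * (k * β) := by rw [← q0]; ring
    rw [this]
    refine mul_le_mul_of_nonneg_left ?_ hkB
    calc k * β ≤ 1 / 2 * (1 / 8) := mul_le_mul hk hBρ q1 (by norm_num)
      _ = 1 / 16 := by norm_num
  have fin : (1 - k) * c ≤ (1 - k) * β := mul_le_mul_of_nonneg_left hx (by linarith)
  linarith

/-- A gradient step on the penalty function stays in a tube of radius `O(1 / ρ)` around the
Stiefel manifold. -/
lemma norm_constr_gradient_step_le {x g : MatSpace d r} {τ ρ B : ℝ} (hB : 0 < B)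
    (hρ : 8 * B ≤ ρ) (hτ : 0 ≤ τ) (hk : τ * ρ ≤ 1 / 2) (hx : ‖constr x‖ ≤ B / ρ)
    (h1 : 3 * (‖x‖ * ‖g‖) ≤ B) (h2 : 2 * (‖x‖ * ‖dissolveAdj x g‖) ≤ B)
    (h3 : ‖dissolveAdj x g‖ ≤ B) :
    ‖constr (x - τ • (dissolveAdj x g + (ρ / 2) • constrAdj x (constr x)))‖ ≤ B / ρ := by
  have hρ0 : 0 < ρ := by linarith
  have hstep := constr_gradient_step x g τ ρ rfl rfl rfl rfl rfl
  rw [← frob_toMat (constr (x - _)), hstep]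
  clear hstep
  set X := toMat x with hX
  set V := toMat (dissolveAdj x g) with hV
  set C := toMat (constr x) with hC
  set M := Xᵀ * toMat g with hM
  set N := Xᵀ * V with hN
  set k := τ * ρ with hkdef
  have hk0 : 0 ≤ k := mul_nonneg hτ hρ0.le
  set c := ‖constr x‖ with hc
  have hc0 : 0 ≤ c := norm_nonneg _
  have hBρ : B / ρ ≤ 1 / 8 := by rw [div_le_iff₀ hρ0]; linarith
  have fC : frob C = c := rfl
  have fV : frob V ≤ B := h3
  have fM : 3 * frob M ≤ B := by
    have := frob_mul_le Xᵀ (toMat g)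
    rw [frob_transpose] at this
    exact (mul_le_mul_of_nonneg_left this (by norm_num)).trans h1
  have fN : 2 * frob N ≤ B := by
    have := frob_mul_le Xᵀ V
    rw [frob_transpose] at this
    exact (mul_le_mul_of_nonneg_left this (by norm_num)).trans h2
  have fM0 := frob_nonneg M
  have fN0 := frob_nonneg N
  have fV0 := frob_nonneg V
  have b2 : frob (C * C) ≤ c * c := by have := frob_mul_le C C; rwa [fC] at this
  have b3 : frob (C * C * C) ≤ c * c * c := by
    have := frob_mul_le (C * C) C
    rw [fC] at this
    exact this.trans (mul_le_mul_of_nonneg_right b2 hc0)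
  have b4 : frob ((1 / 2 : ℝ) • (M * C + C * Mᵀ) + (C * symPart M + symPart M * C))
      ≤ B * c := by
    have a0 := frob_add_le ((1 / 2 : ℝ) • (M * C + C * Mᵀ)) (C * symPart M + symPart M * C)
    have a1 := frob_add_le (M * C) (C * Mᵀ)
    have a2 := frob_add_le (C * symPart M) (symPart M * C)
    have a3 := frob_mul_le M C
    have a4 := frob_mul_le C Mᵀ
    have a5 := frob_mul_le C (symPart M)
    have a6 := frob_mul_le (symPart M) C
    have a7 := frob_symPart_le M
    rw [frob_smul, abs_of_pos (by norm_num : (0 : ℝ) < 1 / 2)] at a0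
    rw [frob_transpose] at a4
    rw [fC] at a3 a4 a5 a6
    have a8 := mul_le_mul_of_nonneg_left a7 hc0
    have a9 := mul_le_mul_of_nonneg_left fM hc0
    nlinarith
  have b5 : frob (C * N + Nᵀ * C) ≤ B * c := by
    have a1 := frob_add_le (C * N) (Nᵀ * C)
    have a3 := frob_mul_le C N
    have a4 := frob_mul_le Nᵀ C
    rw [frob_transpose] at a4
    rw [fC] at a3 a4
    have a9 := mul_le_mul_of_nonneg_left fN hc0
    nlinarith
  have b6 : frob (Vᵀ * V) ≤ B * B := by
    have := frob_mul_le Vᵀ V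
    rw [frob_transpose] at this
    exact this.trans (mul_le_mul fV fV fV0 hB.le)
  have t := frob_combination_le C (C * C) (C * C * C)
    ((1 / 2 : ℝ) • (M * C + C * Mᵀ) + (C * symPart M + symPart M * C)) (C * N + Nᵀ * C) (Vᵀ * V)
    (a := 1 - 2 * k) (b := 2 * k - k ^ 2) (c := k ^ 2) (e := τ) (f := τ * k) (g := τ ^ 2)
    (by linarith) (by nlinarith) (by positivity) hτ (by positivity) (by positivity)
  rw [fC] at t
  exact t.trans (tube_estimate hB hρ0 hτ hk hc0 hx hBρ (frob_nonneg _) b2 b3 b4 b5 b6)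

lemma frob_sq_mul_constr (x : MatSpace d r) :
    frob (toMat x * toMat (constr x)) ^ 2
      = ‖constr x‖ ^ 2 + (toMat (constr x) * (toMat (constr x) * toMat (constr x))).trace := by
  have hCt := constr_transpose x
  rw [frob_sq, ← frob_constr, frob_sq, transpose_mul, hCt, Matrix.mul_assoc,
    ← Matrix.mul_assoc _ (toMat x), gram_eq, Matrix.add_mul, Matrix.mul_add, Matrix.one_mul,
    trace_add]

lemma abs_trace_constr_cube_le (x : MatSpace d r) :
    |(toMat (constr x) * (toMat (constr x) * toMat (constr x))).trace| ≤ ‖constr x‖ ^ 3 := by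
  have h := abs_trace_transpose_mul_le (toMat (constr x)) (toMat (constr x) * toMat (constr x))
  rw [constr_transpose, frob_constr] at h
  have h2 := frob_mul_le (toMat (constr x)) (toMat (constr x))
  rw [frob_constr] at h2
  calc _ ≤ _ := h
    _ ≤ ‖constr x‖ * (‖constr x‖ * ‖constr x‖) := mul_le_mul_of_nonneg_left h2 (norm_nonneg _)
    _ = _ := by ring

/-- To first order `A` cancels the normal displacement `x c(x)`, so the derivative of `A` in this
direction is quadratic in `c(x)`. Along `x c(x)` the penalty therefore dominates the contribution of
`f`. -/
lemma dissolveDeriv_mul_constr (x : MatSpace d r) :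
    dissolveDeriv x (ofMat (toMat x * toMat (constr x)))
      = (-(3 / 2) : ℝ) • ofMat (toMat x * toMat (constr x) * toMat (constr x)) := by
  have hCt := constr_transpose x
  unfold dissolveDeriv
  rw [toMat_ofMat, ← Matrix.mul_assoc _ (toMat x), gram_eq, ← ofMat_smul]
  congr 1
  have : symPart ((1 + toMat (constr x)) * toMat (constr x))
      = toMat (constr x) + toMat (constr x) * toMat (constr x) := by
    unfold symPart
    simp only [transpose_mul, transpose_add, hCt, Matrix.add_mul, Matrix.one_mul]
    module
  rw [this, Matrix.mul_add, ← Matrix.mul_assoc]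
  module

/-- Near the Stiefel manifold, the gradient of the penalty function controls the infeasibility. -/
lemma norm_constr_le_of_gradient {x g : MatSpace d r} {ρ G₀ : ℝ} (hρ0 : 0 < ρ)
    (hρ : 8 * G₀ ≤ ρ) (hg : ‖g‖ ≤ G₀) (hx : ‖constr x‖ ≤ 1 / 4) :
    ‖constr x‖ ≤ 3 / ρ * ‖dissolveAdj x g + (ρ / 2) • constrAdj x (constr x)‖ := by
  set γ := dissolveAdj x g + (ρ / 2) • constrAdj x (constr x) with hγ
  set C := toMat (constr x) with hC
  set w : MatSpace d r := ofMat (toMat x * C) with hw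
  set c := ‖constr x‖ with hc
  have hc0 : 0 ≤ c := norm_nonneg _
  have hG0 : 0 ≤ ‖g‖ := norm_nonneg _
  have hsq : ‖w‖ ^ 2 = c ^ 2 + (C * (C * C)).trace := frob_sq_mul_constr x
  have htr := abs_le.1 (abs_trace_constr_cube_le x)
  rw [← hC, ← hc] at htr
  -- The cubic trace is at most a quarter of `c²`, whence `3/4 c² ≤ ‖x c(x)‖² ≤ 5/4 c²`.
  have hcc : c ^ 3 ≤ c ^ 2 * (1 / 4) := by nlinarith [sq_nonneg c]
  have hlo : 3 / 4 * c ^ 2 ≤ ‖w‖ ^ 2 := by linarith [htr.1]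
  have hhi : ‖w‖ ≤ 5 / 4 * c := by
    refine le_of_sq_le_sq ?_ (by positivity)
    nlinarith [htr.2, sq_nonneg c]
  -- Test the gradient against the normal direction `w = x c(x)`: the penalty contributes `ρ ‖w‖²`,
  -- while `f ∘ A` contributes only a term quadratic in `c(x)`.
  have hin : inner ℝ γ w
      = ρ * ‖w‖ ^ 2 - 3 / 2 * inner ℝ g (ofMat (toMat x * C * C)) := by
    have e : (ρ / 2) • constrAdj x (constr x) = ρ • w := by
      rw [← ofMat_toMat ((ρ / 2) • constrAdj x (constr x)), toMat_constrAdj]; rfl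
    rw [hγ, e, inner_add_left, inner_dissolveAdj, hw, hC, dissolveDeriv_mul_constr, ← hC, ← hw,
      inner_smul_right, inner_smul_left, real_inner_self_eq_norm_sq]
    simp; ring
  have h1 : inner ℝ γ w ≤ ‖γ‖ * ‖w‖ := real_inner_le_norm _ _
  have h2 : inner ℝ g (ofMat (toMat x * C * C)) ≤ ‖g‖ * (‖w‖ * c) :=
    (real_inner_le_norm _ _).trans (mul_le_mul_of_nonneg_left (frob_mul_le (toMat x * C) C) hG0)
  have h3 : ‖g‖ * (‖w‖ * c) ≤ ρ / 8 * (5 / 4 * c * c) := by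
    refine mul_le_mul (by linarith) (mul_le_mul_of_nonneg_right hhi hc0) (by positivity)
      (by positivity)
  have h4 : ‖γ‖ * ‖w‖ ≤ ‖γ‖ * (5 / 4 * c) := mul_le_mul_of_nonneg_left hhi (norm_nonneg _)
  have h5 : ρ * (3 / 4 * c ^ 2) ≤ ρ * ‖w‖ ^ 2 := mul_le_mul_of_nonneg_left hlo hρ0.le
  have h6 : c * (ρ * c) ≤ c * (3 * ‖γ‖) := by nlinarith [mul_nonneg (norm_nonneg γ) hc0]
  rw [div_mul_eq_mul_div, le_div_iff₀ hρ0]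
  rcases hc0.eq_or_lt with h | h
  · rw [← h, zero_mul]; positivity
  · have := le_of_mul_le_mul_left h6 h
    linarith

end StiefelGeometry

end SmMGDA

end

/-! ### Polar decomposition and projection onto the Stiefel manifold. -/

noncomputable section

namespace SmMGDA

open Matrix
open scoped MatrixOrder

section Polar

variable {d r : ℕ}

lemma exists_sqrt_gram (x : MatSpace d r) :
    ∃ s : Matrix (Fin r) (Fin r) ℝ, s.PosSemidef ∧ s * s = (toMat x)ᵀ * toMat x := by
  have h : ((toMat x)ᵀ * toMat x).PosSemidef := by
    simpa using posSemidef_conjTranspose_mul_self (toMat x)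
  exact ⟨CFC.sqrt _, (CFC.sqrt_nonneg _).posSemidef, CFC.sqrt_mul_sqrt_self _ h.nonneg⟩

/-- With `e = s - 1` one has `s² - 1 = e + e s`, and the cross term `tr(e s e)` in the squared norm
is nonnegative because `s` is positive semidefinite. -/
lemma frob_sub_one_le {s : Matrix (Fin r) (Fin r) ℝ} (hs : s.PosSemidef) :
    frob (s - 1) ≤ frob (s * s - 1) := by
  have hst : s.IsSymm := by simpa using hs.1
  replace hst : sᵀ = s := hst
  set e := s - 1 with he
  have het : eᵀ = e := by rw [he, transpose_sub, hst, transpose_one]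
  have hc : s * s - 1 = e + e * s := by rw [he, Matrix.sub_mul, Matrix.one_mul]; abel
  have hcomm : s * e = e * s := by
    rw [he, Matrix.sub_mul, Matrix.mul_sub, Matrix.one_mul, Matrix.mul_one]
  have htr : 0 ≤ (e * s * e).trace := by
    have := (hs.mul_mul_conjTranspose_same e).trace_nonneg
    rwa [conjTranspose_eq_transpose_of_trivial, het] at this
  refine le_of_sq_le_sq ?_ (frob_nonneg _)
  have h1 : frob (e + e * s) ^ 2 = frob e ^ 2 + 2 * (e * s * e).trace + frob (e * s) ^ 2 := by
    rw [frob_sq, frob_sq, frob_sq, transpose_add, transpose_mul, het, hst]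
    simp only [Matrix.add_mul, Matrix.mul_add, trace_add]
    have : (e * (e * s)).trace = (e * s * e).trace := by rw [trace_mul_comm]
    rw [this, hcomm]; ring
  rw [hc, h1]
  nlinarith [sq_nonneg (frob (e * s))]

lemma frob_mul_of_gram_eq_one {q : Matrix (Fin d) (Fin r) ℝ} (hq : qᵀ * q = 1)
    (m : Matrix (Fin r) (Fin r) ℝ) : frob (q * m) = frob m := by
  have h : frob (q * m) ^ 2 = frob m ^ 2 := by
    rw [frob_sq, frob_sq, transpose_mul, Matrix.mul_assoc, ← Matrix.mul_assoc qᵀ, hq,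
      Matrix.one_mul]
  exact (pow_left_inj₀ (frob_nonneg _) (frob_nonneg _) two_ne_zero).1 h

/-- All points of the manifold have the same norm, so only the linear terms of the two squared
distances differ, and their difference is the squared distance from `q` to `q'` weighted by the
polar factor `s`. Positivity of `s` makes `q` a nearest point. -/
lemma norm_sub_sq_polar {x q q' : MatSpace d r} {s : Matrix (Fin r) (Fin r) ℝ} (hst : sᵀ = s)
    (hx : toMat x = toMat q * s) (hq : q ∈ stiefel d r) (hq' : q' ∈ stiefel d r) :
    ‖x - q'‖ ^ 2
      = ‖x - q‖ ^ 2 + (toMat (q - q') * s * (toMat (q - q'))ᵀ).trace := by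
  rw [mem_stiefel_iff] at hq hq'
  have e (p : MatSpace d r) (hp : (toMat p)ᵀ * toMat p = 1) :
      ‖x - p‖ ^ 2 = ‖x‖ ^ 2 - 2 * (s * ((toMat q)ᵀ * toMat p)).trace + r := by
    rw [norm_sub_sq_real, inner_eq_trace, hx, transpose_mul, hst, Matrix.mul_assoc,
      ← frob_toMat p, frob_sq, hp, trace_one, Fintype.card_fin]
  have e2 : (toMat (q - q') * s * (toMat (q - q'))ᵀ).trace
      = 2 * s.trace - 2 * (s * ((toMat q)ᵀ * toMat q')).trace := by
    have h1 : (s * ((toMat q')ᵀ * toMat q)).trace = (s * ((toMat q)ᵀ * toMat q')).trace := by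
      rw [← trace_transpose, transpose_mul, transpose_mul, transpose_transpose, hst,
        trace_mul_comm]
    rw [trace_mul_comm, ← Matrix.mul_assoc, trace_mul_comm, toMat_sub, transpose_sub]
    simp only [Matrix.sub_mul, Matrix.mul_sub, trace_sub, hq, hq', Matrix.mul_one, h1]
    ring
  rw [e q' hq', e q hq, e2, hq, Matrix.mul_one]
  ring

/-- This says `s ≥ 3/4` as a quadratic form. It serves twice: for the invertibility of `s` and for
the uniqueness of the nearest point. -/
lemma le_trace_mul_mul_transpose {s : Matrix (Fin r) (Fin r) ℝ} (hs : frob (s - 1) ≤ 1 / 4)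
    (m : Matrix (Fin d) (Fin r) ℝ) : 3 / 4 * frob m ^ 2 ≤ (m * s * mᵀ).trace := by
  have e : (m * s * mᵀ).trace = frob m ^ 2 + (mᵀ * (m * (s - 1))).trace := by
    rw [frob_sq, trace_mul_comm, Matrix.mul_sub, Matrix.mul_sub, Matrix.mul_one, trace_sub]
    ring
  have h1 := (abs_le.1 (abs_trace_transpose_mul_le m (m * (s - 1)))).1
  have h2 := mul_le_mul_of_nonneg_left (frob_mul_le m (s - 1)) (frob_nonneg m)
  have h3 : frob m * (frob m * frob (s - 1)) ≤ frob m * (frob m * (1 / 4)) :=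
    mul_le_mul_of_nonneg_left (mul_le_mul_of_nonneg_left hs (frob_nonneg m)) (frob_nonneg m)
  rw [e]
  nlinarith

/-- Near the Stiefel manifold, the nearest point is unique and its distance is controlled by the
infeasibility. -/
lemma exists_unique_nearest_stiefel {x : MatSpace d r} (hx : ‖constr x‖ ≤ 1 / 4) :
    ∃ q, nearestPts (stiefel d r) x = {q} ∧ q ∈ stiefel d r ∧ ‖x - q‖ ≤ ‖constr x‖ := by
  obtain ⟨s, hs, hss⟩ := exists_sqrt_gram x
  have hst : s.IsSymm := by simpa using hs.1
  replace hst : sᵀ = s := hst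
  have hsC : s * s - 1 = toMat (constr x) := by rw [hss, toMat_constr]
  have hse : frob (s - 1) ≤ ‖constr x‖ := by
    have := frob_sub_one_le hs
    rwa [hsC, frob_constr] at this
  have hunit : IsUnit s.det := by
    rw [isUnit_iff_ne_zero]
    intro h0
    obtain ⟨v, hv, hsv⟩ := exists_mulVec_eq_zero_iff.2 h0
    -- A kernel vector of `s`, placed as a single row, contradicts the lower bound on the quadratic
    -- form.
    let m : Matrix (Fin 1) (Fin r) ℝ := Matrix.of fun _ j => v j
    have hm : m * s = 0 := by
      rw [← transpose_inj, transpose_mul, hst, transpose_zero]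
      ext i j
      have := congrFun hsv i
      simpa [Matrix.mul_apply, Matrix.mulVec, dotProduct, m] using this
    have h1 := le_trace_mul_mul_transpose (hse.trans hx) m
    rw [hm, Matrix.zero_mul, trace_zero] at h1
    have h2 : frob m = 0 := by nlinarith [frob_nonneg m]
    have h3 := eq_zero_of_frob_eq_zero h2
    exact hv (funext fun j => congrFun (congrFun h3 0) j)
  have hinv : s * s⁻¹ = 1 := mul_nonsing_inv s hunit
  have hinv' : s⁻¹ * s = 1 := nonsing_inv_mul s hunit
  -- The orthogonal polar factor `x s⁻¹`.
  set q : MatSpace d r := ofMat (toMat x * s⁻¹) with hqdef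
  have hxq : toMat x = toMat q * s := by
    rw [hqdef, toMat_ofMat, Matrix.mul_assoc, hinv', Matrix.mul_one]
  have hq : q ∈ stiefel d r := by
    rw [mem_stiefel_iff, hqdef, toMat_ofMat, transpose_mul, transpose_nonsing_inv, hst,
      Matrix.mul_assoc, ← Matrix.mul_assoc _ (toMat x), ← hss, ← Matrix.mul_assoc,
      ← Matrix.mul_assoc, hinv', Matrix.one_mul, hinv]
  have hdist : ‖x - q‖ ≤ ‖constr x‖ := by
    rw [← frob_toMat (x - q), toMat_sub, hxq]
    have : toMat q * s - toMat q = toMat q * (s - 1) := by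
      rw [Matrix.mul_sub, Matrix.mul_one]
    rw [this, frob_mul_of_gram_eq_one ((mem_stiefel_iff q).1 hq)]
    exact hse
  have key (q' : MatSpace d r) (hq' : q' ∈ stiefel d r) :
      ‖x - q‖ ^ 2 + 3 / 4 * ‖q - q'‖ ^ 2 ≤ ‖x - q'‖ ^ 2 := by
    rw [norm_sub_sq_polar hst hxq hq hq', ← frob_toMat (q - q')]
    linarith [le_trace_mul_mul_transpose (hse.trans hx) (toMat (q - q'))]
  refine ⟨q, Set.eq_singleton_iff_unique_mem.2 ⟨⟨hq, fun q' hq' => ?_⟩, fun q' hq' => ?_⟩,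
    hq, hdist⟩
  · refine le_of_sq_le_sq ?_ (norm_nonneg _)
    linarith [key q' hq', sq_nonneg ‖q - q'‖]
  · have h1 := key q' hq'.1
    have h2 := pow_le_pow_left₀ (norm_nonneg _) (hq'.2 q hq) 2
    have h3 : ‖q - q'‖ ^ 2 ≤ 0 := by linarith
    have h4 : ‖q - q'‖ = 0 := by nlinarith [norm_nonneg (q - q')]
    exact (sub_eq_zero.1 (norm_eq_zero.1 h4)).symm

end Polar

end SmMGDA

end

/-! ### Smooth and convex inequalities on convex sets. -/

noncomputable section

namespace SmMGDA

open Filter Topology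

section ConvexAnalysis

variable {E : Type*} [NormedAddCommGroup E] [InnerProductSpace ℝ E]

section Gradient

variable [CompleteSpace E]

lemma hasDerivAt_comp_line {φ : E → ℝ} {g x u : E} {s : ℝ}
    (h : HasGradientAt φ g (x + s • u)) :
    HasDerivAt (fun s : ℝ => φ (x + s • u)) (inner ℝ g u) s := by
  have h1 : HasDerivAt (fun s : ℝ => x + s • u) u s := by
    simpa using ((hasDerivAt_id s).smul_const u).const_add x
  have h2 := (hasGradientAt_iff_hasFDerivAt.1 h).comp_hasDerivAt s h1
  simp only [InnerProductSpace.toDual_apply_apply] at h2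
  exact h2

/-- The descent lemma. After subtracting the claimed quadratic along the segment, the derivative is
nonpositive by the Lipschitz bound, so monotonicity replaces integration of the gradient. -/
lemma le_quadratic_of_lipschitz_gradient {φ : E → ℝ} {g : E → E} {S : Set E} {K : ℝ}
    (hS : Convex ℝ S) (hg : ∀ x ∈ S, HasGradientAt φ (g x) x)
    (hK : ∀ x ∈ S, ∀ y ∈ S, ‖g x - g y‖ ≤ K * ‖x - y‖) {x y : E} (hx : x ∈ S) (hy : y ∈ S) :
    φ y ≤ φ x + inner ℝ (g x) (y - x) + K / 2 * ‖y - x‖ ^ 2 := by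
  set u := y - x with hu
  have hmem : ∀ s ∈ Set.Icc (0 : ℝ) 1, x + s • u ∈ S := fun s hs =>
    hS.add_smul_sub_mem hx hy hs
  let ψ : ℝ → ℝ := fun s => φ (x + s • u) - s * inner ℝ (g x) u - K / 2 * ‖u‖ ^ 2 * s ^ 2
  have hd : ∀ s ∈ Set.Icc (0 : ℝ) 1, HasDerivAt ψ
      (inner ℝ (g (x + s • u)) u - inner ℝ (g x) u - K / 2 * ‖u‖ ^ 2 * (2 * s)) s := by
    intro s hs
    have h1 := hasDerivAt_comp_line (hg _ (hmem s hs))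
    have h2 := (hasDerivAt_id s).mul_const (inner ℝ (g x) u)
    have h3 := ((hasDerivAt_id s).pow 2).const_mul (K / 2 * ‖u‖ ^ 2)
    refine ((h1.sub h2).sub h3).congr_deriv ?_
    simp
  have hanti : AntitoneOn ψ (Set.Icc 0 1) := by
    refine antitoneOn_of_hasDerivWithinAt_nonpos (convex_Icc 0 1)
      (fun s hs => (hd s hs).continuousAt.continuousWithinAt)
      (fun s hs => (hd s (interior_subset hs)).hasDerivWithinAt) fun s hs => ?_
    have hs' := interior_subset hs
    rw [← inner_sub_left]
    have h1 := (real_inner_le_norm (g (x + s • u) - g x) u).trans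
      (mul_le_mul_of_nonneg_right (hK _ (hmem s hs') x hx) (norm_nonneg u))
    rw [add_sub_cancel_left, norm_smul, Real.norm_eq_abs, abs_of_nonneg hs'.1] at h1
    linarith
  have h := hanti (Set.left_mem_Icc.2 zero_le_one) (Set.right_mem_Icc.2 zero_le_one) zero_le_one
  simp only [ψ, one_smul, zero_smul, add_zero] at h
  rw [hu, add_sub_cancel] at h
  linarith

lemma quadratic_le_of_lipschitz_gradient {φ : E → ℝ} {g : E → E} {S : Set E} {K : ℝ}
    (hS : Convex ℝ S) (hg : ∀ x ∈ S, HasGradientAt φ (g x) x)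
    (hK : ∀ x ∈ S, ∀ y ∈ S, ‖g x - g y‖ ≤ K * ‖x - y‖) {x y : E} (hx : x ∈ S) (hy : y ∈ S) :
    φ x + inner ℝ (g x) (y - x) - K / 2 * ‖y - x‖ ^ 2 ≤ φ y := by
  have h := le_quadratic_of_lipschitz_gradient (φ := fun x => -φ x) (g := fun x => -g x) hS
    (fun x hx => by
      have := (hasGradientAt_iff_hasFDerivAt.1 (hg x hx)).neg
      rw [← map_neg] at this
      exact hasGradientAt_iff_hasFDerivAt.2 this)
    (fun x hx y hy => by
      rw [neg_sub_neg, norm_sub_rev]; exact hK x hx y hy) hx hy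
  rw [inner_neg_left] at h
  linarith

lemma le_of_concaveOn_of_hasGradientAt {φ : E → ℝ} {g : E} {S : Set E} (hφ : ConcaveOn ℝ S φ)
    {x y : E} (hx : x ∈ S) (hy : y ∈ S) (hg : HasGradientAt φ g x) :
    φ y ≤ φ x + inner ℝ g (y - x) := by
  set u := y - x with hu
  have hc : ConcaveOn ℝ (Set.Icc (0 : ℝ) 1) (fun s : ℝ => φ (x + s • u)) := by
    refine ⟨convex_Icc 0 1, fun a ha b hb p q hp hq hpq => ?_⟩
    have h1 := hφ.1.add_smul_sub_mem hx hy ha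
    have h2 := hφ.1.add_smul_sub_mem hx hy hb
    have h3 := hφ.2 h1 h2 hp hq hpq
    convert h3 using 2
    rw [← hu]
    have : x = p • x + q • x := by rw [← add_smul, hpq, one_smul]
    nth_rewrite 1 [this]
    simp only [smul_eq_mul]
    module
  have hd : HasDerivAt (fun s : ℝ => φ (x + s • u)) (inner ℝ g u) 0 :=
    hasDerivAt_comp_line (by simpa using hg)
  have h := hc.slope_le_of_hasDerivWithinAt_Ioi (Set.left_mem_Icc.2 zero_le_one)
    (Set.right_mem_Icc.2 zero_le_one) zero_lt_one hd.hasDerivWithinAt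
  simp only [slope, sub_zero, inv_one, one_smul, zero_smul, add_zero, vsub_eq_sub] at h
  rw [hu, add_sub_cancel] at h
  linarith

/-- A bound on the gradient along a convex set gives a bound on increments. -/
lemma sub_le_of_gradient_bound {φ : E → ℝ} {g : E → E} {S : Set E} {K : ℝ}
    (hS : Convex ℝ S) (hg : ∀ x ∈ S, HasGradientAt φ (g x) x)
    (hK : ∀ x ∈ S, ‖g x‖ ≤ K) {x y : E} (hx : x ∈ S) (hy : y ∈ S) :
    φ y - φ x ≤ K * ‖y - x‖ := by
  have h := hS.norm_image_sub_le_of_norm_hasFDerivWithin_le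
    (fun z hz => (hasGradientAt_iff_hasFDerivAt.1 (hg z hz)).hasFDerivWithinAt)
    (fun z hz => by rw [LinearIsometryEquiv.norm_map]; exact hK z hz) hx hy
  exact (le_abs_self _).trans h

end Gradient

/-- The quadratic growth at the maximizer of a strongly concave function. -/
lemma quadratic_growth_of_isMaxOn {φ : E → ℝ} {S : Set E} (hφ : ConcaveOn ℝ S φ) {θ : ℝ}
    {z : E} (hz : z ∈ S)
    (hmax : IsMaxOn (fun y => φ y - θ / 2 * ‖y‖ ^ 2) S z) {y : E} (hy : y ∈ S) :
    φ y - θ / 2 * ‖y‖ ^ 2 + θ / 2 * ‖y - z‖ ^ 2 ≤ φ z - θ / 2 * ‖z‖ ^ 2 := by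
  -- Compare `z` with the point at fraction `s` on the way to `y`, divide by `s`, and then let `s`
  -- tend to `0`.
  have key : ∀ s ∈ Set.Ioo (0 : ℝ) 1,
      φ y - θ / 2 * ‖y‖ ^ 2 + (1 - s) * (θ / 2 * ‖y - z‖ ^ 2) ≤ φ z - θ / 2 * ‖z‖ ^ 2 := by
    intro s hs
    have h1 := hφ.2 hz hy (sub_nonneg.2 hs.2.le) hs.1.le (sub_add_cancel 1 s)
    have hm := hφ.1 hz hy (sub_nonneg.2 hs.2.le) hs.1.le (sub_add_cancel 1 s)
    have h2 : φ ((1 - s) • z + s • y) - θ / 2 * ‖(1 - s) • z + s • y‖ ^ 2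
      ≤ φ z - θ / 2 * ‖z‖ ^ 2 := hmax hm
    have h3 : ‖(1 - s) • z + s • y‖ ^ 2
        = (1 - s) * ‖z‖ ^ 2 + s * ‖y‖ ^ 2 - s * (1 - s) * ‖y - z‖ ^ 2 := by
      rw [norm_add_sq_real, norm_sub_sq_real, norm_smul, norm_smul, inner_smul_left,
        inner_smul_right, Real.norm_eq_abs, Real.norm_eq_abs, abs_of_pos hs.1,
        abs_of_pos (sub_pos.2 hs.2), real_inner_comm]
      simp only [conj_trivial]
      ring
    rw [h3] at h2
    simp only [smul_eq_mul] at h1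
    have h4 : s * (φ y - θ / 2 * ‖y‖ ^ 2 + (1 - s) * (θ / 2 * ‖y - z‖ ^ 2))
        ≤ s * (φ z - θ / 2 * ‖z‖ ^ 2) := by
      linarith
    exact le_of_mul_le_mul_left h4 hs.1
  have ht : Tendsto (fun s : ℝ => φ y - θ / 2 * ‖y‖ ^ 2 + (1 - s) * (θ / 2 * ‖y - z‖ ^ 2))
      (𝓝[>] 0) (𝓝 (φ y - θ / 2 * ‖y‖ ^ 2 + (1 - 0) * (θ / 2 * ‖y - z‖ ^ 2))) := by
    refine Tendsto.mono_left (Continuous.tendsto ?_ 0) nhdsWithin_le_nhds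
    fun_prop
  have := le_of_tendsto ht (by
    filter_upwards [Ioo_mem_nhdsGT (zero_lt_one' ℝ)] with s hs using key s hs)
  rwa [sub_zero, one_mul] at this

/-- The three-point inequality for the minimizer of `h + ‖· - v‖² / (2 τ)`. -/
lemma three_point_of_isMinOn {h : E → ℝ} {S : Set E} (hh : ConvexOn ℝ S h) {τ : ℝ} (hτ : 0 < τ)
    {u v : E} (hu : u ∈ S) (hmin : IsMinOn (fun w => h w + ‖w - v‖ ^ 2 / (2 * τ)) S u) {w : E}
    (hw : w ∈ S) : h u + inner ℝ (τ⁻¹ • (v - u)) (w - u) ≤ h w := by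
  -- Up to a constant, the proximal objective is the negative of this concave function plus `τ⁻¹/2
  -- ‖·‖²`. The quadratic growth at the maximizer then cancels the quadratic terms exactly and
  -- leaves a subgradient inequality.
  have hφ : ConcaveOn ℝ S (fun w => inner ℝ (τ⁻¹ • v) w - h w) := by
    refine ConcaveOn.sub ⟨hh.1, fun a _ b _ p q _ _ _ => ?_⟩ hh
    rw [inner_add_right, inner_smul_right, inner_smul_right, smul_eq_mul, smul_eq_mul]
  have e : ∀ w, ‖w - v‖ ^ 2 / (2 * τ)
      = τ⁻¹ / 2 * ‖w‖ ^ 2 - inner ℝ (τ⁻¹ • v) w + τ⁻¹ / 2 * ‖v‖ ^ 2 := by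
    intro w
    rw [norm_sub_sq_real, inner_smul_left, real_inner_comm]
    simp only [conj_trivial]
    field_simp
  have h1 := quadratic_growth_of_isMaxOn hφ (θ := τ⁻¹) hu (fun w hw => by
    have h2 : h u + ‖u - v‖ ^ 2 / (2 * τ) ≤ h w + ‖w - v‖ ^ 2 / (2 * τ) := hmin hw
    rw [e, e] at h2
    change inner ℝ (τ⁻¹ • v) w - h w - τ⁻¹ / 2 * ‖w‖ ^ 2
      ≤ inner ℝ (τ⁻¹ • v) u - h u - τ⁻¹ / 2 * ‖u‖ ^ 2
    linarith) hw
  have e2 : ‖w - u‖ ^ 2 = ‖w‖ ^ 2 - 2 * inner ℝ u w + ‖u‖ ^ 2 := by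
    rw [norm_sub_sq_real, real_inner_comm]
  have e3 : inner ℝ (τ⁻¹ • (v - u)) (w - u)
      = inner ℝ (τ⁻¹ • v) w - inner ℝ (τ⁻¹ • v) u - τ⁻¹ * inner ℝ u w + τ⁻¹ * ‖u‖ ^ 2 := by
    rw [smul_sub, inner_sub_right, inner_sub_left, inner_sub_left, inner_smul_left u w,
      inner_smul_left u u, real_inner_self_eq_norm_sq]
    simp only [conj_trivial]
    ring
  rw [e2] at h1
  rw [e3]
  linarith

end ConvexAnalysis

end SmMGDA

end

/-! ### Projection, proximal map and subgradients of the regularizer. -/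

noncomputable section

namespace SmMGDA

open Filter Topology

section Regularizer

/-- The only property of the projection that is needed, since the gradient steps never leave the
ball. -/
lemma proj_of_mem {E : Type*} [NormedAddCommGroup E] {S : Set E} {v : E} (hv : v ∈ S) :
    proj S v = v := by
  have h : proj S v ∈ nearestPts S v :=
    Classical.epsilon_spec (p := fun q => q ∈ nearestPts S v)
      ⟨v, hv, fun q' _ => by simp⟩
  have h1 := h.2 v hv
  rw [sub_self, norm_zero] at h1
  exact (sub_eq_zero.1 (norm_le_zero_iff.1 h1)).symm

variable {F : Type*} [NormedAddCommGroup F] [InnerProductSpace ℝ F] {h : F → EReal}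

namespace IsRegularizer

lemma coe_toReal (hh : IsRegularizer h) {y : F} (hy : y ∈ effDom h) :
    ((h y).toReal : EReal) = h y :=
  EReal.coe_toReal (ne_of_lt hy) (hh.ne_bot y)

lemma convexOn (hh : IsRegularizer h) : ConvexOn ℝ (effDom h) fun y => (h y).toReal := by
  have key : ∀ ⦃x⦄, x ∈ effDom h → ∀ ⦃y⦄, y ∈ effDom h → ∀ ⦃a b : ℝ⦄, 0 ≤ a → 0 ≤ b → a + b = 1 →
      h (a • x + b • y) ≤ ((a * (h x).toReal + b * (h y).toReal : ℝ) : EReal) := by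
    intro x hx y hy a b ha hb hab
    exact hh.convex_epi (x := (x, (h x).toReal)) (hh.coe_toReal hx).ge
      (y := (y, (h y).toReal)) (hh.coe_toReal hy).ge ha hb hab
  refine ⟨fun x hx y hy a b ha hb hab => (key hx hy ha hb hab).trans_lt (EReal.coe_lt_top _),
    fun x hx y hy a b ha hb hab => ?_⟩
  have h1 := key hx hy ha hb hab
  rw [← hh.coe_toReal (h1.trans_lt (EReal.coe_lt_top _))] at h1
  exact EReal.coe_le_coe_iff.1 h1

lemma isCompact_effDom [FiniteDimensional ℝ F] (hh : IsRegularizer h) :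
    IsCompact (effDom h) :=
  Metric.isCompact_of_isClosed_isBounded hh.closed_dom hh.bounded_dom

lemma continuousOn (hh : IsRegularizer h) : ContinuousOn (fun y => (h y).toReal) (effDom h) :=
  hh.locallyLipschitz.continuousOn

lemma mem_subdiff_iff (hh : IsRegularizer h) {y g : F} (hy : y ∈ effDom h) :
    g ∈ subdiff h y ↔
      ∀ w ∈ effDom h, (h y).toReal + inner ℝ g (w - y) ≤ (h w).toReal := by
  refine ⟨fun hg w hw => ?_, fun hg w => ?_⟩
  · have := hg w
    rw [← hh.coe_toReal hy, ← hh.coe_toReal hw] at this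
    exact EReal.coe_le_coe_iff.1 this
  · by_cases hw : w ∈ effDom h
    · rw [← hh.coe_toReal hy, ← hh.coe_toReal hw]
      exact EReal.coe_le_coe_iff.2 (hg w hw)
    · have : h w = ⊤ := not_lt_top_iff.1 hw
      rw [this]; exact le_top

/-- Compactness of the domain gives a minimizer, so the choice in `prox` is meaningful; its
optimality condition is the three-point inequality. -/
lemma prox_spec [FiniteDimensional ℝ F] (hh : IsRegularizer h) {τ : ℝ} (hτ : 0 < τ) (v : F) :
    prox h τ v ∈ effDom h ∧ τ⁻¹ • (v - prox h τ v) ∈ subdiff h (prox h τ v) := by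
  have hex : ∃ u, ∀ w, h u + ((‖u - v‖ ^ 2 / (2 * τ) : ℝ) : EReal) ≤
      h w + ((‖w - v‖ ^ 2 / (2 * τ) : ℝ) : EReal) := by
    obtain ⟨u, hu, hmin⟩ := hh.isCompact_effDom.exists_isMinOn hh.proper
      (f := fun w => (h w).toReal + ‖w - v‖ ^ 2 / (2 * τ))
      (hh.continuousOn.add (by fun_prop))
    refine ⟨u, fun w => ?_⟩
    by_cases hw : w ∈ effDom h
    · rw [← hh.coe_toReal hu, ← hh.coe_toReal hw]
      exact EReal.coe_le_coe_iff.2 (hmin hw)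
    · have : h w = ⊤ := not_lt_top_iff.1 hw
      rw [this, EReal.top_add_coe]; exact le_top
  have hmin : ∀ w, h (prox h τ v) + ((‖prox h τ v - v‖ ^ 2 / (2 * τ) : ℝ) : EReal) ≤
      h w + ((‖w - v‖ ^ 2 / (2 * τ) : ℝ) : EReal) := Classical.epsilon_spec hex
  set u := prox h τ v with hu
  have huY : u ∈ effDom h := by
    obtain ⟨w, hw⟩ := hh.proper
    have h1 := hmin w
    rw [← hh.coe_toReal hw] at h1
    by_contra hcon
    have htop : h u = ⊤ := not_lt_top_iff.1 hcon
    rw [htop, EReal.top_add_coe, top_le_iff, ← EReal.coe_add] at h1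
    exact EReal.coe_ne_top _ h1
  refine ⟨huY, (hh.mem_subdiff_iff huY).2 fun w hw => ?_⟩
  refine three_point_of_isMinOn hh.convexOn hτ huY (fun w hw => ?_) hw
  have h1 := hmin w
  rw [← hh.coe_toReal hw, ← hh.coe_toReal huY] at h1
  exact EReal.coe_le_coe_iff.1 h1

/-- Subgradients exist at every point of the domain, with a uniform bound. -/
lemma exists_bounded_subgradient [FiniteDimensional ℝ F] (hh : IsRegularizer h) :
    ∃ Λ : ℝ, 0 ≤ Λ ∧ ∀ y ∈ effDom h, ∃ g ∈ subdiff h y, ‖g‖ ≤ Λ := by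
  obtain ⟨Λ, hΛ⟩ := hh.locallyLipschitz.exists_lipschitzOnWith_of_compact hh.isCompact_effDom
  refine ⟨Λ, Λ.2, fun y hy => ?_⟩
  -- Subgradients at `y` are obtained as limits of those at the proximal points `u n` as the
  -- proximal parameter tends to zero. The Lipschitz constant of `h` bounds them all, so a
  -- subsequence converges and continuity of `h` passes to the limit.
  let τ : ℕ → ℝ := fun n => 1 / ((n : ℝ) + 1)
  have hτ : ∀ n, 0 < τ n := fun n => by positivity
  have hτ0 : Tendsto τ atTop (𝓝 0) := tendsto_one_div_add_atTop_nhds_zero_nat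
  let u : ℕ → F := fun n => prox h (τ n) y
  let p : ℕ → F := fun n => (τ n)⁻¹ • (y - u n)
  have hu : ∀ n, u n ∈ effDom h := fun n => (hh.prox_spec (hτ n) y).1
  have hp : ∀ n, ∀ w ∈ effDom h, (h (u n)).toReal + inner ℝ (p n) (w - u n) ≤ (h w).toReal :=
    fun n => (hh.mem_subdiff_iff (hu n)).1 (hh.prox_spec (hτ n) y).2
  have hyu : ∀ n, y - u n = τ n • p n := fun n => by
    simp only [p]; rw [smul_inv_smul₀ (hτ n).ne']
  have hpΛ : ∀ n, ‖p n‖ ≤ Λ := by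
    intro n
    have h1 := hp n y hy
    rw [hyu, inner_smul_right, real_inner_self_eq_norm_sq] at h1
    have h2 := (le_abs_self _).trans (hΛ.dist_le_mul y hy (u n) (hu n))
    rw [dist_eq_norm, hyu, norm_smul, Real.norm_eq_abs, abs_of_pos (hτ n)] at h2
    have h3 : (τ n * ‖p n‖) * ‖p n‖ ≤ (τ n * ‖p n‖) * Λ := by nlinarith
    rcases (norm_nonneg (p n)).eq_or_lt with h0 | h0
    · rw [← h0]; exact Λ.2
    · exact le_of_mul_le_mul_left h3 (mul_pos (hτ n) h0)
  have hut : Tendsto u atTop (𝓝 y) := by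
    rw [tendsto_iff_norm_sub_tendsto_zero]
    refine squeeze_zero (fun _ => norm_nonneg _) (fun n => ?_)
      (by simpa using hτ0.mul_const (Λ : ℝ))
    rw [norm_sub_rev, hyu, norm_smul, Real.norm_eq_abs, abs_of_pos (hτ n)]
    exact mul_le_mul_of_nonneg_left (hpΛ n) (hτ n).le
  obtain ⟨g, hg, ψ, hψ, hgt⟩ := (isCompact_closedBall (0 : F) Λ).tendsto_subseq
    (fun n => mem_closedBall_zero_iff.2 (hpΛ n))
  refine ⟨g, (hh.mem_subdiff_iff hy).2 fun w hw => ?_, mem_closedBall_zero_iff.1 hg⟩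
  have h1 : Tendsto (fun n => (h (u (ψ n))).toReal) atTop (𝓝 (h y).toReal) :=
    (hh.continuousOn y hy).tendsto.comp (tendsto_nhdsWithin_iff.2
      ⟨hut.comp hψ.tendsto_atTop, Eventually.of_forall fun n => hu _⟩)
  have h2 : Tendsto (fun n => inner ℝ (p (ψ n)) (w - u (ψ n))) atTop (𝓝 (inner ℝ g (w - y))) :=
    hgt.inner ((hut.comp hψ.tendsto_atTop).const_sub w)
  exact le_of_tendsto (h1.add h2) (Eventually.of_forall fun n => hp _ w hw)

end IsRegularizer

end Regularizer

end SmMGDA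

end

/-! ### One step of the minimax method: value function and best response. -/

noncomputable section

namespace SmMGDA

open Filter Topology

section SaddleStep

variable {E V : Type*} [NormedAddCommGroup E] [InnerProductSpace ℝ E] [CompleteSpace E]
  [NormedAddCommGroup V] [InnerProductSpace ℝ V] [CompleteSpace V]

/-- The objective `F(x, y) - h(y)` of a minimax problem on `X × Y`, smooth in `x` and composite
concave in `y`. -/
structure IsSaddleObjective (F : E → V → ℝ) (h : V → ℝ) (X : Set E) (Y : Set V) (l L : ℝ) :
    Prop where
  convex_X : Convex ℝ X
  compact_Y : IsCompact Y
  nonempty_Y : Y.Nonempty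
  convexOn : ConvexOn ℝ Y h
  continuousOn : ContinuousOn h Y
  concaveOn : ∀ x ∈ X, ConcaveOn ℝ Y (F x)
  hasGradX : ∀ x ∈ X, ∀ y ∈ Y, HasGradientAt (fun x' => F x' y) (gradX F x y) x
  hasGradY : ∀ x ∈ X, ∀ y ∈ Y, HasGradientAt (F x) (gradY F x y) y
  nonneg : 0 ≤ l
  lip_x : ∀ x₁ ∈ X, ∀ x₂ ∈ X, ∀ y₁ ∈ Y, ∀ y₂ ∈ Y,
    ‖gradX F x₁ y₁ - gradX F x₂ y₂‖ ≤ l * (‖x₁ - x₂‖ + ‖y₁ - y₂‖)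
  lip_y : ∀ x₁ ∈ X, ∀ x₂ ∈ X, ∀ y ∈ Y, ‖gradY F x₁ y - gradY F x₂ y‖ ≤ l * ‖x₁ - x₂‖
  lip_yy : ∀ x ∈ X, ∀ y₁ ∈ Y, ∀ y₂ ∈ Y, ‖gradY F x y₁ - gradY F x y₂‖ ≤ L * ‖y₁ - y₂‖

/-- The regularized objective `F(x, y) - h(y) - θ/2 ‖y‖²`. -/
def regObjective (F : E → V → ℝ) (h : V → ℝ) (θ : ℝ) (x : E) (y : V) : ℝ :=
  F x y - h y - θ / 2 * ‖y‖ ^ 2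

/-- `z` maximizes the regularized objective at `x` over `Y`. -/
def IsBestResponse (F : E → V → ℝ) (h : V → ℝ) (Y : Set V) (θ : ℝ) (x : E) (z : V) : Prop :=
  z ∈ Y ∧ IsMaxOn (regObjective F h θ x) Y z

namespace IsSaddleObjective

variable {F : E → V → ℝ} {h : V → ℝ} {X : Set E} {Y : Set V} {l L : ℝ}

lemma exists_isBestResponse (H : IsSaddleObjective F h X Y l L) (θ : ℝ) {x : E} (hx : x ∈ X) :
    ∃ z, IsBestResponse F h Y θ x z := by
  refine H.compact_Y.exists_isMaxOn H.nonempty_Y (f := regObjective F h θ x) ?_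
  have h1 : ContinuousOn (F x) Y := fun y hy =>
    (H.hasGradY x hx y hy).differentiableAt.continuousAt.continuousWithinAt
  exact (h1.sub H.continuousOn).sub (by fun_prop)

lemma quadratic_growth (H : IsSaddleObjective F h X Y l L) {θ : ℝ} {x : E} (hx : x ∈ X) {z : V}
    (hz : IsBestResponse F h Y θ x z) {y : V} (hy : y ∈ Y) :
    regObjective F h θ x y + θ / 2 * ‖y - z‖ ^ 2 ≤ regObjective F h θ x z :=
  quadratic_growth_of_isMaxOn ((H.concaveOn x hx).sub H.convexOn) hz.1 hz.2 hy

lemma lip_xx (H : IsSaddleObjective F h X Y l L) {y : V} (hy : y ∈ Y) :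
    ∀ x₁ ∈ X, ∀ x₂ ∈ X, ‖gradX F x₁ y - gradX F x₂ y‖ ≤ l * ‖x₁ - x₂‖ := fun x₁ h₁ x₂ h₂ => by
  simpa using H.lip_x x₁ h₁ x₂ h₂ y hy y hy

lemma lip_xy (H : IsSaddleObjective F h X Y l L) {x : E} (hx : x ∈ X) :
    ∀ y₁ ∈ Y, ∀ y₂ ∈ Y, ‖gradX F x y₁ - gradX F x y₂‖ ≤ l * ‖y₁ - y₂‖ := fun y₁ h₁ y₂ h₂ => by
  simpa using H.lip_x x hx x hx y₁ h₁ y₂ h₂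

/-- Decrease of the regularized value function along a gradient step in `x`. -/
lemma value_descent (H : IsSaddleObjective F h X Y l L) {θ₁ θ₂ η R : ℝ} {x₁ x₂ : E}
    {y z₁ z₂ : V} (hx₁ : x₁ ∈ X) (hx₂ : x₂ ∈ X) (hy : y ∈ Y)
    (hz₁ : IsBestResponse F h Y θ₁ x₁ z₁) (hz₂ : z₂ ∈ Y) (hθ : θ₂ ≤ θ₁) (hη : 0 ≤ η)
    (hR : ‖z₂‖ ≤ R) (hstep : x₂ = x₁ - η • gradX F x₁ y) :
    regObjective F h θ₂ x₂ z₂ ≤ regObjective F h θ₁ x₁ z₁ - η * ‖gradX F x₁ y‖ ^ 2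
      + η * (l * ‖y - z₂‖) * ‖gradX F x₁ y‖ + l / 2 * (η * ‖gradX F x₁ y‖) ^ 2
      + (θ₁ - θ₂) * R ^ 2 / 2 := by
  -- Freezing `y` at the new best response `z₂` compares the two values through the smooth function
  -- `F(·, z₂)`, so differentiability of the value function is not needed.
  have h1 : regObjective F h θ₁ x₁ z₂ ≤ regObjective F h θ₁ x₁ z₁ := hz₁.2 hz₂
  have h2 := le_quadratic_of_lipschitz_gradient H.convex_X
    (fun x hx => H.hasGradX x hx z₂ hz₂) (H.lip_xx hz₂) hx₁ hx₂
  have h3 := H.lip_xy hx₁ y hy z₂ hz₂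
  set G := gradX F x₁ y with hG
  have hu : x₂ - x₁ = -(η • G) := by rw [hstep]; abel
  have hun : ‖x₂ - x₁‖ = η * ‖G‖ := by
    rw [hu, norm_neg, norm_smul, Real.norm_eq_abs, abs_of_nonneg hη]
  have h4 : inner ℝ (gradX F x₁ z₂) (x₂ - x₁)
      = -(η * ‖G‖ ^ 2) + η * inner ℝ (G - gradX F x₁ z₂) G := by
    rw [hu, inner_neg_right, inner_smul_right, inner_sub_left, real_inner_self_eq_norm_sq]
    ring
  have h5 := mul_le_mul_of_nonneg_left ((real_inner_le_norm (G - gradX F x₁ z₂) G).trans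
    (mul_le_mul_of_nonneg_right h3 (norm_nonneg G))) hη
  have h6 : (θ₁ - θ₂) * ‖z₂‖ ^ 2 ≤ (θ₁ - θ₂) * R ^ 2 :=
    mul_le_mul_of_nonneg_left (pow_le_pow_left₀ (norm_nonneg _) hR 2) (sub_nonneg.2 hθ)
  rw [h4, hun] at h2
  unfold regObjective at h1 ⊢
  linarith

/-- Add the quadratic growth at each best response, tested at the other one. The changed weight `θ`
costs a difference of squared norms, bounded through `R`. The two consequences below bound the mixed
difference of `F` by smoothness in `x` or by smoothness in `y`. -/
lemma best_response_gap (H : IsSaddleObjective F h X Y l L) {θ₁ θ₂ R : ℝ} {x₁ x₂ : E}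
    {z₁ z₂ : V} (hx₁ : x₁ ∈ X) (hx₂ : x₂ ∈ X)
    (hz₁ : IsBestResponse F h Y θ₁ x₁ z₁) (hz₂ : IsBestResponse F h Y θ₂ x₂ z₂) (hθ : θ₂ ≤ θ₁)
    (hR₁ : ‖z₁‖ ≤ R) (hR₂ : ‖z₂‖ ≤ R) :
    θ₂ * ‖z₂ - z₁‖ ^ 2 ≤ (F x₂ z₂ - F x₁ z₂) - (F x₂ z₁ - F x₁ z₁)
      + (θ₁ - θ₂) * R * ‖z₂ - z₁‖ := by
  have h1 := H.quadratic_growth hx₁ hz₁ hz₂.1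
  have h2 := H.quadratic_growth hx₂ hz₂ hz₁.1
  rw [norm_sub_rev z₁ z₂] at h2
  unfold regObjective at h1 h2
  have h3 : ‖z₁‖ ^ 2 - ‖z₂‖ ^ 2 ≤ 2 * R * ‖z₂ - z₁‖ := by
    have h4 : ‖z₁‖ - ‖z₂‖ ≤ ‖z₂ - z₁‖ := by rw [norm_sub_rev]; exact norm_sub_norm_le _ _
    have h5 : 0 ≤ ‖z₁‖ + ‖z₂‖ := by positivity
    have h6 : (‖z₁‖ - ‖z₂‖) * (‖z₁‖ + ‖z₂‖) ≤ ‖z₂ - z₁‖ * (‖z₁‖ + ‖z₂‖) :=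
      mul_le_mul_of_nonneg_right h4 h5
    have h7 : ‖z₂ - z₁‖ * (‖z₁‖ + ‖z₂‖) ≤ ‖z₂ - z₁‖ * (2 * R) :=
      mul_le_mul_of_nonneg_left (by linarith) (norm_nonneg _)
    linarith
  have h3' : ‖z₂‖ ^ 2 - ‖z₁‖ ^ 2 ≤ 2 * R * ‖z₂ - z₁‖ := by
    have h4 : ‖z₂‖ - ‖z₁‖ ≤ ‖z₂ - z₁‖ := norm_sub_norm_le _ _
    have h5 : 0 ≤ ‖z₁‖ + ‖z₂‖ := by positivity
    have h6 : (‖z₂‖ - ‖z₁‖) * (‖z₁‖ + ‖z₂‖) ≤ ‖z₂ - z₁‖ * (‖z₁‖ + ‖z₂‖) :=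
      mul_le_mul_of_nonneg_right h4 h5
    have h7 : ‖z₂ - z₁‖ * (‖z₁‖ + ‖z₂‖) ≤ ‖z₂ - z₁‖ * (2 * R) :=
      mul_le_mul_of_nonneg_left (by linarith) (norm_nonneg _)
    linarith
  have h8 := mul_le_mul_of_nonneg_left h3 (sub_nonneg.2 hθ)
  have h9 := mul_le_mul_of_nonneg_left h3' (sub_nonneg.2 hθ)
  have h10 : θ₂ * ‖z₂ - z₁‖ ^ 2 ≤ θ₁ * ‖z₂ - z₁‖ ^ 2 :=
    mul_le_mul_of_nonneg_right hθ (sq_nonneg _)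
  linarith

/-- Strong monotonicity of the gradients of the regularized value function. -/
lemma value_gradient_mono (H : IsSaddleObjective F h X Y l L) {θ₁ θ₂ R : ℝ} {x₁ x₂ : E}
    {z₁ z₂ : V} (hx₁ : x₁ ∈ X) (hx₂ : x₂ ∈ X)
    (hz₁ : IsBestResponse F h Y θ₁ x₁ z₁) (hz₂ : IsBestResponse F h Y θ₂ x₂ z₂) (hθ : θ₂ ≤ θ₁)
    (hR₁ : ‖z₁‖ ≤ R) (hR₂ : ‖z₂‖ ≤ R) :
    θ₂ * ‖z₂ - z₁‖ ^ 2 ≤ inner ℝ (gradX F x₂ z₂ - gradX F x₁ z₁) (x₂ - x₁)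
      + l * ‖x₂ - x₁‖ ^ 2 + (θ₁ - θ₂) * R * ‖z₂ - z₁‖ := by
  have h1 := H.best_response_gap hx₁ hx₂ hz₁ hz₂ hθ hR₁ hR₂
  have h2 := quadratic_le_of_lipschitz_gradient H.convex_X
    (fun x hx => H.hasGradX x hx z₁ hz₁.1) (H.lip_xx hz₁.1) hx₁ hx₂
  have h3 := quadratic_le_of_lipschitz_gradient H.convex_X
    (fun x hx => H.hasGradX x hx z₂ hz₂.1) (H.lip_xx hz₂.1) hx₂ hx₁
  rw [norm_sub_rev x₁ x₂, ← neg_sub x₂ x₁, inner_neg_right] at h3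
  rw [inner_sub_left]
  linarith

/-- The best response is Lipschitz in `x`. -/
lemma best_response_lipschitz (H : IsSaddleObjective F h X Y l L) {θ₁ θ₂ R : ℝ} {x₁ x₂ : E}
    {z₁ z₂ : V} (hx₁ : x₁ ∈ X) (hx₂ : x₂ ∈ X)
    (hz₁ : IsBestResponse F h Y θ₁ x₁ z₁) (hz₂ : IsBestResponse F h Y θ₂ x₂ z₂) (hθ : θ₂ ≤ θ₁)
    (hR₁ : ‖z₁‖ ≤ R) (hR₂ : ‖z₂‖ ≤ R) :
    θ₂ * ‖z₂ - z₁‖ ≤ l * ‖x₂ - x₁‖ + (θ₁ - θ₂) * R := by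
  have h1 := H.best_response_gap hx₁ hx₂ hz₁ hz₂ hθ hR₁ hR₂
  -- The mixed difference is an increment of `F(x₂, ·) - F(x₁, ·)`, whose gradient is bounded by `l
  -- ‖x₂ - x₁‖`.
  have h2 := sub_le_of_gradient_bound (φ := fun y => F x₂ y - F x₁ y)
    (g := fun y => gradY F x₂ y - gradY F x₁ y) H.convexOn.1
    (fun y hy => by
      have := (hasGradientAt_iff_hasFDerivAt.1 (H.hasGradY x₂ hx₂ y hy)).sub
        (hasGradientAt_iff_hasFDerivAt.1 (H.hasGradY x₁ hx₁ y hy))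
      rw [← map_sub] at this
      exact hasGradientAt_iff_hasFDerivAt.2 this)
    (fun y hy => H.lip_y x₂ hx₂ x₁ hx₁ y hy) hz₁.1 hz₂.1
  have hR0 : 0 ≤ R := (norm_nonneg _).trans hR₁
  rcases (norm_nonneg (z₂ - z₁)).eq_or_lt with h0 | h0
  · rw [← h0, mul_zero]
    have := mul_nonneg (sub_nonneg.2 hθ) hR0
    have := mul_nonneg H.nonneg (norm_nonneg (x₂ - x₁))
    linarith
  · refine le_of_mul_le_mul_right ?_ h0
    linarith

/-- The proximal gradient step in `y` contracts towards the best response. -/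
lemma prox_step_contraction (H : IsSaddleObjective F h X Y l L) {θ α : ℝ} {x : E} {y y' z : V}
    (hx : x ∈ X) (hy : y ∈ Y) (hy' : y' ∈ Y) (hz : IsBestResponse F h Y θ x z) (hα : 0 < α)
    (hαL : α * (L + θ) ≤ 1)
    (hprox : ∀ w ∈ Y,
      h y' + inner ℝ (α⁻¹ • (y + α • (gradY F x y - θ • y) - y')) (w - y') ≤ h w) :
    (1 + α * θ) * ‖y' - z‖ ^ 2 ≤ (1 - α * θ) * ‖y - z‖ ^ 2 := by
  have h1 := le_of_concaveOn_of_hasGradientAt (H.concaveOn x hx) hy hz.1 (H.hasGradY x hx y hy)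
  have h2 := quadratic_le_of_lipschitz_gradient H.convexOn.1 (H.hasGradY x hx) (H.lip_yy x hx)
    hy hy'
  have h3 := hprox z hz.1
  have h4 := H.quadratic_growth hx hz hy'
  unfold regObjective at h4
  -- With `a = y - z` and `b = y' - z` the remaining inequality is quadratic in `a` and `b`. After
  -- inserting `α (L + θ) ≤ 1` the inner products of `a` and `b` cancel exactly.
  set g := gradY F x y
  obtain ⟨a, rfl⟩ : ∃ a, y = z + a := ⟨y - z, by abel⟩
  obtain ⟨b, rfl⟩ : ∃ b, y' = z + b := ⟨y' - z, by abel⟩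
  have e1 : α⁻¹ • (z + a + α • (g - θ • (z + a)) - (z + b))
      = α⁻¹ • (a - b) + g - θ • (z + a) := by
    rw [show z + a + α • (g - θ • (z + a)) - (z + b) = (a - b) + α • (g - θ • (z + a)) by abel,
      smul_add, inv_smul_smul₀ hα.ne', add_sub_assoc]
  rw [e1] at h3
  have e2 : z - (z + b) = -b := by abel
  have e3 : z - (z + a) = -a := by abel
  have e4 : z + b - (z + a) = b - a := by abel
  rw [e2] at h3
  rw [e3] at h1
  rw [e4] at h2
  rw [add_sub_cancel_left] at h4
  rw [add_sub_cancel_left, add_sub_cancel_left]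
  have n1 : ‖z + b‖ ^ 2 = ‖z‖ ^ 2 + 2 * inner ℝ z b + ‖b‖ ^ 2 := norm_add_sq_real z b
  have n2 : ‖b - a‖ ^ 2 = ‖b‖ ^ 2 - 2 * inner ℝ a b + ‖a‖ ^ 2 := by
    rw [norm_sub_sq_real, real_inner_comm]
  have n3 : inner ℝ (α⁻¹ • (a - b) + g - θ • (z + a)) (-b)
      = -(α⁻¹ * (inner ℝ a b - ‖b‖ ^ 2)) - inner ℝ g b
        + θ * (inner ℝ z b + inner ℝ a b) := by
    rw [inner_neg_right, inner_sub_left, inner_add_left, inner_smul_left, inner_smul_left,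
      inner_sub_left, inner_add_left, real_inner_self_eq_norm_sq]
    simp only [conj_trivial]
    ring
  rw [n3] at h3
  rw [n1] at h4
  rw [inner_sub_right] at h2
  rw [inner_neg_right] at h1
  have h5 : -(α⁻¹ * (inner ℝ a b - ‖b‖ ^ 2)) + θ * inner ℝ a b
      ≤ L / 2 * ‖b - a‖ ^ 2 := by linarith
  have h6 := mul_le_mul_of_nonneg_left h5 hα.le
  have h7 : α * (-(α⁻¹ * (inner ℝ a b - ‖b‖ ^ 2)) + θ * inner ℝ a b)
      = -(inner ℝ a b - ‖b‖ ^ 2) + α * θ * inner ℝ a b := by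
    field_simp
  rw [h7] at h6
  have h8 : α * (L + θ) * ‖b - a‖ ^ 2 ≤ 1 * ‖b - a‖ ^ 2 :=
    mul_le_mul_of_nonneg_right hαL (sq_nonneg _)
  rw [n2] at h6 h8
  linarith

/-- Growth of the gradient of the regularized value function along a gradient step in `x`. -/
lemma value_gradient_growth (H : IsSaddleObjective F h X Y l L) {θ₁ θ₂ η R : ℝ} {x₁ x₂ : E}
    {y z₁ z₂ : V} (hx₁ : x₁ ∈ X) (hx₂ : x₂ ∈ X) (hy : y ∈ Y)
    (hz₁ : IsBestResponse F h Y θ₁ x₁ z₁) (hz₂ : IsBestResponse F h Y θ₂ x₂ z₂) (hθ : θ₂ ≤ θ₁)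
    (hη : 0 < η) (hR₁ : ‖z₁‖ ≤ R) (hR₂ : ‖z₂‖ ≤ R) (hstep : x₂ = x₁ - η • gradX F x₁ y) :
    ‖gradX F x₂ z₂‖ ^ 2 / 2 ≤ ‖gradX F x₁ z₁‖ ^ 2 / 2 + l * η * ‖gradX F x₁ y‖ ^ 2
      + ((θ₁ - θ₂) * R * ‖z₂ - z₁‖ - θ₂ * ‖z₂ - z₁‖ ^ 2) / η
      + l * (η * ‖gradX F x₁ y‖ + ‖z₂ - z₁‖) * (l * ‖y - z₁‖)
      + (l * (η * ‖gradX F x₁ y‖ + ‖z₂ - z₁‖)) ^ 2 / 2 := by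
  have h1 := H.value_gradient_mono hx₁ hx₂ hz₁ hz₂ hθ hR₁ hR₂
  have h2 := H.lip_x x₂ hx₂ x₁ hx₁ z₂ hz₂.1 z₁ hz₁.1
  have h3 := H.lip_xy hx₁ z₁ hz₁.1 y hy
  rw [norm_sub_rev z₁ y] at h3
  set G := gradX F x₁ y with hG
  set g₁ := gradX F x₁ z₁
  set g₂ := gradX F x₂ z₂
  have hu : x₂ - x₁ = -(η • G) := by rw [hstep]; abel
  have hun : ‖x₂ - x₁‖ = η * ‖G‖ := by
    rw [hu, norm_neg, norm_smul, Real.norm_eq_abs, abs_of_pos hη]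
  rw [hun] at h1 h2
  rw [hu, inner_neg_right, inner_smul_right] at h1
  -- The displacement is `-η G`, so weak monotonicity of the gradient of the value function bounds
  -- this inner product from above. The discrepancy between `G` and `g₁` is handled separately in
  -- `h5`.
  have h4 : inner ℝ (g₂ - g₁) G ≤ l * η * ‖G‖ ^ 2
      + ((θ₁ - θ₂) * R * ‖z₂ - z₁‖ - θ₂ * ‖z₂ - z₁‖ ^ 2) / η := by
    rw [← sub_le_iff_le_add', le_div_iff₀ hη]
    linarith
  have h5 : inner ℝ (g₂ - g₁) (g₁ - G)
      ≤ l * (η * ‖G‖ + ‖z₂ - z₁‖) * (l * ‖y - z₁‖) :=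
    (real_inner_le_norm _ _).trans (mul_le_mul h2 h3 (norm_nonneg _)
      ((norm_nonneg _).trans h2))
  have h6 : ‖g₂‖ ^ 2 = ‖g₁‖ ^ 2 + 2 * (inner ℝ (g₂ - g₁) G + inner ℝ (g₂ - g₁) (g₁ - G))
      + ‖g₂ - g₁‖ ^ 2 := by
    rw [← inner_add_right, add_sub_cancel, real_inner_comm]
    have : g₂ = g₁ + (g₂ - g₁) := by abel
    nth_rewrite 1 [this]
    rw [norm_add_sq_real]
  have h7 := pow_le_pow_left₀ (norm_nonneg _) h2 2
  linarith

end IsSaddleObjective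

end SaddleStep

end SmMGDA

end

/-! ### Scalar estimates for one iteration. -/

noncomputable section

namespace SmMGDA

section StepEstimates

/-- The relations between the step sizes `η` (in `x`), `α` (in `y`), the regularization `θ`, the
Lipschitz constant `l` and the fourth root `q` of the iteration number. -/
structure StepBounds (α l b q η θ : ℝ) : Prop where
  α_pos : 0 < α
  l_pos : 0 < l
  b_ge : 35 ≤ b
  q_ge : 1 ≤ q
  θ_eq : α * θ * q = 19 / 20
  η_pos : 0 < η
  η_le : η * l ≤ 2 / 3
  η_sq_le : η * l ^ 2 * (α * b * q ^ 2) ≤ 4 / 3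
  le_η_sq : 1 / 2 ≤ η * l ^ 2 * (α * b * q ^ 2)

namespace StepBounds

variable {α l b q η θ : ℝ}

lemma θ_pos (S : StepBounds α l b q η θ) : 0 < θ := by
  have h1 := S.θ_eq
  have h2 : 0 < α * q := mul_pos S.α_pos (zero_lt_one.trans_le S.q_ge)
  have h3 : θ = 19 / 20 / (α * q) := by rw [eq_div_iff h2.ne']; linarith
  rw [h3]; positivity

/-- Young's inequality for `(d + D)²`, normalized so that the coefficient of `d²` is one; `s` is the
share of the contraction spent on it. -/
lemma sq_le_of_le_add {s e d D : ℝ} (hs0 : 0 < s) (hs1 : s ≤ 1) (he0 : 0 ≤ e) (he : e ≤ d + D) :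
    (1 - s) * e ^ 2 ≤ d ^ 2 + D ^ 2 / s := by
  have h1 : e ^ 2 ≤ (d + D) ^ 2 := pow_le_pow_left₀ he0 he 2
  have h2 : (1 - s) * e ^ 2 ≤ (1 - s) * (d + D) ^ 2 :=
    mul_le_mul_of_nonneg_left h1 (by linarith)
  have h3 : d ^ 2 + D ^ 2 / s - (1 - s) * (d + D) ^ 2
      = ((s * d - (1 - s) * D) ^ 2 + s * D ^ 2) / s := by
    field_simp
    ring
  have h4 : 0 ≤ ((s * d - (1 - s) * D) ^ 2 + s * D ^ 2) / s := by positivity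
  linarith

set_option maxHeartbeats 1000000 in
/-- One step decreases the potential `P + w d²`. -/
lemma potential_step (S : StepBounds α l b q η θ) {P P' G e d d' D r κ w' : ℝ}
    (he : 0 ≤ e) (hD : 0 ≤ D)
    (h1 : P' ≤ P - η * G ^ 2 + η * (l * e) * G + l / 2 * (η * G) ^ 2 + κ)
    (h2 : d' ^ 2 ≤ (1 - α * θ) * e ^ 2) (h3 : e ≤ d + D) (h4 : θ * D ≤ l * (η * G) + θ * r)
    (hw : w' ≤ 10 / (α * b * q)) :
    P' + w' * d' ^ 2 + (η * G ^ 2 / 4 + e ^ 2 / (α * b * q ^ 2))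
      ≤ P + 10 / (α * b * q) * d ^ 2 + κ + 30 / (α * b) * r ^ 2 := by
  have hα := S.α_pos
  have hl := S.l_pos
  have hb : 0 < b := by linarith [S.b_ge]
  have hq := S.q_ge
  have hq0 : 0 < q := by linarith
  have hη := S.η_pos
  have hθ := S.θ_pos
  have hαθ : α * θ = 19 / 20 / q := by rw [eq_div_iff hq0.ne']; exact S.θ_eq
  set m := 1 / (α * b) with hm
  have hm0 : 0 < m := by positivity
  have ew : 10 / (α * b * q) = 10 * m / q := by rw [hm]; field_simp
  have eμ : e ^ 2 / (α * b * q ^ 2) = m / q ^ 2 * e ^ 2 := by rw [hm]; field_simp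
  have er : 30 / (α * b) * r ^ 2 = 30 * m * r ^ 2 := by rw [hm]; field_simp
  rw [ew] at hw
  rw [ew, eμ, er]
  have hη1 : η * l ^ 2 ≤ 4 / 3 * (m / q ^ 2) := by
    have : m / q ^ 2 = 1 / (α * b * q ^ 2) := by rw [hm]; field_simp
    rw [this, mul_one_div, le_div_iff₀ (by positivity)]
    exact S.η_sq_le
  have s1 : η * (l * e) * G ≤ η * G ^ 2 / 4 + 4 / 3 * (m / q ^ 2) * e ^ 2 := by
    have a1 : η * l ^ 2 * e ^ 2 ≤ 4 / 3 * (m / q ^ 2) * e ^ 2 :=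
      mul_le_mul_of_nonneg_right hη1 (sq_nonneg e)
    have a2 : 0 ≤ η * (G / 2 - l * e) ^ 2 := by positivity
    linarith
  have s2 : l / 2 * (η * G) ^ 2 ≤ η * G ^ 2 / 3 := by
    have : η * l * (η * G ^ 2) ≤ 2 / 3 * (η * G ^ 2) :=
      mul_le_mul_of_nonneg_right S.η_le (by positivity)
    linarith
  have s3 : w' * d' ^ 2 ≤ 10 * m / q * ((1 - 19 / 20 / q) * e ^ 2) := by
    rw [← hαθ]
    exact (mul_le_mul_of_nonneg_right hw (sq_nonneg _)).trans
      (mul_le_mul_of_nonneg_left h2 (by positivity))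
  -- Three quarters of the contraction `α θ = (19/20)/q` pay for the triangle inequality `e ≤ d +
  -- D`. With weight `10` the remaining quarter gives `19/8 · m e²/q²`, just above the `4/3 + 1`
  -- needed for the coupling term in `s1` and for the claimed decrease.
  have s4 : (1 - 3 / 4 * (19 / 20 / q)) * e ^ 2 ≤ d ^ 2 + D ^ 2 / (3 / 4 * (19 / 20 / q)) := by
    refine sq_le_of_le_add (by positivity) ?_ he h3
    rw [← mul_div_assoc, div_le_one hq0]; linarith
  have s5 := mul_le_mul_of_nonneg_left s4 (by positivity : 0 ≤ 10 * m / q)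
  have e1 : 10 * m / q * ((1 - 19 / 20 / q) * e ^ 2)
      = 10 * m / q * ((1 - 3 / 4 * (19 / 20 / q)) * e ^ 2) - 19 / 8 * (m / q ^ 2 * e ^ 2) := by
    field_simp
    ring
  have e2 : 10 * m / q * (d ^ 2 + D ^ 2 / (3 / 4 * (19 / 20 / q)))
      = 10 * m / q * d ^ 2 + 800 / 57 * m * D ^ 2 := by
    field_simp
    ring
  rw [e2] at s5
  have hinv : 1 / θ = 20 / 19 * (α * q) := by
    rw [div_eq_iff hθ.ne']
    have := S.θ_eq
    linarith
  have s6 : D ≤ 20 / 19 * (α * q) * (l * (η * G)) + r := by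
    have : D ≤ (l * (η * G) + θ * r) / θ := by rw [le_div_iff₀ hθ]; linarith
    refine this.trans (le_of_eq ?_)
    rw [← hinv]
    field_simp
  have s7 : D ^ 2 ≤ 2 * (20 / 19 * (α * q) * (l * (η * G))) ^ 2 + 2 * r ^ 2 := by
    have a1 := pow_le_pow_left₀ hD s6 2
    have a2 := sq_nonneg (20 / 19 * (α * q) * (l * (η * G)) - r)
    linarith
  -- Here `b ≥ 35` is used: the drift of the best response caused by the `x` step costs at most
  -- `1/12` of `η G²`. Together with `1/4` from `s1` and `1/3` from `s2` this leaves room for the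
  -- claimed decrease `η G²/4`.
  have s8 : 800 / 57 * m * (2 * (20 / 19 * (α * q) * (l * (η * G))) ^ 2) ≤ η * G ^ 2 / 12 := by
    have e3 : 800 / 57 * m * (2 * (20 / 19 * (α * q) * (l * (η * G))) ^ 2)
        = 640000 / 20577 / b ^ 2 * (η * l ^ 2 * (α * b * q ^ 2)) * (η * G ^ 2) := by
      rw [hm]
      field_simp
      ring
    rw [e3]
    have a1 : 640000 / 20577 / b ^ 2 * (η * l ^ 2 * (α * b * q ^ 2))
        ≤ 640000 / 20577 / b ^ 2 * (4 / 3) :=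
      mul_le_mul_of_nonneg_left S.η_sq_le (by positivity)
    have a2 : 640000 / 20577 / b ^ 2 * (4 / 3) ≤ 1 / 12 := by
      have : (1225 : ℝ) ≤ b ^ 2 := by nlinarith [S.b_ge]
      rw [div_mul_eq_mul_div, div_le_iff₀ (by positivity)]
      linarith
    have := mul_le_mul_of_nonneg_right (a1.trans a2) (by positivity : 0 ≤ η * G ^ 2)
    linarith
  have s9 := mul_le_mul_of_nonneg_left s7 (by positivity : 0 ≤ 800 / 57 * m)
  have s10 : 0 ≤ m / q ^ 2 * e ^ 2 := by positivity
  have s11 : 0 ≤ m * r ^ 2 := by positivity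
  have s12 : 0 ≤ η * G ^ 2 := by positivity
  linarith

set_option maxHeartbeats 1000000 in
/-- One step increases the energy `γ²/2 + 2 l² d²` by a controlled amount. -/
lemma energy_step (S : StepBounds α l b q η θ) {γ γ' G e d d' D r : ℝ}
    (he : 0 ≤ e)
    (h1 : γ' ^ 2 / 2 ≤ γ ^ 2 / 2 + l * η * G ^ 2 + (θ * r * D - θ * D ^ 2) / η
      + l * (η * G + D) * (l * d) + (l * (η * G + D)) ^ 2 / 2)
    (h2 : d' ^ 2 ≤ (1 - α * θ) * e ^ 2) (h3 : e ≤ d + D) :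
    γ' ^ 2 / 2 + 2 * l ^ 2 * d' ^ 2 ≤ γ ^ 2 / 2 + 2 * l ^ 2 * d ^ 2
      + ((l + 8 / (3 * (α * b))) * (η * G ^ 2) + θ / η * r ^ 2 / 2) := by
  have hα := S.α_pos
  have hl := S.l_pos
  have hb : 0 < b := by linarith [S.b_ge]
  have hq := S.q_ge
  have hq0 : 0 < q := by linarith
  have hη := S.η_pos
  have hθ := S.θ_pos
  have hαθ : α * θ = 19 / 20 / q := by rw [eq_div_iff hq0.ne']; exact S.θ_eq
  set ω := θ / η with hω
  have hω0 : 0 < ω := by positivity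
  -- The strong concavity term `-θ D²/η` is strong enough to absorb all terms in `D²` below, because
  -- `b ≥ 35` makes `η` small compared with `θ`.
  have hωl : 24 * (l ^ 2 * q) ≤ ω := by
    rw [hω, le_div_iff₀ hη]
    have a1 : η * l ^ 2 * (α * b * q ^ 2) * θ ≤ 4 / 3 * θ :=
      mul_le_mul_of_nonneg_right S.η_sq_le hθ.le
    have a2 : η * l ^ 2 * (α * b * q ^ 2) * θ = 19 / 20 * b * (l ^ 2 * q * η) := by
      rw [← S.θ_eq]; ring
    rw [a2] at a1
    have a3 : 35 * (l ^ 2 * q * η) ≤ b * (l ^ 2 * q * η) :=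
      mul_le_mul_of_nonneg_right S.b_ge (by positivity)
    have a4 : 0 ≤ l ^ 2 * q * η := by positivity
    linarith
  have t1 : (θ * r * D - θ * D ^ 2) / η = ω * (r * D - D ^ 2) := by rw [hω]; field_simp
  have t2 : ω * (r * D - D ^ 2) ≤ ω * r ^ 2 / 2 - ω * D ^ 2 / 2 := by
    have : 0 ≤ ω * (r - D) ^ 2 := by positivity
    linarith
  have t3 : 12 * (l ^ 2 * q) * D ^ 2 ≤ ω * D ^ 2 / 2 := by
    have := mul_le_mul_of_nonneg_right hωl (sq_nonneg D)
    linarith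
  have t4 : l ^ 2 * (η * G * d) ≤ l ^ 2 * (q * (η * G) ^ 2 + d ^ 2 / (4 * q)) := by
    refine mul_le_mul_of_nonneg_left ?_ (sq_nonneg l)
    have e1 : q * (η * G) ^ 2 + d ^ 2 / (4 * q) - η * G * d
        = (2 * q * (η * G) - d) ^ 2 / (4 * q) := by field_simp; ring
    have : 0 ≤ (2 * q * (η * G) - d) ^ 2 / (4 * q) := by positivity
    linarith
  have t5 : l ^ 2 * (D * d) ≤ l ^ 2 * (q * D ^ 2 + d ^ 2 / (4 * q)) := by
    refine mul_le_mul_of_nonneg_left ?_ (sq_nonneg l)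
    have e1 : q * D ^ 2 + d ^ 2 / (4 * q) - D * d
        = (2 * q * D - d) ^ 2 / (4 * q) := by field_simp; ring
    have : 0 ≤ (2 * q * D - d) ^ 2 / (4 * q) := by positivity
    linarith
  have t6 : (l * (η * G + D)) ^ 2 / 2 ≤ l ^ 2 * (η * G) ^ 2 + l ^ 2 * D ^ 2 := by
    have : 0 ≤ l ^ 2 * (η * G - D) ^ 2 := by positivity
    linarith
  -- Half of the contraction pays for the triangle inequality. The other half, with energy weight `2
  -- l²`, leaves `-(19/20) l² d²/q`, which covers the two quarters of `l² d²/q` from `t4` and `t5`.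
  have t7 : d' ^ 2 ≤ (1 - 19 / 40 / q) * d ^ 2 + 40 / 19 * q * D ^ 2 := by
    have hs : 19 / 40 / q ≤ 1 / 2 := by rw [div_le_iff₀ hq0]; linarith
    have hs0 : 0 < 19 / 40 / q := by positivity
    have a1 : d' ^ 2 ≤ (1 - 19 / 40 / q) * ((1 - 19 / 40 / q) * e ^ 2) := by
      refine h2.trans ?_
      have : 1 - α * θ = 1 - 2 * (19 / 40 / q) := by rw [hαθ]; ring
      rw [this]
      have : 0 ≤ (19 / 40 / q) ^ 2 * e ^ 2 := by positivity
      linarith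
    have a2 := sq_le_of_le_add hs0 (by linarith) he h3
    have a3 := mul_le_mul_of_nonneg_left a2 (by linarith : 0 ≤ 1 - 19 / 40 / q)
    have a4 : D ^ 2 / (19 / 40 / q) = 40 / 19 * q * D ^ 2 := by field_simp
    rw [a4] at a3
    have a5 : 0 ≤ 19 / 40 / q * (40 / 19 * q * D ^ 2) := by positivity
    linarith
  have t8 := mul_le_mul_of_nonneg_left t7 (by positivity : 0 ≤ 2 * l ^ 2)
  have e8 : 2 * l ^ 2 * ((1 - 19 / 40 / q) * d ^ 2 + 40 / 19 * q * D ^ 2)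
      = 2 * l ^ 2 * d ^ 2 - 19 / 20 * (l ^ 2 * (d ^ 2 / q)) + 80 / 19 * (l ^ 2 * q * D ^ 2) := by
    field_simp
    ring
  have e9 : d ^ 2 / (4 * q) = d ^ 2 / q / 4 := by field_simp
  rw [e8] at t8
  rw [e9] at t4 t5
  have t9 : l ^ 2 * (q * (η * G) ^ 2) ≤ 4 / (3 * (α * b)) * (η * G ^ 2) := by
    have a1 : l ^ 2 * q * η ≤ 4 / (3 * (α * b)) := by
      rw [le_div_iff₀ (by positivity)]
      have a2 := S.η_sq_le
      have a3 : η * l ^ 2 * (α * b) * q * 1 ≤ η * l ^ 2 * (α * b) * q * q :=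
        mul_le_mul_of_nonneg_left hq (by positivity)
      linarith
    have := mul_le_mul_of_nonneg_right a1 (by positivity : 0 ≤ η * G ^ 2)
    linarith
  have t10 : l ^ 2 * (η * G) ^ 2 ≤ l ^ 2 * (q * (η * G) ^ 2) := by
    refine mul_le_mul_of_nonneg_left ?_ (sq_nonneg l)
    exact le_mul_of_one_le_left (sq_nonneg _) hq
  have t11 : l ^ 2 * D ^ 2 ≤ l ^ 2 * q * D ^ 2 := by
    rw [mul_assoc]
    exact mul_le_mul_of_nonneg_left (le_mul_of_one_le_left (sq_nonneg _) hq) (sq_nonneg l)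
  have t12 : 0 ≤ l ^ 2 * (d ^ 2 / q) := by positivity
  have t13 : 0 ≤ l ^ 2 * q * D ^ 2 := by positivity
  have e10 : 8 / (3 * (α * b)) = 2 * (4 / (3 * (α * b))) := by ring
  rw [t1] at h1
  rw [e10]
  linarith

end StepBounds

end StepEstimates

end SmMGDA

end

/-! ### Step sizes, regularization parameters and the descent of the potential. -/

noncomputable section

namespace SmMGDA

open Filter Topology

section StepSizes

/-- The step size in `x` at iteration `t`. -/
def stepX (α b l : ℝ) (t : ℕ) : ℝ := 2 / (2 * α * l ^ 2 * (1 + b * √((t : ℝ) + 1)) - l)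

/-- The regularization parameter at iteration `t`. -/
def regParam (α : ℝ) (t : ℕ) : ℝ := 19 / 20 * (1 / α) * (1 / ((t : ℝ) + 1) ^ (1 / 4 : ℝ))

/-- The fourth root of `t + 1`. -/
def root (t : ℕ) : ℝ := ((t : ℝ) + 1) ^ (1 / 4 : ℝ)

lemma root_pos (t : ℕ) : 0 < root t := by unfold root; positivity

lemma one_le_root (t : ℕ) : 1 ≤ root t :=
  Real.one_le_rpow (by have : (0 : ℝ) ≤ t := t.cast_nonneg
                       linarith) (by norm_num)

lemma root_sq (t : ℕ) : root t ^ 2 = √((t : ℝ) + 1) := by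
  unfold root
  rw [Real.sqrt_eq_rpow, ← Real.rpow_natCast, ← Real.rpow_mul (by positivity)]
  norm_num

lemma root_pow_four (t : ℕ) : root t ^ 4 = (t : ℝ) + 1 := by
  have : root t ^ 4 = (root t ^ 2) ^ 2 := by ring
  rw [this, root_sq, Real.sq_sqrt (by positivity)]

lemma root_mono (t : ℕ) : root t ≤ root (t + 1) := by
  unfold root
  exact Real.rpow_le_rpow (by positivity) (by push_cast; linarith) (by norm_num)

/-- Compare fourth powers: `(t + 1)(1 + 1/(t + 1)) = t + 2`, and `1 + s ≤ (1 + s)⁴`. The constant is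
crude, but the relative decay rate `1/(t + 1)` of `θ` suffices. -/
lemma root_succ_le (t : ℕ) : root (t + 1) ≤ root t * (1 + 1 / ((t : ℝ) + 1)) := by
  have h0 := root_pos t
  refine le_of_pow_le_pow_left₀ (n := 4) (by norm_num) (by positivity) ?_
  rw [mul_pow, root_pow_four, root_pow_four]
  set s := 1 / ((t : ℝ) + 1) with hs
  have hs0 : 0 ≤ s := by positivity
  have h1 : 1 + s ≤ (1 + s) ^ 4 := le_self_pow₀ (by linarith) (by norm_num)
  have h2 : ((t : ℝ) + 1) * (1 + s) = (t + 1 : ℕ) + 1 := by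
    rw [hs]; push_cast; field_simp
  calc ((t + 1 : ℕ) : ℝ) + 1 = ((t : ℝ) + 1) * (1 + s) := h2.symm
    _ ≤ _ := mul_le_mul_of_nonneg_left h1 (by positivity)

lemma regParam_eq (α : ℝ) (t : ℕ) : regParam α t = 19 / 20 * (1 / α) * (1 / root t) := rfl

lemma regParam_pos {α : ℝ} (hα : 0 < α) (t : ℕ) : 0 < regParam α t := by
  have := root_pos t
  rw [regParam_eq]; positivity

lemma regParam_anti {α : ℝ} (hα : 0 < α) (t : ℕ) : regParam α (t + 1) ≤ regParam α t := by
  rw [regParam_eq, regParam_eq]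
  exact mul_le_mul_of_nonneg_left (one_div_le_one_div_of_le (root_pos t) (root_mono t))
    (by positivity)

lemma regParam_sub_le {α : ℝ} (hα : 0 < α) (t : ℕ) :
    regParam α t - regParam α (t + 1) ≤ regParam α (t + 1) * (1 / ((t : ℝ) + 1)) := by
  have h := root_succ_le t
  have h0 := root_pos t
  have h1 := root_pos (t + 1)
  rw [regParam_eq, regParam_eq]
  have e : 1 / root t ≤ 1 / root (t + 1) * (1 + 1 / ((t : ℝ) + 1)) := by
    rw [div_le_iff₀ h0, div_mul_eq_mul_div, one_mul, div_mul_eq_mul_div, le_div_iff₀ h1]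
    linarith
  have := mul_le_mul_of_nonneg_left e (by positivity : 0 ≤ 19 / 20 * (1 / α))
  linarith

/-- Together with `α L ≤ 1/10` this gives the condition `α (L + θ) ≤ 1` of the proximal contraction.
It relies on `2^(1/4) ≥ 19/18`, hence on the index being at least one; at index zero the product is
`19/20`. -/
lemma mul_regParam_succ_le {α : ℝ} (hα : 0 < α) (t : ℕ) : α * regParam α (t + 1) ≤ 9 / 10 := by
  have h1 := root_pos (t + 1)
  have h2 : (19 / 18 : ℝ) ≤ root (t + 1) := by
    refine le_of_pow_le_pow_left₀ (n := 4) (by norm_num) h1.le ?_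
    rw [root_pow_four]
    have : (0 : ℝ) ≤ t := t.cast_nonneg
    push_cast
    norm_num
    linarith
  rw [regParam_eq]
  have : α * (19 / 20 * (1 / α) * (1 / root (t + 1))) = 19 / 20 / root (t + 1) := by field_simp
  rw [this, div_le_iff₀ h1]
  linarith

/-- Writing the step as `2/(2Q - l)` with `Q = α l² (1 + b √(t+1))`, the lower bound `b > 2/(α l) -
1` says that `Q > 2 l`, and all the estimates follow from this and `Q ≥ 2 α l²`. -/
lemma stepX_estimates {α b l : ℝ} (hα : 0 < α) (hl : 0 < l) (hb : 35 ≤ b)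
    (hbl : 2 / (α * l) - 1 < b) (t : ℕ) :
    0 < stepX α b l t ∧ stepX α b l t * l ≤ 2 / 3 ∧
      stepX α b l t * l ^ 2 * (α * b * root t ^ 2) ≤ 4 / 3 ∧
      1 / 2 ≤ stepX α b l t * l ^ 2 * (α * b * root t ^ 2) := by
  rw [root_sq]
  unfold stepX
  set S := √((t : ℝ) + 1) with hS
  have hS1 : 1 ≤ S := by
    rw [hS, Real.one_le_sqrt]
    have : (0 : ℝ) ≤ t := t.cast_nonneg
    linarith
  have hb0 : 0 < b := by linarith
  have hαl : 0 < α * l := by positivity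
  have h1 : 2 < α * l * (1 + b) := by
    have : 2 / (α * l) < 1 + b := by linarith
    rw [div_lt_iff₀ hαl] at this
    linarith
  have hbS : b ≤ b * S := le_mul_of_one_le_right hb0.le hS1
  have h2 : 2 * l < α * l ^ 2 * (1 + b * S) := by
    have a1 : α * l * (1 + b) ≤ α * l * (1 + b * S) :=
      mul_le_mul_of_nonneg_left (by linarith) hαl.le
    have a2 := mul_lt_mul_of_pos_right (h1.trans_le a1) hl
    linarith
  set Q := α * l ^ 2 * (1 + b * S) with hQ
  have hQ0 : 0 < Q := by linarith
  have hden : 2 * α * l ^ 2 * (1 + b * S) - l = 2 * Q - l := by rw [hQ]; ring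
  rw [hden]
  have hd0 : 0 < 2 * Q - l := by linarith
  refine ⟨by positivity, ?_, ?_, ?_⟩
  · rw [div_mul_eq_mul_div, div_le_iff₀ hd0]; linarith
  · rw [div_mul_eq_mul_div, div_mul_eq_mul_div, div_le_iff₀ hd0]
    have : l ^ 2 * (α * b * S) = Q - α * l ^ 2 := by rw [hQ]; ring
    have : 0 < α * l ^ 2 := by positivity
    linarith
  · rw [div_mul_eq_mul_div, div_mul_eq_mul_div, le_div_iff₀ hd0]
    have e1 : l ^ 2 * (α * b * S) = Q - α * l ^ 2 := by rw [hQ]; ring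
    have e2 : α * l ^ 2 * 2 ≤ α * l ^ 2 * (1 + b * S) :=
      mul_le_mul_of_nonneg_left (by linarith) (by positivity)
    linarith

lemma stepBounds {α b l : ℝ} (hα : 0 < α) (hl : 0 < l) (hb : 35 ≤ b)
    (hbl : 2 / (α * l) - 1 < b) (t : ℕ) :
    StepBounds α l b (root t) (stepX α b l t) (regParam α t) := by
  obtain ⟨h1, h2, h3, h4⟩ := stepX_estimates hα hl hb hbl t
  refine ⟨hα, hl, hb, one_le_root t, ?_, h1, h2, h3, h4⟩
  have := root_pos t
  rw [regParam_eq]; field_simp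

end StepSizes

section Sequences

/-- The scalar inequalities satisfied along the iterations: `P` is the regularized value, `G` the
norm of the gradient in `x`, `e` and `d` the distances to the best response before and after the
step in `y`, `D` the displacement of the best response, `γ` the norm of the gradient of the
regularized value. -/
structure DescentSystem (α b l R : ℝ) (P G e d D γ : ℕ → ℝ) : Prop where
  R_nonneg : 0 ≤ R
  e_nonneg : ∀ t, 0 ≤ e t
  d_nonneg : ∀ t, 0 ≤ d t
  D_nonneg : ∀ t, 0 ≤ D t
  G_nonneg : ∀ t, 0 ≤ G t
  γ_nonneg : ∀ t, 0 ≤ γ t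
  descent : ∀ t, P (t + 1) ≤ P t - stepX α b l (t + 1) * G (t + 1) ^ 2
    + stepX α b l (t + 1) * (l * e (t + 1)) * G (t + 1)
    + l / 2 * (stepX α b l (t + 1) * G (t + 1)) ^ 2
    + (regParam α t - regParam α (t + 1)) * R ^ 2 / 2
  contract : ∀ t, d (t + 1) ^ 2 ≤ (1 - α * regParam α (t + 1)) * e (t + 1) ^ 2
  triangle : ∀ t, e (t + 1) ≤ d t + D t
  drift : ∀ t, regParam α (t + 1) * D t ≤ l * (stepX α b l (t + 1) * G (t + 1))
    + (regParam α t - regParam α (t + 1)) * R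
  growth : ∀ t, γ (t + 1) ^ 2 / 2 ≤ γ t ^ 2 / 2 + l * stepX α b l (t + 1) * G (t + 1) ^ 2
    + ((regParam α t - regParam α (t + 1)) * R * D t - regParam α (t + 1) * D t ^ 2)
      / stepX α b l (t + 1)
    + l * (stepX α b l (t + 1) * G (t + 1) + D t) * (l * d t)
    + (l * (stepX α b l (t + 1) * G (t + 1) + D t)) ^ 2 / 2
  γ_le : ∀ t, γ t ≤ G (t + 1) + l * d t
  le_γ : ∀ t, G (t + 1) ≤ γ t + l * d t

/-- The amount by which the potential decreases at one iteration. -/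
def decrease (α b l : ℝ) (G e : ℕ → ℝ) (t : ℕ) : ℝ :=
  stepX α b l (t + 1) * G (t + 1) ^ 2 / 4 + e (t + 1) ^ 2 / (α * b * root (t + 1) ^ 2)

/-- The relative decrease of the regularization parameter, times `R`. -/
def regDrift (α R : ℝ) (t : ℕ) : ℝ :=
  (regParam α t - regParam α (t + 1)) * R / regParam α (t + 1)

lemma regDrift_nonneg {α R : ℝ} (hα : 0 < α) (hR : 0 ≤ R) (t : ℕ) : 0 ≤ regDrift α R t :=
  div_nonneg (mul_nonneg (sub_nonneg.2 (regParam_anti hα t)) hR) (regParam_pos hα _).le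

lemma regDrift_le {α R : ℝ} (hα : 0 < α) (hR : 0 ≤ R) (t : ℕ) :
    regDrift α R t ≤ R / ((t : ℝ) + 1) := by
  unfold regDrift
  rw [div_le_iff₀ (regParam_pos hα _)]
  have := mul_le_mul_of_nonneg_right (regParam_sub_le hα t) hR
  calc _ ≤ _ := this
    _ = _ := by ring

namespace DescentSystem

variable {α b l R : ℝ} {P G e d D γ : ℕ → ℝ}

lemma mul_regDrift {α R : ℝ} (hα : 0 < α) (t : ℕ) :
    regParam α (t + 1) * regDrift α R t = (regParam α t - regParam α (t + 1)) * R := by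
  unfold regDrift
  rw [mul_div_cancel₀ _ (regParam_pos hα _).ne']

/-- The error terms of `StepBounds.potential_step` telescope: the change of `θ` is absorbed by `θ
R²/2`, and the drift, of order `R²/(t+1)²`, by a multiple of `1/(t+1)`. -/
lemma potential_decrease (S : DescentSystem α b l R P G e d D γ) (hα : 0 < α) (hl : 0 < l)
    (hb : 35 ≤ b) (hbl : 2 / (α * l) - 1 < b) (t : ℕ) :
    P (t + 1) + 10 / (α * b * root (t + 2)) * d (t + 1) ^ 2 + regParam α (t + 1) * R ^ 2 / 2
        + 60 * R ^ 2 / (α * b) * (1 / ((t : ℝ) + 2)) + decrease α b l G e t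
      ≤ P t + 10 / (α * b * root (t + 1)) * d t ^ 2 + regParam α t * R ^ 2 / 2
        + 60 * R ^ 2 / (α * b) * (1 / ((t : ℝ) + 1)) := by
  have hb0 : 0 < b := by linarith
  have hw : 10 / (α * b * root (t + 2)) ≤ 10 / (α * b * root (t + 1)) := by
    have h1 := root_pos (t + 1)
    have h2 := root_mono (t + 1)
    gcongr
  have h := (stepBounds hα hl hb hbl (t + 1)).potential_step (S.e_nonneg _) (S.D_nonneg t)
    (S.descent t) (S.contract t) (S.triangle t)
    (r := regDrift α R t) (by rw [mul_regDrift hα]; exact S.drift t) hw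
  have h2 : 30 / (α * b) * regDrift α R t ^ 2
      ≤ 60 * R ^ 2 / (α * b) * (1 / ((t : ℝ) + 1) - 1 / ((t : ℝ) + 2)) := by
    have h3 : regDrift α R t ^ 2 ≤ (R / ((t : ℝ) + 1)) ^ 2 :=
      pow_le_pow_left₀ (regDrift_nonneg hα S.R_nonneg t) (regDrift_le hα S.R_nonneg t) 2
    have h4 : (R / ((t : ℝ) + 1)) ^ 2 ≤ 2 * R ^ 2 * (1 / ((t : ℝ) + 1) - 1 / ((t : ℝ) + 2)) := by
      have ht : (0 : ℝ) ≤ t := t.cast_nonneg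
      have e1 : 1 / ((t : ℝ) + 1) - 1 / ((t : ℝ) + 2) = 1 / (((t : ℝ) + 1) * (t + 2)) := by
        field_simp; ring
      rw [e1, div_pow, mul_one_div, div_le_div_iff₀ (by positivity) (by positivity)]
      have : 0 ≤ R ^ 2 * ((t : ℝ) + 1) * t := by positivity
      linarith
    calc _ ≤ 30 / (α * b) * (2 * R ^ 2 * (1 / ((t : ℝ) + 1) - 1 / ((t : ℝ) + 2))) :=
          mul_le_mul_of_nonneg_left (h3.trans h4) (by positivity)
      _ = _ := by ring
  unfold decrease
  linarith

/-- The total decrease allowed by the initial and the limiting value. -/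
def budget (α b R Pl Pu : ℝ) : ℝ :=
  Pu - Pl + 10 / (α * b) * (2 * R) ^ 2 + 1 / α * R ^ 2 + 60 * R ^ 2 / (α * b)

lemma decrease_nonneg (hα : 0 < α) (hl : 0 < l)
    (hb : 35 ≤ b) (hbl : 2 / (α * l) - 1 < b) (t : ℕ) : 0 ≤ decrease α b l G e t := by
  have h1 := (stepBounds hα hl hb hbl (t + 1)).η_pos
  have h2 := root_pos (t + 1)
  have hb0 : 0 < b := by linarith
  unfold decrease; positivity

lemma sum_decrease_le (S : DescentSystem α b l R P G e d D γ) (hα : 0 < α) (hl : 0 < l)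
    (hb : 35 ≤ b) (hbl : 2 / (α * l) - 1 < b) {Pl Pu : ℝ} (hPl : ∀ t, Pl ≤ P t) (hPu : P 0 ≤ Pu)
    (hd : d 0 ≤ 2 * R) (T : ℕ) :
    ∑ t ∈ Finset.range T, decrease α b l G e t ≤ budget α b R Pl Pu := by
  have hb0 : 0 < b := by linarith
  let W : ℕ → ℝ := fun t => P t + 10 / (α * b * root (t + 1)) * d t ^ 2
    + regParam α t * R ^ 2 / 2 + 60 * R ^ 2 / (α * b) * (1 / ((t : ℝ) + 1))
  have hstep : ∀ t, decrease α b l G e t ≤ W t - W (t + 1) := by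
    intro t
    have h := S.potential_decrease hα hl hb hbl t
    have e1 : ((t + 1 : ℕ) : ℝ) + 1 = t + 2 := by push_cast; ring
    simp only [W, e1]
    linarith
  have h1 : ∑ t ∈ Finset.range T, decrease α b l G e t ≤ W 0 - W T := by
    rw [← Finset.sum_range_sub']
    exact Finset.sum_le_sum fun t _ => hstep t
  have h2 : Pl ≤ W T := by
    have := root_pos (T + 1)
    have := regParam_pos hα T
    have h3 : 0 ≤ 10 / (α * b * root (T + 1)) * d T ^ 2 := by positivity
    have h4 : 0 ≤ regParam α T * R ^ 2 / 2 := by positivity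
    have h5 : 0 ≤ 60 * R ^ 2 / (α * b) * (1 / ((T : ℝ) + 1)) := by positivity
    have := hPl T
    simp only [W]
    linarith
  have h3 : W 0 ≤ Pu + 10 / (α * b) * (2 * R) ^ 2 + 1 / α * R ^ 2 + 60 * R ^ 2 / (α * b) := by
    have a1 : 10 / (α * b * root (0 + 1)) * d 0 ^ 2 ≤ 10 / (α * b) * (2 * R) ^ 2 := by
      refine mul_le_mul ?_ (pow_le_pow_left₀ (S.d_nonneg 0) hd 2) (sq_nonneg _) (by positivity)
      exact div_le_div_of_nonneg_left (by norm_num) (by positivity)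
        (le_mul_of_one_le_right (by positivity) (one_le_root _))
    have a2 : regParam α 0 * R ^ 2 / 2 ≤ 1 / α * R ^ 2 := by
      have : regParam α 0 ≤ 1 / α := by
        unfold regParam
        have : (0 : ℝ) < 1 / α := by positivity
        simp only [Nat.cast_zero, zero_add, Real.one_rpow]
        linarith
      have a3 := mul_le_mul_of_nonneg_right this (sq_nonneg R)
      have a4 : 0 ≤ 1 / α * R ^ 2 := by positivity
      linarith
    simp only [W, Nat.cast_zero, zero_add, div_one, mul_one] at a1 ⊢
    linarith
  unfold budget
  linarith

/-- Among the iterations `N, …, 2N - 1` there is one with small residuals. -/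
lemma exists_small (S : DescentSystem α b l R P G e d D γ) (hα : 0 < α) (hl : 0 < l)
    (hb : 35 ≤ b) (hbl : 2 / (α * l) - 1 < b) {Pl Pu : ℝ} (hPl : ∀ t, Pl ≤ P t) (hPu : P 0 ≤ Pu)
    (hd : d 0 ≤ 2 * R) {N : ℕ} (hN : 1 ≤ N) :
    ∃ t, N ≤ t ∧ t < 2 * N ∧
      G (t + 1) ^ 2 ≤ 64 * (α * b) * (budget α b R Pl Pu + 1) * l ^ 2 / √N ∧
      e t ^ 2 ≤ 64 * (α * b) * (budget α b R Pl Pu + 1) / √N := by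
  have hb0 : 0 < b := by linarith
  set B := budget α b R Pl Pu with hB
  have hsum := S.sum_decrease_le hα hl hb hbl hPl hPu hd
  have hdec := fun t => decrease_nonneg (G := G) (e := e) hα hl hb hbl t
  have hB0 : 0 ≤ B := (Finset.sum_nonneg fun t _ => hdec t).trans (hsum 0)
  set K := 64 * (α * b) * (B + 1) with hK
  have hK0 : 0 < K := by positivity
  have hN0 : (0 : ℝ) < N := by exact_mod_cast hN
  have hsN : 0 < √(N : ℝ) := Real.sqrt_pos.2 hN0
  -- If every `t` in the range had a large residual, each would force a decrease of at least `4(B +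
  -- 1)/N`, so the sum would exceed twice the budget.
  by_contra hcon
  push Not at hcon
  have hroot : ∀ t < 2 * N, root (t + 1) ^ 2 ≤ 2 * √(N : ℝ) := by
    intro t ht
    rw [root_sq]
    have : 2 * √(N : ℝ) = √(4 * N) := by
      rw [Real.sqrt_mul (by norm_num), show (4 : ℝ) = 2 ^ 2 by norm_num,
        Real.sqrt_sq (by norm_num)]
    rw [this]
    apply Real.sqrt_le_sqrt
    have h1 : (t : ℝ) + 1 ≤ 2 * N := by exact_mod_cast ht
    have h2 : (1 : ℝ) ≤ N := by exact_mod_cast hN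
    push_cast
    linarith
  have hroot0 : ∀ t < 2 * N, root t ^ 2 ≤ 2 * √(N : ℝ) := fun t ht =>
    (pow_le_pow_left₀ (root_pos t).le (root_mono t) 2).trans (hroot t ht)
  -- The residual `G (t+1)` enters the decrease at `t`, but `e t` enters the decrease at `t - 1`.
  -- Both are wanted at the same iteration, so two consecutive decreases are added; this is why `N ≥
  -- 1` is required and each decrease is counted at most twice.
  have hlow : ∀ t, N ≤ t → t < 2 * N →
      4 * (B + 1) / N ≤ decrease α b l G e t + decrease α b l G e (t - 1) := by
    intro t ht1 ht2
    have ht0 : t - 1 + 1 = t := Nat.sub_add_cancel (hN.trans ht1)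
    have hSN : √(N : ℝ) * √(N : ℝ) = N := Real.mul_self_sqrt hN0.le
    by_cases hG : G (t + 1) ^ 2 ≤ K * l ^ 2 / √N
    · have he := hcon t ht1 ht2 hG
      have h1 : 4 * (B + 1) / N ≤ e t ^ 2 / (α * b * root t ^ 2) := by
        have hr := root_pos t
        rw [div_le_div_iff₀ hN0 (by positivity)]
        have h2 : α * b * root t ^ 2 ≤ α * b * (2 * √N) :=
          mul_le_mul_of_nonneg_left (hroot0 t ht2) (by positivity)
        have h3 := (div_lt_iff₀ hsN).1 he
        have h4 : K * √(N : ℝ) ≤ e t ^ 2 * N := by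
          have := mul_le_mul_of_nonneg_right h3.le hsN.le
          refine this.trans (le_of_eq ?_)
          rw [mul_assoc, hSN]
        have h5 : 4 * (B + 1) * (α * b * root t ^ 2) ≤ 4 * (B + 1) * (α * b * (2 * √N)) :=
          mul_le_mul_of_nonneg_left h2 (by positivity)
        have h6 : 4 * (B + 1) * (α * b * (2 * √(N : ℝ))) ≤ K * √N := by
          have : 0 ≤ (B + 1) * (α * b) * √(N : ℝ) := by positivity
          rw [hK]; linarith
        linarith
      have h2 := (stepBounds hα hl hb hbl t).η_pos
      have h3 : e t ^ 2 / (α * b * root t ^ 2) ≤ decrease α b l G e (t - 1) := by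
        unfold decrease
        rw [ht0]
        have : 0 ≤ stepX α b l t * G t ^ 2 / 4 := by positivity
        linarith
      linarith [hdec t]
    · push Not at hG
      have hst := stepBounds hα hl hb hbl (t + 1)
      have hη := hst.η_pos
      have hr := root_pos (t + 1)
      have h1 : 4 * (B + 1) / N ≤ stepX α b l (t + 1) * G (t + 1) ^ 2 / 4 := by
        rw [div_le_div_iff₀ hN0 (by norm_num)]
        have h3 := (div_lt_iff₀ hsN).1 hG
        have h4 : K * l ^ 2 * √(N : ℝ) ≤ G (t + 1) ^ 2 * N := by
          have := mul_le_mul_of_nonneg_right h3.le hsN.le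
          refine this.trans (le_of_eq ?_)
          rw [mul_assoc, hSN]
        have h5 := mul_le_mul_of_nonneg_left h4 hη.le
        have h6 : 1 / 2 ≤ stepX α b l (t + 1) * l ^ 2 * (α * b * (2 * √N)) :=
          hst.le_η_sq.trans (mul_le_mul_of_nonneg_left
            (mul_le_mul_of_nonneg_left (hroot t ht2) (by positivity)) (by positivity))
        have h7 := mul_le_mul_of_nonneg_left h6 (by positivity : 0 ≤ 32 * (B + 1))
        have h8 : stepX α b l (t + 1) * (K * l ^ 2 * √(N : ℝ))
            = 32 * (B + 1) * (stepX α b l (t + 1) * l ^ 2 * (α * b * (2 * √N))) := by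
          rw [hK]; ring
        rw [h8] at h5
        linarith
      have h2 : stepX α b l (t + 1) * G (t + 1) ^ 2 / 4 ≤ decrease α b l G e t := by
        unfold decrease
        have : 0 ≤ e (t + 1) ^ 2 / (α * b * root (t + 1) ^ 2) := by positivity
        linarith
      linarith [hdec (t - 1)]
  have h1 : ∑ t ∈ Finset.Ico N (2 * N), (4 * (B + 1) / N : ℝ) = 4 * (B + 1) := by
    rw [Finset.sum_const, Nat.card_Ico, nsmul_eq_mul, show 2 * N - N = N by omega]
    field_simp
  have h2 : ∑ t ∈ Finset.Ico N (2 * N), (4 * (B + 1) / N : ℝ)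
      ≤ ∑ t ∈ Finset.Ico N (2 * N), (decrease α b l G e t + decrease α b l G e (t - 1)) :=
    Finset.sum_le_sum fun t ht => hlow t (Finset.mem_Ico.1 ht).1 (Finset.mem_Ico.1 ht).2
  rw [Finset.sum_add_distrib] at h2
  have h3 : ∑ t ∈ Finset.Ico N (2 * N), decrease α b l G e t ≤ B :=
    (Finset.sum_le_sum_of_subset_of_nonneg (fun t ht => Finset.mem_range.2 (Finset.mem_Ico.1 ht).2)
      fun t _ _ => hdec t).trans (hsum (2 * N))
  have h4 : ∑ t ∈ Finset.Ico N (2 * N), decrease α b l G e (t - 1) ≤ B := by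
    have : ∑ t ∈ Finset.Ico N (2 * N), decrease α b l G e (t - 1)
        = ∑ t ∈ Finset.Ico (N - 1) (2 * N - 1), decrease α b l G e t := by
      have := Finset.sum_Ico_add' (fun t => decrease α b l G e (t - 1)) (N - 1) (2 * N - 1) 1
      rw [Nat.sub_add_cancel hN, Nat.sub_add_cancel (by omega)] at this
      rw [← this]
      simp
    rw [this]
    exact (Finset.sum_le_sum_of_subset_of_nonneg
      (fun t ht => Finset.mem_range.2 (Finset.mem_Ico.1 ht).2)
      fun t _ _ => hdec t).trans (hsum (2 * N - 1))
  linarith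

end DescentSystem

end Sequences

end SmMGDA

end

/-! ### Convergence of the residuals along the whole sequence. -/

noncomputable section

namespace SmMGDA

open Filter Topology

section Convergence

/-- A nonnegative sequence with summable increments that is frequently small tends to zero. -/
lemma tendsto_zero_of_summable_increments {H s : ℕ → ℝ} (hH : ∀ t, 0 ≤ H t)
    (hs0 : ∀ t, 0 ≤ s t) (hs : Summable s) (hstep : ∀ t, H (t + 1) ≤ H t + s t)
    (hfreq : ∀ ε > 0, ∀ N, ∃ t ≥ N, H t < ε) : Tendsto H atTop (𝓝 0) := by
  -- The sequence minus its accumulated allowance is nonincreasing, so after a small value it can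
  -- grow only by a tail of the series.
  have hmono : ∀ n m, n ≤ m →
      H m - ∑ i ∈ Finset.range m, s i ≤ H n - ∑ i ∈ Finset.range n, s i := by
    intro n m hnm
    induction m, hnm using Nat.le_induction with
    | base => exact le_rfl
    | succ m _ ih =>
      rw [Finset.sum_range_succ]
      linarith [hstep m]
  have htail := hs.hasSum.tendsto_sum_nat
  rw [Metric.tendsto_atTop]
  intro ε hε
  obtain ⟨N, hN⟩ := (Metric.tendsto_atTop.1 htail) (ε / 2) (half_pos hε)
  obtain ⟨n, hnN, hn⟩ := hfreq (ε / 2) (half_pos hε) N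
  refine ⟨n, fun m hm => ?_⟩
  rw [Real.dist_eq, sub_zero, abs_of_nonneg (hH m)]
  have h1 := hmono n m hm
  have h2 := hs.sum_le_tsum (Finset.range m) fun i _ => hs0 i
  have h3 := hN n hnN
  rw [Real.dist_eq, abs_sub_lt_iff] at h3
  linarith [h3.2]

namespace DescentSystem

variable {α b l R : ℝ} {P G e d D γ : ℕ → ℝ}

lemma summable_decrease (S : DescentSystem α b l R P G e d D γ) (hα : 0 < α) (hl : 0 < l)
    (hb : 35 ≤ b) (hbl : 2 / (α * l) - 1 < b) {Pl Pu : ℝ} (hPl : ∀ t, Pl ≤ P t) (hPu : P 0 ≤ Pu)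
    (hd : d 0 ≤ 2 * R) : Summable (decrease α b l G e) :=
  summable_of_sum_range_le (fun t => decrease_nonneg hα hl hb hbl t)
    (S.sum_decrease_le hα hl hb hbl hPl hPu hd)

lemma d_le_e (S : DescentSystem α b l R P G e d D γ) (hα : 0 < α) (t : ℕ) :
    d (t + 1) ≤ e (t + 1) := by
  refine le_of_sq_le_sq ((S.contract t).trans ?_) (S.e_nonneg _)
  have := mul_nonneg (mul_pos hα (regParam_pos hα (t + 1))).le (sq_nonneg (e (t + 1)))
  linarith

/-- The ratio `θ/η` grows like the fourth root of `t`, whereas the squared drift decays like `1/t²`.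
Bounding the root by a square root gives the summable exponent `3/2`. -/
lemma summable_drift (hα : 0 < α) (hl : 0 < l) (hb : 35 ≤ b) (hbl : 2 / (α * l) - 1 < b)
    (hR : 0 ≤ R) :
    Summable fun t => regParam α (t + 1) / stepX α b l (t + 1) * regDrift α R t ^ 2 / 2 := by
  have hb0 : 0 < b := by linarith
  have hsum : Summable fun t : ℕ => 1 / |(t : ℝ) + 1| ^ (3 / 2 : ℝ) :=
    Real.summable_one_div_nat_add_rpow 1 (3 / 2) |>.2 (by norm_num)
  refine Summable.of_nonneg_of_le (fun t => ?_) (fun t => ?_)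
    (hsum.mul_left (2 * l ^ 2 * b * R ^ 2))
  · have h1 := (stepBounds hα hl hb hbl (t + 1)).η_pos
    have h2 := regParam_pos hα (t + 1)
    positivity
  · have hst := stepBounds hα hl hb hbl (t + 1)
    have hη := hst.η_pos
    have hq := root_pos (t + 1)
    have hθ := regParam_pos hα (t + 1)
    have h1 : regParam α (t + 1) / stepX α b l (t + 1) ≤ 2 * l ^ 2 * b * root (t + 1) := by
      rw [div_le_iff₀ hη]
      have a1 := mul_le_mul_of_nonneg_left hst.le_η_sq
        (by positivity : 0 ≤ 2 * regParam α (t + 1))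
      have a2 : 2 * regParam α (t + 1)
          * (stepX α b l (t + 1) * l ^ 2 * (α * b * root (t + 1) ^ 2))
          = 2 * (α * regParam α (t + 1) * root (t + 1))
            * (l ^ 2 * b * root (t + 1) * stepX α b l (t + 1)) := by ring
      rw [a2, hst.θ_eq] at a1
      have : 0 ≤ l ^ 2 * b * root (t + 1) * stepX α b l (t + 1) := by positivity
      linarith
    have ht1 : (0 : ℝ) < (t : ℝ) + 1 := by positivity
    have h2 : root (t + 1) ≤ 2 * √((t : ℝ) + 1) := by
      have a1 : root (t + 1) ≤ root (t + 1) ^ 2 := by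
        rw [sq]; exact le_mul_of_one_le_left hq.le (one_le_root _)
      rw [root_sq] at a1
      refine a1.trans ?_
      have : 2 * √((t : ℝ) + 1) = √(4 * ((t : ℝ) + 1)) := by
        rw [Real.sqrt_mul (by norm_num), show (4 : ℝ) = 2 ^ 2 by norm_num,
          Real.sqrt_sq (by norm_num)]
      rw [this]
      refine Real.sqrt_le_sqrt ?_
      push_cast
      linarith [(t.cast_nonneg : (0 : ℝ) ≤ t)]
    have h3 : regDrift α R t ^ 2 ≤ (R / ((t : ℝ) + 1)) ^ 2 :=
      pow_le_pow_left₀ (regDrift_nonneg hα hR t) (regDrift_le hα hR t) 2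
    have h4 : √((t : ℝ) + 1) * (1 / ((t : ℝ) + 1)) ^ 2 = 1 / |(t : ℝ) + 1| ^ (3 / 2 : ℝ) := by
      have e1 : ((t : ℝ) + 1) ^ (3 / 2 : ℝ) = ((t : ℝ) + 1) * √((t : ℝ) + 1) := by
        rw [show (3 / 2 : ℝ) = 1 + 1 / 2 by norm_num, Real.rpow_add ht1, Real.rpow_one,
          Real.sqrt_eq_rpow]
      have e2 := Real.sq_sqrt ht1.le
      have e3 := Real.sqrt_pos.2 ht1
      rw [abs_of_pos ht1, e1, div_pow, one_pow, mul_one_div, div_eq_div_iff (by positivity)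
        (by positivity), sq ((t : ℝ) + 1)]
      linear_combination ((t : ℝ) + 1) * e2
    calc regParam α (t + 1) / stepX α b l (t + 1) * regDrift α R t ^ 2 / 2
        ≤ (2 * l ^ 2 * b * (2 * √((t : ℝ) + 1))) * (R / ((t : ℝ) + 1)) ^ 2 / 2 := by
          refine div_le_div_of_nonneg_right ?_ (by norm_num)
          refine mul_le_mul (h1.trans (mul_le_mul_of_nonneg_left h2 (by positivity))) h3
            (sq_nonneg _) (by positivity)
      _ = 2 * l ^ 2 * b * R ^ 2 * (√((t : ℝ) + 1) * (1 / ((t : ℝ) + 1)) ^ 2) := by ring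
      _ = _ := by rw [h4]

/-- The energy increments are dominated by the summable decreases of the potential plus the summable
drift. Frequent smallness comes from `exists_small`, converting `G` and `e` into `γ` and `d`. -/
lemma tendsto_energy (S : DescentSystem α b l R P G e d D γ) (hα : 0 < α) (hl : 0 < l)
    (hb : 35 ≤ b) (hbl : 2 / (α * l) - 1 < b) {Pl Pu : ℝ} (hPl : ∀ t, Pl ≤ P t) (hPu : P 0 ≤ Pu)
    (hd : d 0 ≤ 2 * R) :
    Tendsto (fun t => γ t ^ 2 / 2 + 2 * l ^ 2 * d t ^ 2) atTop (𝓝 0) := by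
  have hb0 : 0 < b := by linarith
  have hη : ∀ t, 0 < stepX α b l (t + 1) := fun t => (stepBounds hα hl hb hbl (t + 1)).η_pos
  have hsum1 : Summable fun t =>
      (l + 8 / (3 * (α * b))) * (stepX α b l (t + 1) * G (t + 1) ^ 2) := by
    refine Summable.of_nonneg_of_le (fun t => ?_) (fun t => ?_)
      ((S.summable_decrease hα hl hb hbl hPl hPu hd).mul_left (4 * (l + 8 / (3 * (α * b)))))
    · have := hη t
      positivity
    · rw [mul_comm 4, mul_assoc]
      refine mul_le_mul_of_nonneg_left ?_ (by positivity)
      have h1 := root_pos (t + 1)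
      have h2 : 0 ≤ e (t + 1) ^ 2 / (α * b * root (t + 1) ^ 2) := by positivity
      unfold decrease
      linarith
  have hsum2 := summable_drift (R := R) hα hl hb hbl S.R_nonneg
  refine tendsto_zero_of_summable_increments (fun t => by positivity) (fun t => ?_)
    (hsum1.add hsum2) (fun t => ?_) fun ε hε N => ?_
  · have h1 := hη t
    have h2 := regParam_pos hα (t + 1)
    positivity
  · refine (stepBounds hα hl hb hbl (t + 1)).energy_step (S.e_nonneg _) ?_ (S.contract t)
      (S.triangle t)
    rw [mul_regDrift hα]
    exact S.growth t
  · set K := 64 * (α * b) * (budget α b R Pl Pu + 1) with hK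
    have hlim : Tendsto (fun n : ℕ => 4 * K * l ^ 2 * (√(n : ℝ))⁻¹) atTop (𝓝 0) := by
      have : Tendsto (fun n : ℕ => (√(n : ℝ))⁻¹) atTop (𝓝 0) :=
        tendsto_inv_atTop_zero.comp
          (Real.tendsto_sqrt_atTop.comp tendsto_natCast_atTop_atTop)
      simpa using this.const_mul (4 * K * l ^ 2)
    obtain ⟨n, hn⟩ := ((hlim.eventually (gt_mem_nhds hε)).and
      (eventually_ge_atTop (N + 1))).exists
    obtain ⟨t, ht1, ht2, hG, he⟩ := S.exists_small hα hl hb hbl hPl hPu hd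
      (N := n) (by omega)
    obtain ⟨t', rfl⟩ : ∃ t', t = t' + 1 := ⟨t - 1, by omega⟩
    refine ⟨t' + 1, by omega, lt_of_le_of_lt ?_ hn.1⟩
    have h1 := S.γ_le (t' + 1)
    have h2 : d (t' + 1) ^ 2 ≤ e (t' + 1) ^ 2 :=
      pow_le_pow_left₀ (S.d_nonneg _) (S.d_le_e hα t') 2
    have h3 : γ (t' + 1) ^ 2 ≤ 2 * G (t' + 1 + 1) ^ 2 + 2 * (l * d (t' + 1)) ^ 2 := by
      have a1 := pow_le_pow_left₀ (S.γ_nonneg _) h1 2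
      have a2 := sq_nonneg (G (t' + 1 + 1) - l * d (t' + 1))
      linarith
    have h4 := mul_le_mul_of_nonneg_left (h2.trans he) (sq_nonneg l)
    have e1 : K * l ^ 2 / √(n : ℝ) = K * l ^ 2 * (√(n : ℝ))⁻¹ := div_eq_mul_inv _ _
    have e2 : l ^ 2 * (K / √(n : ℝ)) = K * l ^ 2 * (√(n : ℝ))⁻¹ := by
      rw [div_eq_mul_inv]; ring
    rw [e1] at hG
    rw [e2] at h4
    linarith

lemma tendsto_d (S : DescentSystem α b l R P G e d D γ) (hα : 0 < α) (hl : 0 < l)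
    (hb : 35 ≤ b) (hbl : 2 / (α * l) - 1 < b) {Pl Pu : ℝ} (hPl : ∀ t, Pl ≤ P t) (hPu : P 0 ≤ Pu)
    (hd : d 0 ≤ 2 * R) : Tendsto d atTop (𝓝 0) := by
  have h := S.tendsto_energy hα hl hb hbl hPl hPu hd
  have h1 : Tendsto (fun t => d t ^ 2) atTop (𝓝 0) := by
    refine squeeze_zero (fun t => sq_nonneg _) (fun t => ?_)
      (by simpa using h.const_mul (1 / (2 * l ^ 2)))
    have : 0 ≤ γ t ^ 2 / 2 / (2 * l ^ 2) := by positivity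
    have e1 : 1 / (2 * l ^ 2) * (γ t ^ 2 / 2 + 2 * l ^ 2 * d t ^ 2)
        = γ t ^ 2 / 2 / (2 * l ^ 2) + d t ^ 2 := by field_simp
    rw [e1]; linarith
  have h2 := (Real.continuous_sqrt.tendsto 0).comp h1
  rw [Real.sqrt_zero] at h2
  exact h2.congr fun t => Real.sqrt_sq (S.d_nonneg t)

lemma tendsto_G (S : DescentSystem α b l R P G e d D γ) (hα : 0 < α) (hl : 0 < l)
    (hb : 35 ≤ b) (hbl : 2 / (α * l) - 1 < b) {Pl Pu : ℝ} (hPl : ∀ t, Pl ≤ P t) (hPu : P 0 ≤ Pu)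
    (hd : d 0 ≤ 2 * R) : Tendsto (fun t => G (t + 1)) atTop (𝓝 0) := by
  have h := S.tendsto_energy hα hl hb hbl hPl hPu hd
  have h1 : Tendsto (fun t => γ t ^ 2) atTop (𝓝 0) := by
    refine squeeze_zero (fun t => sq_nonneg _) (fun t => ?_)
      (by simpa using h.const_mul 2)
    have : 0 ≤ l ^ 2 * d t ^ 2 := by positivity
    linarith
  have h2 := (Real.continuous_sqrt.tendsto 0).comp h1
  rw [Real.sqrt_zero] at h2
  have h3 : Tendsto γ atTop (𝓝 0) := h2.congr fun t => Real.sqrt_sq (S.γ_nonneg t)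
  refine squeeze_zero (fun t => S.G_nonneg _) S.le_γ ?_
  simpa using h3.add ((S.tendsto_d hα hl hb hbl hPl hPu hd).const_mul l)

/-- Since `e ≤ d + D`, it is enough that the displacement `D` of the best response vanishes; it is
bounded by a multiple of `G` plus `R/(t+1)`. -/
lemma tendsto_e (S : DescentSystem α b l R P G e d D γ) (hα : 0 < α) (hl : 0 < l)
    (hb : 35 ≤ b) (hbl : 2 / (α * l) - 1 < b) {Pl Pu : ℝ} (hPl : ∀ t, Pl ≤ P t) (hPu : P 0 ≤ Pu)
    (hd : d 0 ≤ 2 * R) : Tendsto (fun t => e (t + 1)) atTop (𝓝 0) := by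
  have hb0 : 0 < b := by linarith
  have hD : ∀ t, D t ≤ 20 / 19 * (4 / 3) / (l * b) * G (t + 1) + R * (1 / ((t : ℝ) + 1)) := by
    intro t
    have hst := stepBounds hα hl hb hbl (t + 1)
    have hη := hst.η_pos
    have hq := root_pos (t + 1)
    have hθ := regParam_pos hα (t + 1)
    have h1 := S.drift t
    rw [← mul_regDrift hα] at h1
    have h2 : l * stepX α b l (t + 1)
        ≤ 20 / 19 * (4 / 3) / (l * b) * regParam α (t + 1) := by
      rw [div_mul_eq_mul_div, le_div_iff₀ (by positivity)]
      have a1 := hst.η_sq_le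
      have a2 := hst.θ_eq
      have a3 : l * stepX α b l (t + 1) * (l * b)
          = stepX α b l (t + 1) * l ^ 2 * (α * b * root (t + 1) ^ 2) * (1 / (α * root (t + 1) ^ 2)) := by
        field_simp
      have a4 : 1 / (α * root (t + 1) ^ 2) ≤ 20 / 19 * regParam α (t + 1) := by
        rw [div_le_iff₀ (by positivity)]
        have : 20 / 19 * regParam α (t + 1) * (α * root (t + 1) ^ 2)
          = 20 / 19 * (α * regParam α (t + 1) * root (t + 1)) * root (t + 1) := by ring
        rw [this, a2]
        linarith [one_le_root (t + 1)]
      rw [a3]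
      calc _ ≤ 4 / 3 * (20 / 19 * regParam α (t + 1)) :=
            mul_le_mul a1 a4 (by positivity) (by norm_num)
        _ = _ := by ring
    have h3 := mul_le_mul_of_nonneg_right h2 (S.G_nonneg (t + 1))
    have h4 : regParam α (t + 1) * regDrift α R t
        ≤ regParam α (t + 1) * (R * (1 / ((t : ℝ) + 1))) := by
      rw [mul_one_div]
      exact mul_le_mul_of_nonneg_left (regDrift_le hα S.R_nonneg t) hθ.le
    refine le_of_mul_le_mul_left ?_ hθ
    linarith
  have h1 := (S.tendsto_G hα hl hb hbl hPl hPu hd).const_mul (20 / 19 * (4 / 3) / (l * b))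
  have h2 := (tendsto_one_div_add_atTop_nhds_zero_nat (𝕜 := ℝ)).const_mul R
  refine squeeze_zero (fun t => S.e_nonneg _)
    (fun t => (S.triangle t).trans (add_le_add le_rfl (hD t))) ?_
  simpa using (S.tendsto_d hα hl hb hbl hPl hPu hd).add (h1.add h2)

end DescentSystem

end Convergence

end SmMGDA

end

/-! ### From the iterates to the scalar system. -/

noncomputable section

namespace SmMGDA

section Iterates

variable {E V : Type*} [NormedAddCommGroup E] [InnerProductSpace ℝ E] [CompleteSpace E]
  [NormedAddCommGroup V] [InnerProductSpace ℝ V] [CompleteSpace V]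
  {F : E → V → ℝ} {h : V → ℝ} {X : Set E} {Y : Set V} {l L : ℝ}

/-- The iterates of the alternating method satisfy the scalar descent inequalities. -/
lemma IsSaddleObjective.exists_descentSystem (H : IsSaddleObjective F h X Y l L) {α b R : ℝ}
    (hα : 0 < α) (hl : 0 < l) (hb : 35 ≤ b) (hbl : 2 / (α * l) - 1 < b) (hαL : α * (10 * L) ≤ 1)
    (hR : ∀ y ∈ Y, ‖y‖ ≤ R) {x : ℕ → E} {y : ℕ → V} (hx : ∀ t, x t ∈ X) (hy : ∀ t, y t ∈ Y)
    (hstep : ∀ t, x (t + 1) = x t - stepX α b l t • gradX F (x t) (y t))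
    (hprox : ∀ t, ∀ w ∈ Y, h (y (t + 1)) + inner ℝ (α⁻¹ • (y t + α • (gradY F (x (t + 1)) (y t)
      - regParam α t • y t) - y (t + 1))) (w - y (t + 1)) ≤ h w) :
    ∃ z : ℕ → V, (∀ t, IsBestResponse F h Y (regParam α t) (x (t + 1)) (z t)) ∧
      DescentSystem α b l R (fun t => regObjective F h (regParam α t) (x (t + 1)) (z t))
        (fun t => ‖gradX F (x t) (y t)‖) (fun t => ‖y t - z t‖) (fun t => ‖y (t + 1) - z t‖)
        (fun t => ‖z (t + 1) - z t‖) (fun t => ‖gradX F (x (t + 1)) (z t)‖) := by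
  -- The maximizer `z t` belongs to `x (t + 1)` with the weight of index `t`, because the `y` update
  -- at iteration `t` already uses the new `x`.
  choose z hz using fun t => H.exists_isBestResponse (regParam α t) (hx (t + 1))
  have hη : ∀ t, 0 < stepX α b l t := fun t => (stepBounds hα hl hb hbl t).η_pos
  refine ⟨z, hz, ⟨(norm_nonneg _).trans (hR _ (hy 0)), fun t => norm_nonneg _,
    fun t => norm_nonneg _, fun t => norm_nonneg _, fun t => norm_nonneg _,
    fun t => norm_nonneg _, fun t => ?_, fun t => ?_, fun t => ?_, fun t => ?_, fun t => ?_,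
    fun t => ?_, fun t => ?_⟩⟩
  · exact H.value_descent (hx _) (hx _) (hy _) (hz t) (hz (t + 1)).1 (regParam_anti hα t)
      (hη _).le (hR _ (hz (t + 1)).1) (hstep (t + 1))
  · have h1 := H.prox_step_contraction (hx _) (hy (t + 1)) (hy (t + 1 + 1)) (hz (t + 1)) hα
      (by linarith [mul_regParam_succ_le hα t]) (hprox (t + 1))
    have h2 := mul_nonneg (mul_pos hα (regParam_pos hα (t + 1))).le
      (sq_nonneg ‖y (t + 1 + 1) - z (t + 1)‖)
    linarith
  · have : y (t + 1) - z (t + 1) = (y (t + 1) - z t) - (z (t + 1) - z t) := by abel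
    simp only [this]
    exact norm_sub_le _ _
  · have h1 := H.best_response_lipschitz (hx _) (hx _) (hz t) (hz (t + 1)) (regParam_anti hα t)
      (hR _ (hz t).1) (hR _ (hz (t + 1)).1)
    have h2 : ‖x (t + 1 + 1) - x (t + 1)‖
        = stepX α b l (t + 1) * ‖gradX F (x (t + 1)) (y (t + 1))‖ := by
      rw [hstep (t + 1), sub_sub_cancel_left, norm_neg, norm_smul, Real.norm_eq_abs,
        abs_of_pos (hη _)]
    rwa [h2] at h1
  · exact H.value_gradient_growth (hx _) (hx _) (hy _) (hz t) (hz (t + 1)) (regParam_anti hα t)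
      (hη _) (hR _ (hz t).1) (hR _ (hz (t + 1)).1) (hstep (t + 1))
  · have h1 := H.lip_xy (hx (t + 1)) (z t) (hz t).1 (y (t + 1)) (hy _)
    have h2 := norm_sub_norm_le (gradX F (x (t + 1)) (z t)) (gradX F (x (t + 1)) (y (t + 1)))
    rw [norm_sub_rev (z t)] at h1
    linarith
  · have h1 := H.lip_xy (hx (t + 1)) (y (t + 1)) (hy _) (z t) (hz t).1
    have h2 := norm_sub_norm_le (gradX F (x (t + 1)) (y (t + 1))) (gradX F (x (t + 1)) (z t))
    linarith

end Iterates

end SmMGDA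

end

/-! ### Standing assumptions, data bounds and the size of `l`. -/

noncomputable section

namespace SmMGDA

open Matrix Filter Topology

section Problem

variable {d₁ r d₂ : ℕ}

/-- The standing assumptions on the problem. -/
structure IsProblem (f : MatSpace d₁ r → EuclideanSpace ℝ (Fin d₂) → ℝ)
    (h : EuclideanSpace ℝ (Fin d₂) → EReal) (C Lxx Lxy Lyx Lyy : ℝ) : Prop where
  r_pos : 0 < r
  C_gt : √r + 1 / 2 < C
  reg : IsRegularizer h
  diff : ∃ U : Set (MatSpace d₁ r × EuclideanSpace ℝ (Fin d₂)), IsOpen U ∧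
      (dissolve '' Metric.closedBall 0 C) ×ˢ effDom h ⊆ U ∧
      DifferentiableOn ℝ (Function.uncurry f) U
  lip : GradLipschitzOn f (dissolve '' Metric.closedBall 0 C) (effDom h) Lxx Lxy Lyx Lyy
  conc : ∀ x ∈ dissolve '' Metric.closedBall (0 : MatSpace d₁ r) C, ConcaveOn ℝ (effDom h) (f x)

/-- Bounds for the data of the problem. -/
structure DataBounds (f : MatSpace d₁ r → EuclideanSpace ℝ (Fin d₂) → ℝ)
    (h : EuclideanSpace ℝ (Fin d₂) → EReal) (C G₀ G₁ Mf Mh R : ℝ) : Prop where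
  G₀_nonneg : 0 ≤ G₀
  gradX_le : ∀ x ∈ Metric.closedBall (0 : MatSpace d₁ r) C, ∀ y ∈ effDom h,
    ‖gradX f (dissolve x) y‖ ≤ G₀
  gradY_le : ∀ x ∈ Metric.closedBall (0 : MatSpace d₁ r) C, ∀ y ∈ effDom h,
    ‖gradY f (dissolve x) y‖ ≤ G₁
  f_le : ∀ x ∈ Metric.closedBall (0 : MatSpace d₁ r) C, ∀ y ∈ effDom h, |f (dissolve x) y| ≤ Mf
  h_le : ∀ y ∈ effDom h, |(h y).toReal| ≤ Mh
  norm_le : ∀ y ∈ effDom h, ‖y‖ ≤ R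

variable {f : MatSpace d₁ r → EuclideanSpace ℝ (Fin d₂) → ℝ}
  {h : EuclideanSpace ℝ (Fin d₂) → EReal} {C Lxx Lxy Lyx Lyy : ℝ}

namespace IsProblem

lemma C_pos (Q : IsProblem f h C Lxx Lxy Lyx Lyy) : 0 < C := by
  have := Real.sqrt_nonneg (r : ℝ)
  linarith [Q.C_gt]

lemma isCompact_image (_ : IsProblem f h C Lxx Lxy Lyx Lyy) :
    IsCompact (dissolve '' Metric.closedBall (0 : MatSpace d₁ r) C) :=
  (isCompact_closedBall _ _).image differentiable_dissolve.continuous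

lemma differentiableAt (Q : IsProblem f h C Lxx Lxy Lyx Lyy) {x : MatSpace d₁ r}
    (hx : x ∈ Metric.closedBall (0 : MatSpace d₁ r) C) {y : EuclideanSpace ℝ (Fin d₂)}
    (hy : y ∈ effDom h) : DifferentiableAt ℝ (Function.uncurry f) (dissolve x, y) := by
  obtain ⟨U, hU, hsub, hd⟩ := Q.diff
  have hmem : (dissolve x, y) ∈ U := hsub ⟨Set.mem_image_of_mem _ hx, hy⟩
  exact hd.differentiableAt (hU.mem_nhds hmem)

lemma differentiableAt_left (Q : IsProblem f h C Lxx Lxy Lyx Lyy) {x : MatSpace d₁ r}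
    (hx : x ∈ Metric.closedBall (0 : MatSpace d₁ r) C) {y : EuclideanSpace ℝ (Fin d₂)}
    (hy : y ∈ effDom h) : DifferentiableAt ℝ (fun x' => f x' y) (dissolve x) :=
  DifferentiableAt.comp (g := Function.uncurry f) (f := fun x' => (x', y)) (dissolve x)
    (Q.differentiableAt hx hy) (by fun_prop)

lemma differentiableAt_right (Q : IsProblem f h C Lxx Lxy Lyx Lyy) {x : MatSpace d₁ r}
    (hx : x ∈ Metric.closedBall (0 : MatSpace d₁ r) C) {y : EuclideanSpace ℝ (Fin d₂)}
    (hy : y ∈ effDom h) : DifferentiableAt ℝ (f (dissolve x)) y :=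
  DifferentiableAt.comp (g := Function.uncurry f) (f := fun y' => (dissolve x, y')) y
    (Q.differentiableAt hx hy) (by fun_prop)

lemma hasGradientAt_left (Q : IsProblem f h C Lxx Lxy Lyx Lyy) (ρ : ℝ) {x : MatSpace d₁ r}
    (hx : x ∈ Metric.closedBall (0 : MatSpace d₁ r) C) {y : EuclideanSpace ℝ (Fin d₂)}
    (hy : y ∈ effDom h) : HasGradientAt (fun x' => penalized f ρ x' y)
      (dissolveAdj x (gradX f (dissolve x) y) + (ρ / 2) • constrAdj x (constr x)) x :=
  hasGradientAt_penalized f ρ (Q.differentiableAt_left hx hy)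

lemma gradX_penalized (Q : IsProblem f h C Lxx Lxy Lyx Lyy) (ρ : ℝ) {x : MatSpace d₁ r}
    (hx : x ∈ Metric.closedBall (0 : MatSpace d₁ r) C) {y : EuclideanSpace ℝ (Fin d₂)}
    (hy : y ∈ effDom h) : gradX (penalized f ρ) x y
      = dissolveAdj x (gradX f (dissolve x) y) + (ρ / 2) • constrAdj x (constr x) :=
  (Q.hasGradientAt_left ρ hx hy).gradient

lemma hasGradientAt_right (Q : IsProblem f h C Lxx Lxy Lyx Lyy) (ρ : ℝ) {x : MatSpace d₁ r}
    (hx : x ∈ Metric.closedBall (0 : MatSpace d₁ r) C) {y : EuclideanSpace ℝ (Fin d₂)}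
    (hy : y ∈ effDom h) : HasGradientAt (penalized f ρ x) (gradY f (dissolve x) y) y := by
  have h1 := hasGradientAt_iff_hasFDerivAt.1 (Q.differentiableAt_right hx hy).hasGradientAt
  exact hasGradientAt_iff_hasFDerivAt.2 (h1.add_const (ρ / 4 * ‖constr x‖ ^ 2))

lemma gradY_penalized (Q : IsProblem f h C Lxx Lxy Lyx Lyy) (ρ : ℝ) {x : MatSpace d₁ r}
    (hx : x ∈ Metric.closedBall (0 : MatSpace d₁ r) C) {y : EuclideanSpace ℝ (Fin d₂)}
    (hy : y ∈ effDom h) : gradY (penalized f ρ) x y = gradY f (dissolve x) y :=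
  (Q.hasGradientAt_right ρ hx hy).gradient

lemma isSaddleObjective (Q : IsProblem f h C Lxx Lxy Lyx Lyy) {ρ lxx lxy lyx l : ℝ}
    (hl : GradLipschitzOn (penalized f ρ) (Metric.closedBall 0 C) (effDom h) lxx lxy lyx Lyy)
    (hmax : l = max (max lxx lxy) (max lyx Lyy)) :
    IsSaddleObjective (penalized f ρ) (fun y => (h y).toReal) (Metric.closedBall 0 C) (effDom h)
      l Lyy := by
  have h1 : lxx ≤ l := by rw [hmax]; exact (le_max_left _ _).trans (le_max_left _ _)
  have h2 : lxy ≤ l := by rw [hmax]; exact (le_max_right _ _).trans (le_max_left _ _)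
  have h3 : lyx ≤ l := by rw [hmax]; exact (le_max_left _ _).trans (le_max_right _ _)
  refine ⟨convex_closedBall _ _, Q.reg.isCompact_effDom, Q.reg.proper, Q.reg.convexOn,
    Q.reg.continuousOn, fun x hx => ?_, fun x hx y hy => ?_, fun x hx y hy => ?_,
    hl.nonneg.1.trans h1, fun x₁ hx₁ x₂ hx₂ y₁ hy₁ y₂ hy₂ => ?_, fun x₁ hx₁ x₂ hx₂ y hy => ?_,
    fun x hx y₁ hy₁ y₂ hy₂ => ?_⟩
  · exact (Q.conc _ (Set.mem_image_of_mem _ hx)).add_const _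
  · rw [Q.gradX_penalized ρ hx hy]; exact Q.hasGradientAt_left ρ hx hy
  · rw [Q.gradY_penalized ρ hx hy]; exact Q.hasGradientAt_right ρ hx hy
  · refine (hl.lip_x x₁ hx₁ x₂ hx₂ y₁ hy₁ y₂ hy₂).trans ?_
    rw [mul_add]
    gcongr
  · have := hl.lip_y x₁ hx₁ x₂ hx₂ y hy y hy
    rw [sub_self, norm_zero, mul_zero, add_zero] at this
    exact this.trans (mul_le_mul_of_nonneg_right h3 (norm_nonneg _))
  · simpa using hl.lip_y x hx x hx y₁ hy₁ y₂ hy₂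

/-- The bounds involve neither `ρ` nor the Lipschitz constants of the penalty function, as the
uniform constants of the theorem require. Gradients are bounded by their value at one point plus the
Lipschitz estimate over the compact image. -/
lemma exists_dataBounds (Q : IsProblem f h C Lxx Lxy Lyx Lyy) :
    ∃ G₀ G₁ Mf Mh R, DataBounds f h C G₀ G₁ Mf Mh R := by
  obtain ⟨y₀, hy₀⟩ := Q.reg.proper
  have h0 : (0 : MatSpace d₁ r) ∈ Metric.closedBall (0 : MatSpace d₁ r) C :=
    Metric.mem_closedBall_self Q.C_pos.le
  obtain ⟨R, hR⟩ := Q.reg.isCompact_effDom.isBounded.exists_norm_le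
  obtain ⟨S, hS⟩ := Q.isCompact_image.isBounded.exists_norm_le
  obtain ⟨Mh, hMh⟩ := Q.reg.isCompact_effDom.exists_bound_of_continuousOn Q.reg.continuousOn
  obtain ⟨Mf, hMf⟩ := (Q.isCompact_image.prod Q.reg.isCompact_effDom).exists_bound_of_continuousOn
    (f := Function.uncurry f) (by
      rintro ⟨a, y⟩ ⟨⟨x, hx, rfl⟩, hy⟩
      exact (Q.differentiableAt hx hy).continuousAt.continuousWithinAt)
  have hA : ∀ x ∈ Metric.closedBall (0 : MatSpace d₁ r) C,
      ‖dissolve x - dissolve (0 : MatSpace d₁ r)‖ ≤ 2 * S := fun x hx => by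
    have h1 := hS _ (Set.mem_image_of_mem dissolve hx)
    have h2 := hS _ (Set.mem_image_of_mem dissolve h0)
    linarith [norm_sub_le (dissolve x) (dissolve (0 : MatSpace d₁ r))]
  have hY : ∀ y ∈ effDom h, ‖y - y₀‖ ≤ 2 * R := fun y hy => by
    linarith [norm_sub_le y y₀, hR y hy, hR y₀ hy₀]
  obtain ⟨n1, n2, n3, n4⟩ := Q.lip.nonneg
  refine ⟨|‖gradX f (dissolve 0) y₀‖ + (Lxx * (2 * S) + Lxy * (2 * R))|,
    ‖gradY f (dissolve 0) y₀‖ + (Lyx * (2 * S) + Lyy * (2 * R)), Mf, Mh, R,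
    ⟨abs_nonneg _, fun x hx y hy => ?_, fun x hx y hy => ?_, fun x hx y hy => ?_,
    fun y hy => hMh y hy, hR⟩⟩
  · refine le_trans ?_ (le_abs_self _)
    have h1 := Q.lip.lip_x _ (Set.mem_image_of_mem dissolve hx) _
      (Set.mem_image_of_mem dissolve h0) y hy y₀ hy₀
    have h2 := norm_sub_norm_le (gradX f (dissolve x) y) (gradX f (dissolve 0) y₀)
    have h3 := mul_le_mul_of_nonneg_left (hA x hx) n1
    have h4 := mul_le_mul_of_nonneg_left (hY y hy) n2
    linarith
  · have h1 := Q.lip.lip_y _ (Set.mem_image_of_mem dissolve hx) _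
      (Set.mem_image_of_mem dissolve h0) y hy y₀ hy₀
    have h2 := norm_sub_norm_le (gradY f (dissolve x) y) (gradY f (dissolve 0) y₀)
    have h3 := mul_le_mul_of_nonneg_left (hA x hx) n3
    have h4 := mul_le_mul_of_nonneg_left (hY y hy) n4
    linarith
  · exact hMf (dissolve x, y) ⟨Set.mem_image_of_mem _ hx, hy⟩

end IsProblem

lemma norm_constr_le (x : MatSpace d₁ r) : ‖constr x‖ ≤ ‖x‖ ^ 2 + √r := by
  have h1 := frob_sub_le ((toMat x)ᵀ * toMat x) (1 : Matrix (Fin r) (Fin r) ℝ)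
  have h2 := frob_mul_le (toMat x)ᵀ (toMat x)
  have h3 : frob (1 : Matrix (Fin r) (Fin r) ℝ) = √r := by
    rw [← Real.sqrt_sq (frob_nonneg _), frob_sq]; simp
  rw [frob_transpose, frob_toMat] at h2
  rw [h3] at h1
  rw [← frob_constr, toMat_constr, sq]
  linarith

/-- A bound for `‖∇A(x)[g]‖` when `‖x‖ ≤ C` and `‖g‖ ≤ G₀`. -/
def adjBound (C G₀ : ℝ) : ℝ := G₀ * (1 + (C ^ 2 + C) / 2 + C ^ 2)

/-- The constant governing the width of the tube around the Stiefel manifold. -/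
def tubeConst (C G₀ : ℝ) : ℝ := 1 + 3 * (C * G₀) + (2 * C + 1) * adjBound C G₀

lemma adjBound_nonneg {C G₀ : ℝ} (hC : 0 ≤ C) (hG : 0 ≤ G₀) : 0 ≤ adjBound C G₀ := by
  unfold adjBound; positivity

lemma norm_dissolveAdj_le_adjBound {C G₀ : ℝ} (hC : √r ≤ C) {x g : MatSpace d₁ r}
    (hx : ‖x‖ ≤ C) (hg : ‖g‖ ≤ G₀) : ‖dissolveAdj x g‖ ≤ adjBound C G₀ := by
  have h1 := norm_dissolveAdj_le x g
  have h2 := norm_constr_le x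
  have h3 : ‖x‖ ^ 2 ≤ C ^ 2 := pow_le_pow_left₀ (norm_nonneg _) hx 2
  refine h1.trans (mul_le_mul hg (by linarith) (by positivity) ((norm_nonneg _).trans hg))

/-- The Lipschitz constant of the gradient of the penalty function grows like `2 ρ`. -/
lemma IsProblem.penalty_le (Q : IsProblem f h C Lxx Lxy Lyx Lyy) {G₀ G₁ Mf Mh R : ℝ}
    (D : DataBounds f h C G₀ G₁ Mf Mh R) {ρ lxx lxy lyx : ℝ}
    (hρ : 8 * tubeConst C G₀ ≤ ρ)
    (hl : GradLipschitzOn (penalized f ρ) (Metric.closedBall 0 C) (effDom h) lxx lxy lyx Lyy)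
    {x₀ : MatSpace d₁ r} (hx₀ : x₀ ∈ stiefel d₁ r) : 4 / 3 * ρ ≤ lxx := by
  obtain ⟨y, hy⟩ := Q.reg.proper
  have hr1 : (1 : ℝ) ≤ r := by exact_mod_cast Q.r_pos
  have hC := Q.C_gt
  set σ := √(r : ℝ) with hσ
  have hσ1 : 1 ≤ σ := Real.one_le_sqrt.2 hr1
  have hσ2 : σ * σ = r := Real.mul_self_sqrt (by linarith)
  have hσ0 : 0 < σ := by linarith
  -- Rescaling `x₀` by `1 + s` moves it by exactly `1/2`, which stays in the ball because `C > √r +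
  -- 1/2`. The penalty gradient changes by at least `ρ` over this displacement, while the terms from
  -- `f` amount to at most `ρ/12`.
  set s := 1 / (2 * σ) with hs
  have hs0 : 0 < s := by positivity
  have hsσ : s * σ = 1 / 2 := by rw [hs]; field_simp
  have hB0 := adjBound_nonneg Q.C_pos.le D.G₀_nonneg
  have hn0 : ‖x₀‖ = σ := norm_of_mem_stiefel hx₀
  set x₁ := (1 + s) • x₀ with hx₁
  have hn1 : ‖x₁‖ = (1 + s) * σ := by
    rw [hx₁, norm_smul, hn0, Real.norm_eq_abs, abs_of_pos (by linarith)]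
  have m0 : x₀ ∈ Metric.closedBall (0 : MatSpace d₁ r) C := by
    rw [mem_closedBall_zero_iff, hn0]; linarith
  have m1 : x₁ ∈ Metric.closedBall (0 : MatSpace d₁ r) C := by
    rw [mem_closedBall_zero_iff, hn1]; linarith
  have hgram := (mem_stiefel_iff x₀).1 hx₀
  have hc0 : toMat (constr x₀) = 0 := by rw [toMat_constr, hgram, sub_self]
  have hc1 : toMat (constr x₁) = (2 * s + s ^ 2) • (1 : Matrix (Fin r) (Fin r) ℝ) := by
    rw [toMat_constr, hx₁, toMat_smul, transpose_smul, Matrix.smul_mul, Matrix.mul_smul, hgram]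
    module
  have hp0 : (ρ / 2) • constrAdj x₀ (constr x₀) = 0 := by
    rw [← ofMat_toMat ((ρ / 2) • constrAdj x₀ (constr x₀)), toMat_constrAdj, hc0]
    simp [ofMat_zero]
  have hp1 : (ρ / 2) • constrAdj x₁ (constr x₁) = (ρ * ((2 * s + s ^ 2) * (1 + s))) • x₀ := by
    rw [← ofMat_toMat ((ρ / 2) • constrAdj x₁ (constr x₁)), toMat_constrAdj, hc1, hx₁, toMat_smul,
      Matrix.mul_smul, Matrix.mul_one, smul_smul, smul_smul, ofMat_smul, ofMat_toMat]
    congr 1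
    ring
  have h1 := hl.lip_x x₁ m1 x₀ m0 y hy y hy
  rw [Q.gradX_penalized ρ m0 hy, Q.gradX_penalized ρ m1 hy, hp0, hp1, sub_self, norm_zero,
    mul_zero, add_zero, add_zero] at h1
  have hx10 : x₁ - x₀ = s • x₀ := by rw [hx₁]; module
  rw [hx10, norm_smul, Real.norm_eq_abs, abs_of_pos hs0, hn0, hsσ] at h1
  have a0 := norm_dissolveAdj_le_adjBound (by linarith) (mem_closedBall_zero_iff.1 m0)
    (D.gradX_le x₀ m0 y hy)
  have a1 := norm_dissolveAdj_le_adjBound (by linarith) (mem_closedBall_zero_iff.1 m1)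
    (D.gradX_le x₁ m1 y hy)
  set v₀ := dissolveAdj x₀ (gradX f (dissolve x₀) y)
  set v₁ := dissolveAdj x₁ (gradX f (dissolve x₁) y)
  set w := (ρ * ((2 * s + s ^ 2) * (1 + s))) • x₀ with hw
  have hT1 : 1 ≤ tubeConst C G₀ := by
    have h1 := mul_nonneg Q.C_pos.le D.G₀_nonneg
    have h2 : 0 ≤ (2 * C + 1) * adjBound C G₀ := mul_nonneg (by linarith [Q.C_pos]) hB0
    unfold tubeConst; linarith
  have hρ0 : 0 < ρ := by linarith
  have hwn : ρ ≤ ‖w‖ := by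
    rw [hw, norm_smul, hn0, Real.norm_eq_abs, abs_of_pos (by positivity)]
    have e1 : ρ * ((2 * s + s ^ 2) * (1 + s)) * σ = ρ * ((2 + s) * (1 + s)) * (s * σ) := by ring
    rw [e1, hsσ]
    have : 0 ≤ ρ * (3 * s + s ^ 2) := by positivity
    linarith
  have h2 : ‖w‖ ≤ ‖v₁ + w - v₀‖ + ‖v₁‖ + ‖v₀‖ := by
    have e : w = (v₁ + w - v₀) - v₁ + v₀ := by abel
    calc ‖w‖ = ‖(v₁ + w - v₀) - v₁ + v₀‖ := by rw [← e]
      _ ≤ _ := (norm_add_le _ _).trans (add_le_add (norm_sub_le _ _) le_rfl)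
  have h3 : 24 * adjBound C G₀ ≤ ρ := by
    have a2 := mul_nonneg Q.C_pos.le D.G₀_nonneg
    have a3 : 3 * adjBound C G₀ ≤ (2 * C + 1) * adjBound C G₀ :=
      mul_le_mul_of_nonneg_right (by linarith) hB0
    unfold tubeConst at hρ
    linarith
  linarith

end Problem

end SmMGDA

end

/-! ### Invariance of the tube and transfer of accuracy to the manifold. -/

noncomputable section

namespace SmMGDA

open Matrix Filter Topology

section Tube

variable {d₁ r d₂ : ℕ} {f : MatSpace d₁ r → EuclideanSpace ℝ (Fin d₂) → ℝ}
  {h : EuclideanSpace ℝ (Fin d₂) → EReal} {C Lxx Lxy Lyx Lyy : ℝ} {G₀ G₁ Mf Mh R : ℝ}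

lemma one_le_tubeConst (hC : 0 ≤ C) (hG : 0 ≤ G₀) : 1 ≤ tubeConst C G₀ := by
  have h1 := mul_nonneg hC hG
  have h2 : 0 ≤ (2 * C + 1) * adjBound C G₀ :=
    mul_nonneg (by linarith) (adjBound_nonneg hC hG)
  unfold tubeConst; linarith

/-- The tube around the Stiefel manifold in which the iterates stay. -/
def tube (d₁ r : ℕ) (C G₀ ρ : ℝ) : Set (MatSpace d₁ r) := {x | ‖constr x‖ ≤ tubeConst C G₀ / ρ}

lemma norm_constr_le_of_mem_tube (hC : 0 ≤ C) (hG : 0 ≤ G₀) {ρ : ℝ}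
    (hρ : 8 * tubeConst C G₀ ≤ ρ) {x : MatSpace d₁ r} (hx : x ∈ tube d₁ r C G₀ ρ) :
    ‖constr x‖ ≤ 1 / 8 := by
  have h1 := one_le_tubeConst hC hG
  have hx : ‖constr x‖ ≤ tubeConst C G₀ / ρ := hx
  refine hx.trans ?_
  rw [div_le_iff₀ (by linarith)]; linarith

lemma IsProblem.tube_subset (Q : IsProblem f h C Lxx Lxy Lyx Lyy) (hG : 0 ≤ G₀) {ρ : ℝ}
    (hρ : 8 * tubeConst C G₀ ≤ ρ) : tube d₁ r C G₀ ρ ⊆ Metric.closedBall 0 C := fun x hx => by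
  have h1 := norm_constr_le_of_mem_tube Q.C_pos.le hG hρ hx
  rw [mem_closedBall_zero_iff]
  have h2 : ‖x‖ ≤ √r + 1 / 2 := norm_le_of_norm_constr_le (by linarith)
  linarith [Q.C_gt]

lemma IsProblem.sub_smul_gradX_mem_tube (Q : IsProblem f h C Lxx Lxy Lyx Lyy)
    (D : DataBounds f h C G₀ G₁ Mf Mh R) {ρ τ : ℝ} (hρ : 8 * tubeConst C G₀ ≤ ρ) (hτ : 0 ≤ τ)
    (hk : τ * ρ ≤ 1 / 2) {x : MatSpace d₁ r} (hx : x ∈ tube d₁ r C G₀ ρ)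
    {y : EuclideanSpace ℝ (Fin d₂)} (hy : y ∈ effDom h) :
    x - τ • gradX (penalized f ρ) x y ∈ tube d₁ r C G₀ ρ := by
  have hxX := Q.tube_subset D.G₀_nonneg hρ hx
  have hC := Q.C_pos
  have hG := D.G₀_nonneg
  rw [Q.gradX_penalized ρ hxX hy]
  have hxn := mem_closedBall_zero_iff.1 hxX
  have hg := D.gradX_le x hxX y hy
  have hv := norm_dissolveAdj_le_adjBound (by linarith [Q.C_gt]) hxn hg
  have hB := adjBound_nonneg hC.le hG
  have h1 : ‖x‖ * ‖gradX f (dissolve x) y‖ ≤ C * G₀ := mul_le_mul hxn hg (norm_nonneg _) hC.le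
  have h2 : ‖x‖ * ‖dissolveAdj x (gradX f (dissolve x) y)‖ ≤ C * adjBound C G₀ :=
    mul_le_mul hxn hv (norm_nonneg _) hC.le
  have h3 := mul_nonneg hC.le hG
  have h4 := mul_nonneg hC.le hB
  refine norm_constr_gradient_step_le (by linarith [one_le_tubeConst hC.le hG]) hρ hτ hk hx
    ?_ ?_ ?_ <;> unfold tubeConst <;> linarith

lemma run_evals (f : MatSpace d₁ r → EuclideanSpace ℝ (Fin d₂) → ℝ)
    (h : EuclideanSpace ℝ (Fin d₂) → EReal) (P : Params) (x₀ : MatSpace d₁ r)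
    (y₀ : EuclideanSpace ℝ (Fin d₂)) (z₀ : MatSpace d₁ r) (t : ℕ) :
    (run f h P x₀ y₀ z₀ t).evals = 2 * t := by
  induction t with
  | zero => rfl
  | succ t ih =>
    change (run f h P x₀ y₀ z₀ t).evals + 2 = _
    rw [ih]; ring

/-- The recursion satisfied by the iterates, which stay in the tube. -/
lemma IsProblem.run_spec (Q : IsProblem f h C Lxx Lxy Lyx Lyy)
    (D : DataBounds f h C G₀ G₁ Mf Mh R) {ρ α b l : ℝ} (hρ : 8 * tubeConst C G₀ ≤ ρ)
    (hα : 0 < α) (hb : 35 ≤ b) (hbl : 2 / (α * l) - 1 < b) (hlρ : 4 / 3 * ρ ≤ l)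
    {x₀ : MatSpace d₁ r} (hx₀ : x₀ ∈ stiefel d₁ r) {y₀ : EuclideanSpace ℝ (Fin d₂)}
    (hy₀ : y₀ ∈ effDom h) {s : ℕ → State (MatSpace d₁ r) (EuclideanSpace ℝ (Fin d₂))}
    (hs : s = run f h (concaveParams ρ C α b l) x₀ y₀ x₀) :
    (∀ t, (s t).x ∈ tube d₁ r C G₀ ρ) ∧ (∀ t, (s t).y ∈ effDom h) ∧
      (∀ t, (s (t + 1)).x
        = (s t).x - stepX α b l t • gradX (penalized f ρ) (s t).x (s t).y) ∧
      ∀ t, α⁻¹ • ((s t).y + α • (gradY (penalized f ρ) (s (t + 1)).x (s t).y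
        - regParam α t • (s t).y) - (s (t + 1)).y) ∈ subdiff h (s (t + 1)).y := by
  have hB := one_le_tubeConst Q.C_pos.le D.G₀_nonneg
  have hρ0 : 0 < ρ := by linarith
  have hl : 0 < l := by linarith
  have hstepx : ∀ t, (s t).x ∈ tube d₁ r C G₀ ρ → (s t).y ∈ effDom h →
      (s (t + 1)).x = (s t).x - stepX α b l t • gradX (penalized f ρ) (s t).x (s t).y ∧
        (s (t + 1)).x ∈ tube d₁ r C G₀ ρ := by
    intro t hx hy
    have hη := stepBounds hα hl hb hbl t
    -- `l ≥ 4/3 ρ` turns the bound `η l ≤ 2/3` into the step condition for invariance of the tube.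
    have hk : stepX α b l t * ρ ≤ 1 / 2 := by
      have h1 := mul_le_mul_of_nonneg_left hlρ hη.η_pos.le
      linarith [hη.η_le]
    have hmem := Q.sub_smul_gradX_mem_tube D hρ hη.η_pos.le hk hx hy
    have e : (s (t + 1)).x
        = (s t).x - stepX α b l t • gradX (penalized f ρ) (s t).x (s t).y := by
      have e1 : (s (t + 1)).x = proj (Metric.closedBall 0 C) ((s t).x - stepX α b l t •
          ((dissolveAdj (s t).x (gradX f (dissolve (s t).x) (s t).y)
            + (ρ / 2) • constrAdj (s t).x (constr (s t).x))
            + (0 : ℝ) • ((s t).x - (s t).z))) := by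
        rw [hs]; rfl
      rw [zero_smul, add_zero,
        ← Q.gradX_penalized ρ (Q.tube_subset D.G₀_nonneg hρ hx) hy,
        proj_of_mem (Q.tube_subset D.G₀_nonneg hρ hmem)] at e1
      exact e1
    exact ⟨e, by rw [e]; exact hmem⟩
  have hstepy : ∀ t, (s (t + 1)).y = prox h α ((s t).y + α •
      (gradY f (dissolve (s (t + 1)).x) (s t).y - regParam α t • (s t).y)) := by
    intro t
    rw [hs]; rfl
  have hinv : ∀ t, (s t).x ∈ tube d₁ r C G₀ ρ ∧ (s t).y ∈ effDom h := by
    intro t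
    induction t with
    | zero =>
      rw [hs]
      refine ⟨?_, hy₀⟩
      have hx₀ : constr x₀ = 0 := hx₀
      change ‖constr x₀‖ ≤ _
      rw [hx₀, norm_zero]
      positivity
    | succ t ih =>
      refine ⟨(hstepx t ih.1 ih.2).2, ?_⟩
      rw [hstepy]
      exact (Q.reg.prox_spec hα _).1
  refine ⟨fun t => (hinv t).1, fun t => (hinv t).2, fun t => (hstepx t (hinv t).1 (hinv t).2).1,
    fun t => ?_⟩
  rw [Q.gradY_penalized ρ (Q.tube_subset D.G₀_nonneg hρ (hinv (t + 1)).1) (hinv t).2, hstepy]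
  exact (Q.reg.prox_spec hα _).2

lemma norm_dissolve_sub_le (x : MatSpace d₁ r) :
    ‖dissolve x - x‖ ≤ ‖x‖ * ‖constr x‖ / 2 := by
  have e : toMat (dissolve x - x) = -((1 / 2 : ℝ) • (toMat x * toMat (constr x))) := by
    rw [toMat_sub, toMat_dissolve]; abel
  rw [← frob_toMat, e, frob_neg, frob_smul, abs_of_pos (by norm_num)]
  have := frob_mul_le (toMat x) (toMat (constr x))
  rw [frob_toMat, frob_constr] at this
  linarith

/-- On the manifold `∇A` is the tangential projection, so the Riemannian gradient is the gradient of
`f ∘ A`. -/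
lemma riemGradX_eq (f : MatSpace d₁ r → EuclideanSpace ℝ (Fin d₂) → ℝ) {q : MatSpace d₁ r}
    (hq : q ∈ stiefel d₁ r) (y : EuclideanSpace ℝ (Fin d₂)) :
    riemGradX f q y = dissolveAdj q (gradX f q y) := by
  have hq : constr q = 0 := hq
  rw [← ofMat_toMat (dissolveAdj q _), toMat_dissolveAdj, hq]
  change _ = ofMat (toMat (gradX f q y) - (1 / 2 : ℝ) • (toMat (gradX f q y) * 0) - _)
  rw [Matrix.mul_zero, smul_zero, sub_zero]
  rfl

lemma symPart_sub (m n : Matrix (Fin r) (Fin r) ℝ) : symPart (m - n) = symPart m - symPart n := by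
  unfold symPart; rw [transpose_sub]; module

/-- The map `(x, g) ↦ ∇A(x)[g]` is Lipschitz near the Stiefel manifold. -/
lemma norm_dissolveAdj_sub_le {x q g g' : MatSpace d₁ r} (hC : 0 ≤ C) (hx : ‖x‖ ≤ C)
    (hqn : ‖q‖ ≤ C) (hq : q ∈ stiefel d₁ r) (hg : ‖g‖ ≤ G₀) :
    ‖dissolveAdj x g - dissolveAdj q g'‖ ≤ (1 + C ^ 2) * ‖g - g'‖
      + G₀ / 2 * ‖constr x‖ + 2 * (C * G₀) * ‖x - q‖ := by
  have hq0 : toMat (constr q) = 0 := by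
    have hq : constr q = 0 := hq
    rw [hq]; rfl
  have e : toMat (dissolveAdj x g - dissolveAdj q g')
      = toMat (g - g') - (1 / 2 : ℝ) • (toMat g * toMat (constr x))
        - (toMat (x - q) * symPart ((toMat x)ᵀ * toMat g)
          + toMat q * symPart ((toMat (x - q))ᵀ * toMat g)
          + toMat q * symPart ((toMat q)ᵀ * toMat (g - g'))) := by
    rw [toMat_sub, toMat_dissolveAdj, toMat_dissolveAdj, hq0]
    simp only [toMat_sub, transpose_sub, Matrix.sub_mul, Matrix.mul_sub, symPart_sub,
      Matrix.mul_zero, smul_zero]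
    abel
  have hG : 0 ≤ G₀ := (norm_nonneg _).trans hg
  rw [← frob_toMat, e]
  have t1 := frob_sub_le (toMat (g - g') - (1 / 2 : ℝ) • (toMat g * toMat (constr x)))
    (toMat (x - q) * symPart ((toMat x)ᵀ * toMat g)
      + toMat q * symPart ((toMat (x - q))ᵀ * toMat g)
      + toMat q * symPart ((toMat q)ᵀ * toMat (g - g')))
  have t2 := frob_sub_le (toMat (g - g')) ((1 / 2 : ℝ) • (toMat g * toMat (constr x)))
  have t3 := frob_add_le (toMat (x - q) * symPart ((toMat x)ᵀ * toMat g)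
      + toMat q * symPart ((toMat (x - q))ᵀ * toMat g))
      (toMat q * symPart ((toMat q)ᵀ * toMat (g - g')))
  have t4 := frob_add_le (toMat (x - q) * symPart ((toMat x)ᵀ * toMat g))
      (toMat q * symPart ((toMat (x - q))ᵀ * toMat g))
  have s (a b c : MatSpace d₁ r) : frob (toMat a * symPart ((toMat b)ᵀ * toMat c))
      ≤ ‖a‖ * (‖b‖ * ‖c‖) := by
    refine (frob_mul_le _ _).trans (mul_le_mul_of_nonneg_left ?_ (norm_nonneg a))
    refine (frob_symPart_le _).trans ((frob_mul_le _ _).trans ?_)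
    rw [frob_transpose]; rfl
  have s1 : frob (toMat (x - q) * symPart ((toMat x)ᵀ * toMat g)) ≤ ‖x - q‖ * (C * G₀) :=
    (s _ _ _).trans (mul_le_mul_of_nonneg_left (mul_le_mul hx hg (norm_nonneg _) hC)
      (norm_nonneg _))
  have s2 : frob (toMat q * symPart ((toMat (x - q))ᵀ * toMat g)) ≤ C * (‖x - q‖ * G₀) :=
    (s _ _ _).trans (mul_le_mul hqn (mul_le_mul_of_nonneg_left hg (norm_nonneg _))
      (by positivity) hC)
  have s3 : frob (toMat q * symPart ((toMat q)ᵀ * toMat (g - g'))) ≤ C * (C * ‖g - g'‖) :=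
    (s _ _ _).trans (mul_le_mul hqn (mul_le_mul_of_nonneg_right hqn (norm_nonneg _))
      (by positivity) hC)
  have s4 : frob ((1 / 2 : ℝ) • (toMat g * toMat (constr x))) ≤ 1 / 2 * (G₀ * ‖constr x‖) := by
    rw [frob_smul, abs_of_pos (by norm_num)]
    refine mul_le_mul_of_nonneg_left ?_ (by norm_num)
    exact (frob_mul_le _ _).trans (mul_le_mul_of_nonneg_right hg (norm_nonneg _))
  have s5 : frob (toMat (g - g')) = ‖g - g'‖ := rfl
  linarith

/-- The constant bounding the Riemannian gradient at the projection. -/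
def riemConst (C G₀ Lxx : ℝ) : ℝ :=
  1 + 3 * C + 3 * ((1 + C ^ 2) * (Lxx * (1 + C / 2)) + G₀ / 2 + 2 * (C * G₀))

/-- A point of the tube with a small gradient of the penalty function is close to a nearly
stationary point of the manifold. -/
lemma IsProblem.exists_projection (Q : IsProblem f h C Lxx Lxy Lyx Lyy)
    (D : DataBounds f h C G₀ G₁ Mf Mh R) {ρ ε : ℝ} (hρ : 8 * tubeConst C G₀ ≤ ρ)
    {x : MatSpace d₁ r} (hx : x ∈ tube d₁ r C G₀ ρ) {y : EuclideanSpace ℝ (Fin d₂)}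
    (hy : y ∈ effDom h) (hε : ‖gradX (penalized f ρ) x y‖ ≤ ε) :
    ∃ q, nearestPts (stiefel d₁ r) x = {q} ∧ ‖x - q‖ ≤ 3 / ρ * ε ∧
      ‖riemGradX f q y‖ ≤ riemConst C G₀ Lxx * ε ∧
      ‖gradY f (dissolve x) y - gradY f q y‖ ≤ 3 * (Lyx * (1 + C / 2)) * ε := by
  have hC := Q.C_pos
  have hG := D.G₀_nonneg
  have hB := one_le_tubeConst hC.le hG
  have hρ0 : 0 < ρ := by linarith
  have hε0 : 0 ≤ ε := (norm_nonneg _).trans hε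
  have hxX := Q.tube_subset hG hρ hx
  have hxn := mem_closedBall_zero_iff.1 hxX
  have hc8 := norm_constr_le_of_mem_tube hC.le hG hρ hx
  have hg := D.gradX_le x hxX y hy
  obtain ⟨q, hnear, hq, hxq⟩ := exists_unique_nearest_stiefel (x := x) (by linarith)
  have hqn : ‖q‖ ≤ C := by rw [norm_of_mem_stiefel hq]; linarith [Q.C_gt]
  have hqX : q ∈ Metric.closedBall (0 : MatSpace d₁ r) C := mem_closedBall_zero_iff.2 hqn
  rw [Q.gradX_penalized ρ hxX hy] at hε
  have hδ : ‖constr x‖ ≤ 3 / ρ * ε := by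
    refine (norm_constr_le_of_gradient hρ0 ?_ hg (by linarith)).trans
      (mul_le_mul_of_nonneg_left hε (by positivity))
    have h1 : (3 / 2 : ℝ) ≤ C := by
      have : (1 : ℝ) ≤ √r := Real.one_le_sqrt.2 (by exact_mod_cast Q.r_pos)
      linarith [Q.C_gt]
    have h2 : 3 / 2 * G₀ ≤ C * G₀ := mul_le_mul_of_nonneg_right h1 hG
    have h3 : 0 ≤ (2 * C + 1) * adjBound C G₀ :=
      mul_nonneg (by linarith) (adjBound_nonneg hC.le hG)
    unfold tubeConst at hρ
    linarith
  set δ := 3 / ρ * ε with hδdef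
  have hδ0 : 0 ≤ δ := by positivity
  have hδε : δ ≤ 3 * ε := by
    refine mul_le_mul_of_nonneg_right ?_ hε0
    rw [div_le_iff₀ hρ0]; linarith
  have hAq : dissolve q = q := dissolve_of_mem_stiefel hq
  have hqA : q ∈ dissolve '' Metric.closedBall (0 : MatSpace d₁ r) C := ⟨q, hqX, hAq⟩
  have hdist : ‖dissolve x - q‖ ≤ (1 + C / 2) * δ := by
    have e : dissolve x - q = (dissolve x - x) + (x - q) := by abel
    rw [e]
    have h1 := norm_dissolve_sub_le x
    have h2 : ‖x‖ * ‖constr x‖ ≤ C * δ := mul_le_mul hxn hδ (norm_nonneg _) hC.le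
    have h3 := norm_add_le (dissolve x - x) (x - q)
    linarith
  obtain ⟨n1, n2, n3, n4⟩ := Q.lip.nonneg
  have hgx : ‖gradX f (dissolve x) y - gradX f q y‖ ≤ Lxx * ((1 + C / 2) * δ) := by
    have h1 := Q.lip.lip_x _ (Set.mem_image_of_mem dissolve hxX) q hqA y hy y hy
    rw [sub_self, norm_zero, mul_zero, add_zero] at h1
    exact h1.trans (mul_le_mul_of_nonneg_left hdist n1)
  have hgy : ‖gradY f (dissolve x) y - gradY f q y‖ ≤ Lyx * ((1 + C / 2) * δ) := by
    have h1 := Q.lip.lip_y _ (Set.mem_image_of_mem dissolve hxX) q hqA y hy y hy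
    rw [sub_self, norm_zero, mul_zero, add_zero] at h1
    exact h1.trans (mul_le_mul_of_nonneg_left hdist n3)
  refine ⟨q, hnear, hxq.trans hδ, ?_, ?_⟩
  · rw [riemGradX_eq f hq]
    set v := dissolveAdj x (gradX f (dissolve x) y) with hv
    set v' := dissolveAdj q (gradX f q y) with hv'
    have h1 := norm_dissolveAdj_sub_le (g' := gradX f q y) hC.le hxn hqn hq hg
    rw [← hv, ← hv'] at h1
    -- The factor `ρ` in the penalty gradient is cancelled by the `1/ρ` in the infeasibility bound,
    -- which keeps the final constant independent of `ρ`.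
    have hp : ‖(ρ / 2) • constrAdj x (constr x)‖ ≤ 3 * C * ε := by
      rw [← frob_toMat, toMat_constrAdj, frob_smul, abs_of_pos hρ0]
      have h2 := frob_mul_le (toMat x) (toMat (constr x))
      rw [frob_toMat, frob_constr] at h2
      have h3 : ‖x‖ * ‖constr x‖ ≤ C * δ := mul_le_mul hxn hδ (norm_nonneg _) hC.le
      have h4 := mul_le_mul_of_nonneg_left (h2.trans h3) hρ0.le
      have h5 : ρ * (C * δ) = 3 * C * ε := by rw [hδdef]; field_simp
      linarith
    have e : v' = (v + (ρ / 2) • constrAdj x (constr x)) - (ρ / 2) • constrAdj x (constr x)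
        - (v - v') := by abel
    have h6 : ‖v'‖ ≤ ε + 3 * C * ε + ‖v - v'‖ := by
      rw [e]
      refine (norm_sub_le _ _).trans (add_le_add ((norm_sub_le _ _).trans (add_le_add hε hp)) ?_)
      rw [← e]
    have h7 := mul_le_mul_of_nonneg_left hgx (by positivity : 0 ≤ 1 + C ^ 2)
    have h8 := mul_le_mul_of_nonneg_left hδ (by positivity : 0 ≤ G₀ / 2)
    have h9 := mul_le_mul_of_nonneg_left (hxq.trans hδ) (by positivity : 0 ≤ 2 * (C * G₀))
    have h10 := mul_le_mul_of_nonneg_left hδε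
      (by positivity : 0 ≤ (1 + C ^ 2) * (Lxx * (1 + C / 2)) + G₀ / 2 + 2 * (C * G₀))
    unfold riemConst
    linarith
  · have h1 := mul_le_mul_of_nonneg_left hδε (by positivity : 0 ≤ Lyx * (1 + C / 2))
    linarith

end Tube

end SmMGDA

end

/-! ### Bounds on the values, stationarity of limits and the constants. -/

noncomputable section

namespace SmMGDA

open Matrix Filter Topology

section Convergence

variable {d₁ r d₂ : ℕ} {f : MatSpace d₁ r → EuclideanSpace ℝ (Fin d₂) → ℝ}
  {h : EuclideanSpace ℝ (Fin d₂) → EReal} {C Lxx Lxy Lyx Lyy : ℝ} {G₀ G₁ Mf Mh R : ℝ}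

lemma regParam_le {α : ℝ} (hα : 0 < α) (t : ℕ) : regParam α t ≤ 1 / α * (1 / root t) := by
  have := root_pos t
  have h1 : 0 ≤ 1 / α * (1 / root t) := by positivity
  rw [regParam_eq, mul_assoc]
  linarith

lemma regParam_le_inv {α : ℝ} (hα : 0 < α) (t : ℕ) : regParam α t ≤ 1 / α := by
  refine (regParam_le hα t).trans (mul_le_of_le_one_right (by positivity) ?_)
  rw [div_le_one (root_pos t)]
  exact one_le_root t

/-- The subgradient produced by a proximal gradient step is close to the new gradient. -/
lemma norm_prox_subgradient_sub_le {V : Type*} [NormedAddCommGroup V] [InnerProductSpace ℝ V]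
    {α θ L R : ℝ} (hα : 0 < α) (hθ : 0 ≤ θ) {y y' g g' : V} (hg : ‖g - g'‖ ≤ L * ‖y - y'‖)
    (hy : ‖y‖ ≤ R) :
    ‖α⁻¹ • (y + α • (g - θ • y) - y') - g'‖ ≤ (α⁻¹ + L) * ‖y - y'‖ + θ * R := by
  have e : α⁻¹ • (y + α • (g - θ • y) - y') - g' = α⁻¹ • (y - y') + (g - g') - θ • y := by
    rw [add_sub_right_comm, smul_add, smul_smul, inv_mul_cancel₀ hα.ne', one_smul]
    abel
  rw [e]
  refine (norm_sub_le _ _).trans ?_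
  have h1 := norm_add_le (α⁻¹ • (y - y')) (g - g')
  rw [norm_smul, Real.norm_eq_abs, abs_of_pos (inv_pos.2 hα)] at h1
  rw [norm_smul, Real.norm_eq_abs, abs_of_nonneg hθ]
  have h2 := mul_le_mul_of_nonneg_left hy hθ
  linarith

lemma infEDist_dualResidual_le {x : MatSpace d₁ r} {y g : EuclideanSpace ℝ (Fin d₂)} {κ : ℝ}
    (hg : g ∈ subdiff h y) (hκ : ‖g - gradY f x y‖ ≤ κ) :
    Metric.infEDist 0 (dualResidual f h x y) ≤ ENNReal.ofReal κ := by
  refine (Metric.infEDist_le_edist_of_mem (Set.mem_image_of_mem _ hg)).trans ?_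
  rw [edist_dist, dist_zero_left, neg_add_eq_sub]
  exact ENNReal.ofReal_le_ofReal hκ

/-- The scalar descent system of the algorithm, with bounds for the regularized values. -/
lemma IsProblem.exists_descentSystem (Q : IsProblem f h C Lxx Lxy Lyx Lyy)
    (D : DataBounds f h C G₀ G₁ Mf Mh R) {ρ α b l lxx lxy lyx : ℝ}
    (hρ : 8 * tubeConst C G₀ ≤ ρ) (hα : 0 < α) (hαL : α * (10 * Lyy) ≤ 1) (hb : 35 ≤ b)
    (hbl : 2 / (α * l) - 1 < b) (hl0 : 0 < l)
    (hl : GradLipschitzOn (penalized f ρ) (Metric.closedBall 0 C) (effDom h) lxx lxy lyx Lyy)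
    (hmax : l = max (max lxx lxy) (max lyx Lyy))
    {x : ℕ → MatSpace d₁ r} {y : ℕ → EuclideanSpace ℝ (Fin d₂)}
    (hx : ∀ t, x t ∈ tube d₁ r C G₀ ρ) (hy : ∀ t, y t ∈ effDom h)
    (hstep : ∀ t, x (t + 1) = x t - stepX α b l t • gradX (penalized f ρ) (x t) (y t))
    (hprox : ∀ t, α⁻¹ • (y t + α • (gradY (penalized f ρ) (x (t + 1)) (y t)
        - regParam α t • y t) - y (t + 1)) ∈ subdiff h (y (t + 1))) :
    ∃ (z : ℕ → EuclideanSpace ℝ (Fin d₂)) (P Δ γ : ℕ → ℝ),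
      DescentSystem α b l R P (fun t => ‖gradX (penalized f ρ) (x t) (y t)‖)
        (fun t => ‖y t - z t‖) (fun t => ‖y (t + 1) - z t‖) Δ γ ∧
      (∀ t, -(Mf + Mh + 1 / α * R ^ 2) ≤ P t) ∧ P 0 ≤ Mf + Mh + tubeConst C G₀ ∧
      ‖y (0 + 1) - z 0‖ ≤ 2 * R := by
  have hB := one_le_tubeConst Q.C_pos.le D.G₀_nonneg
  have hρ0 : 0 < ρ := by linarith
  have hX := fun t => Q.tube_subset D.G₀_nonneg hρ (hx t)
  obtain ⟨z, hz, S⟩ := (Q.isSaddleObjective hl hmax).exists_descentSystem hα hl0 hb hbl hαL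
    D.norm_le hX hy hstep (fun t => (Q.reg.mem_subdiff_iff (hy (t + 1))).1 (hprox t))
  refine ⟨z, _, _, _, S, fun t => ?_, ?_, ?_⟩
  · have h1 := abs_le.1 (D.f_le _ (hX (t + 1)) _ (hz t).1)
    have h2 := abs_le.1 (D.h_le _ (hz t).1)
    have h3 : regParam α t * ‖z t‖ ^ 2 ≤ 1 / α * R ^ 2 :=
      mul_le_mul (regParam_le_inv hα t) (pow_le_pow_left₀ (norm_nonneg _) (D.norm_le _ (hz t).1) 2)
        (sq_nonneg _) (by positivity)
    have h4 : 0 ≤ ρ / 4 * ‖constr (x (t + 1))‖ ^ 2 := by positivity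
    have h5 : 0 ≤ 1 / α * R ^ 2 := by positivity
    unfold regObjective penalized
    linarith
  · have h1 := abs_le.1 (D.f_le _ (hX (0 + 1)) _ (hz 0).1)
    have h2 := abs_le.1 (D.h_le _ (hz 0).1)
    have h3 := mul_nonneg (regParam_pos hα 0).le (sq_nonneg ‖z 0‖)
    -- The penalty term `ρ/4 ‖c‖²` is bounded uniformly in `ρ`, since in the tube `ρ ‖c‖ ≤ B` and
    -- `‖c‖ ≤ 1/8`. The budget, and with it `K`, is therefore independent of `ρ`.
    have h4 : ρ * ‖constr (x (0 + 1))‖ ≤ tubeConst C G₀ := by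
      have : ‖constr (x (0 + 1))‖ ≤ tubeConst C G₀ / ρ := hx (0 + 1)
      rw [le_div_iff₀ hρ0] at this
      linarith
    have h5 := norm_constr_le_of_mem_tube Q.C_pos.le D.G₀_nonneg hρ (hx (0 + 1))
    have h6 := mul_le_mul h4 h5 (norm_nonneg _) (by linarith)
    unfold regObjective penalized
    linarith
  · linarith [norm_sub_le (y (0 + 1)) (z 0), D.norm_le _ (hy (0 + 1)), D.norm_le _ (hz 0).1]

/-- Limits of iterates with vanishing residuals are stationary. -/
lemma IsProblem.stationary_of_tendsto (Q : IsProblem f h C Lxx Lxy Lyx Lyy)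
    (D : DataBounds f h C G₀ G₁ Mf Mh R) {ρ lxx lxy lyx lyy : ℝ} (hρ : 8 * tubeConst C G₀ ≤ ρ)
    (hl : GradLipschitzOn (penalized f ρ) (Metric.closedBall 0 C) (effDom h) lxx lxy lyx lyy)
    {x : ℕ → MatSpace d₁ r} {y g : ℕ → EuclideanSpace ℝ (Fin d₂)} {xs : MatSpace d₁ r}
    {ys : EuclideanSpace ℝ (Fin d₂)}
    (hx : ∀ n, x n ∈ tube d₁ r C G₀ ρ) (hy : ∀ n, y n ∈ effDom h)
    (hxs : Tendsto x atTop (𝓝 xs)) (hys : Tendsto y atTop (𝓝 ys))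
    (hG : Tendsto (fun n => ‖gradX (penalized f ρ) (x n) (y n)‖) atTop (𝓝 0))
    (hg : ∀ n, g n ∈ subdiff h (y n))
    (hgt : Tendsto (fun n => ‖g n - gradY (penalized f ρ) (x n) (y n)‖) atTop (𝓝 0)) :
    xs ∈ stiefel d₁ r ∧ riemGradX f xs ys = 0 ∧ 0 ∈ dualResidual f h xs ys := by
  have hxsT : xs ∈ tube d₁ r C G₀ ρ :=
    le_of_tendsto' ((differentiable_constr.continuous.tendsto xs).norm.comp hxs) hx
  have hysY : ys ∈ effDom h := Q.reg.closed_dom.mem_of_tendsto hys (Eventually.of_forall hy)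
  have hX := fun n => Q.tube_subset D.G₀_nonneg hρ (hx n)
  have hxsX := Q.tube_subset D.G₀_nonneg hρ hxsT
  have dx : Tendsto (fun n => ‖xs - x n‖) atTop (𝓝 0) := by
    simpa using (hxs.const_sub xs).norm
  have dy : Tendsto (fun n => ‖ys - y n‖) atTop (𝓝 0) := by
    simpa using (hys.const_sub ys).norm
  have hgrad : ‖gradX (penalized f ρ) xs ys‖ ≤ 0 := by
    have hlim : Tendsto (fun n => ‖gradX (penalized f ρ) (x n) (y n)‖
        + (lxx * ‖xs - x n‖ + lxy * ‖ys - y n‖)) atTop (𝓝 0) := by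
      simpa using hG.add ((dx.const_mul lxx).add (dy.const_mul lxy))
    refine ge_of_tendsto' hlim fun n => ?_
    have h1 := hl.lip_x xs hxsX (x n) (hX n) ys hysY (y n) (hy n)
    have h2 := norm_sub_norm_le (gradX (penalized f ρ) xs ys) (gradX (penalized f ρ) (x n) (y n))
    linarith
  -- At zero tolerance the accuracy estimate says that the limit coincides with its projection and
  -- that its Riemannian gradient vanishes.
  obtain ⟨q, hnear, hxq, hriem, -⟩ := Q.exists_projection D hρ hxsT hysY hgrad
  have hq : q ∈ nearestPts (stiefel d₁ r) xs := by rw [hnear]; rfl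
  rw [mul_zero] at hxq hriem
  obtain rfl : xs = q := sub_eq_zero.1 (norm_le_zero_iff.1 hxq)
  refine ⟨hq.1, norm_le_zero_iff.1 hriem, ?_⟩
  set g' := gradY (penalized f ρ) xs ys with hg'
  have hg'f : g' = gradY f xs ys := by
    rw [hg', Q.gradY_penalized ρ hxsX hysY, dissolve_of_mem_stiefel hq.1]
  have hlim : Tendsto g atTop (𝓝 g') := by
    rw [tendsto_iff_norm_sub_tendsto_zero]
    have hlim : Tendsto (fun n => ‖g n - gradY (penalized f ρ) (x n) (y n)‖
        + (lyx * ‖xs - x n‖ + lyy * ‖ys - y n‖)) atTop (𝓝 0) := by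
      simpa using hgt.add ((dx.const_mul lyx).add (dy.const_mul lyy))
    refine squeeze_zero (fun n => norm_nonneg _) (fun n => ?_) hlim
    have h1 := hl.lip_y xs hxsX (x n) (hX n) ys hysY (y n) (hy n)
    rw [norm_sub_rev] at h1
    have h2 := norm_add_le (g n - gradY (penalized f ρ) (x n) (y n))
      (gradY (penalized f ρ) (x n) (y n) - g')
    rw [sub_add_sub_cancel] at h2
    linarith
  refine ⟨g', (Q.reg.mem_subdiff_iff hysY).2 fun w hw => ?_, ?_⟩
  · have h1 : Tendsto (fun n => (h (y n)).toReal) atTop (𝓝 (h ys).toReal) :=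
      (Q.reg.continuousOn ys hysY).tendsto.comp
        (tendsto_nhdsWithin_iff.2 ⟨hys, Eventually.of_forall hy⟩)
    exact le_of_tendsto' (h1.add (hlim.inner (hys.const_sub w)))
      fun n => (Q.reg.mem_subdiff_iff (hy n)).1 (hg n) w hw
  · change -gradY f xs ys + g' = 0
    rw [hg'f, neg_add_cancel]

lemma exists_nat_sqrt_bounds {M l ε : ℝ}
    (h : 1 ≤ M ^ 2 * l ^ 4 / ε ^ 4) :
    ∃ N : ℕ, 1 ≤ N ∧ M * l ^ 2 / ε ^ 2 ≤ √N ∧ (N : ℝ) ≤ 2 * (M ^ 2 * l ^ 4 / ε ^ 4) := by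
  refine ⟨⌈M ^ 2 * l ^ 4 / ε ^ 4⌉₊, Nat.one_le_ceil_iff.2 (by linarith), ?_, ?_⟩
  · refine Real.le_sqrt_of_sq_le (le_trans (le_of_eq ?_) (Nat.le_ceil _))
    rw [div_pow, mul_pow]
    ring
  · linarith [Nat.ceil_lt_add_one (by linarith : 0 ≤ M ^ 2 * l ^ 4 / ε ^ 4)]

/-- The constant governing the decay of the squared residuals. -/
def decayConst (α b C G₀ Mf Mh R : ℝ) : ℝ :=
  64 * (α * b) * (DescentSystem.budget α b R (-(Mf + Mh + 1 / α * R ^ 2))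
    (Mf + Mh + tubeConst C G₀) + 1)

/-- The complexity constant is a multiple of the square of this one. -/
def complexityConst (α b C G₀ Mf Mh R Lyy : ℝ) : ℝ :=
  decayConst α b C G₀ Mf Mh R * (1 + 16 * (α⁻¹ + Lyy) ^ 2) + 4 * R ^ 2 / α ^ 2 + 1

end Convergence

end SmMGDA

end

/-! ### Iteration count and accuracy of the iterates. -/

noncomputable section

namespace SmMGDA

open Matrix Filter Topology

section Complexity

variable {d₁ r d₂ : ℕ} {f : MatSpace d₁ r → EuclideanSpace ℝ (Fin d₂) → ℝ}
  {h : EuclideanSpace ℝ (Fin d₂) → EReal} {C Lxx Lxy Lyx Lyy : ℝ} {G₀ G₁ Mf Mh R : ℝ}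

/-- The common conversion of `√N ≥ M l²/ε²` into a residual bound; the weight `k` is admissible as
soon as `M` dominates `k² K`. The summands of `complexityConst` are chosen for the three uses of
this bound. -/
lemma le_of_sq_le_div_sqrt {N : ℕ} {M K k l ε u : ℝ} (hM : 0 < M) (hl : 1 ≤ l) (hε : 0 < ε)
    (hK : 0 ≤ K) (hN : M * l ^ 2 / ε ^ 2 ≤ √N) (hk : k ^ 2 * K ≤ M)
    (hu : u ^ 2 ≤ K * l ^ 2 / √N) : k * u ≤ ε := by
  have hl0 : 0 < l := by linarith
  have hs : 0 < M * l ^ 2 / ε ^ 2 := by positivity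
  refine le_of_sq_le_sq ?_ hε.le
  have h1 : u ^ 2 ≤ K * l ^ 2 / (M * l ^ 2 / ε ^ 2) :=
    hu.trans (div_le_div_of_nonneg_left (by positivity) hs hN)
  have h2 : K * l ^ 2 / (M * l ^ 2 / ε ^ 2) = K / M * ε ^ 2 := by field_simp
  rw [h2] at h1
  calc (k * u) ^ 2 = k ^ 2 * u ^ 2 := by ring
    _ ≤ k ^ 2 * (K / M * ε ^ 2) := mul_le_mul_of_nonneg_left h1 (sq_nonneg k)
    _ = k ^ 2 * K / M * ε ^ 2 := by ring
    _ ≤ 1 * ε ^ 2 := mul_le_mul_of_nonneg_right ((div_le_one hM).2 hk) (sq_nonneg ε)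
    _ = ε ^ 2 := one_mul _

/-- A descent system reaches small residuals within `O(l⁴ ε⁻⁴)` iterations. -/
lemma DescentSystem.exists_residuals_le {α b l P' P'' L : ℝ} {P G e d Δ γ : ℕ → ℝ}
    (S : DescentSystem α b l R P G e d Δ γ) (hα : 0 < α) (hl : 1 ≤ l) (hb : 35 ≤ b)
    (hbl : 2 / (α * l) - 1 < b) (hP' : ∀ t, P' ≤ P t) (hP'' : P 0 ≤ P'') (hd : d 0 ≤ 2 * R)
    (hL : 0 ≤ L) {K M ε : ℝ} (hK : K = 64 * (α * b) * (DescentSystem.budget α b R P' P'' + 1))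
    (hM : M = K * (1 + 16 * (α⁻¹ + L) ^ 2) + 4 * R ^ 2 / α ^ 2 + 1) (hε : 0 < ε)
    (hε1 : 1 ≤ M ^ 2 * l ^ 4 / ε ^ 4) :
    ∃ t : ℕ, 2 * ((t : ℝ) + 1) ≤ 8 * M ^ 2 * (l ^ 4 / ε ^ 4) ∧ G (t + 1) ≤ ε ∧
      (α⁻¹ + L) * (e t + d t) + regParam α t * R ≤ ε := by
  have hl0 : 0 < l := by linarith
  have hK0 : 0 ≤ K := by
    have h1 := S.sum_decrease_le hα hl0 hb hbl hP' hP'' hd 0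
    rw [Finset.sum_range_zero] at h1
    rw [hK]; positivity
  have hR := S.R_nonneg
  have t1 : 0 ≤ K * (16 * (α⁻¹ + L) ^ 2) := by positivity
  have t2 : 0 ≤ 4 * R ^ 2 / α ^ 2 := by positivity
  have hM1 : 1 ≤ M := by rw [hM]; linarith
  have hM0 : 0 < M := by linarith
  obtain ⟨N, hN1, hN2, hN3⟩ := exists_nat_sqrt_bounds hε1
  obtain ⟨t, ht1, ht2, hG, he⟩ := S.exists_small hα hl0 hb hbl hP' hP'' hd hN1
  rw [← hK] at hG he
  refine ⟨t, ?_, ?_, ?_⟩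
  · have h1 : (t : ℝ) + 1 ≤ 2 * N := by exact_mod_cast ht2
    have e1 : 8 * M ^ 2 * (l ^ 4 / ε ^ 4) = 4 * (2 * (M ^ 2 * l ^ 4 / ε ^ 4)) := by ring
    rw [e1]; linarith
  · have := le_of_sq_le_div_sqrt (k := 1) hM0 hl hε hK0 hN2 (by rw [hM]; linarith) hG
    linarith
  · have he' : e t ^ 2 ≤ K * l ^ 2 / √N := by
      refine he.trans (div_le_div_of_nonneg_right ?_ (Real.sqrt_nonneg _))
      exact le_mul_of_one_le_right hK0 (one_le_pow₀ hl)
    have h1 := le_of_sq_le_div_sqrt (k := 4 * (α⁻¹ + L)) hM0 hl hε hK0 hN2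
      (by rw [hM, mul_pow]; linarith) he'
    -- The contraction `d ≤ e` is available only from index one on, and `t ≥ N ≥ 1`.
    obtain ⟨k, rfl⟩ : ∃ k, t = k + 1 := ⟨t - 1, by omega⟩
    have h2 := S.d_le_e hα k
    have hN0 : 0 < √(N : ℝ) := Real.sqrt_pos.2 (by exact_mod_cast hN1)
    have hθ : regParam α (k + 1) ^ 2 ≤ (1 / α) ^ 2 / √N := by
      have h3 := pow_le_pow_left₀ (regParam_pos hα (k + 1)).le (regParam_le hα (k + 1)) 2
      refine h3.trans ?_
      rw [mul_pow, one_div_pow (root _), root_sq, mul_one_div]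
      refine div_le_div_of_nonneg_left (sq_nonneg _) hN0 (Real.sqrt_le_sqrt ?_)
      have : (N : ℝ) ≤ ((k + 1 : ℕ) : ℝ) := by exact_mod_cast ht1
      linarith
    have hθ' : regParam α (k + 1) ^ 2 ≤ (1 / α) ^ 2 * l ^ 2 / √N := by
      refine hθ.trans (div_le_div_of_nonneg_right ?_ hN0.le)
      exact le_mul_of_one_le_right (sq_nonneg _) (one_le_pow₀ hl)
    -- The regularization bias `θ R` takes half of the tolerance: `θ` decays like `t^(-1/4)`, which
    -- is exactly the rate `ε` at `t` of order `ε⁻⁴`. The other half goes to the `y` residual.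
    have h4 := le_of_sq_le_div_sqrt (k := 2 * R) hM0 hl hε (sq_nonneg _) hN2 (by
      have e1 : (2 * R) ^ 2 * (1 / α) ^ 2 = 4 * R ^ 2 / α ^ 2 := by ring
      rw [e1, hM]; linarith) hθ'
    have h5 : (α⁻¹ + L) * (e (k + 1) + d (k + 1)) ≤ (α⁻¹ + L) * (2 * e (k + 1)) :=
      mul_le_mul_of_nonneg_left (by linarith) (by positivity)
    linarith

/-- The constant of the stationarity measures. -/
def accuracyConst (C G₀ G₁ Lxx Lyx Λ : ℝ) : ℝ :=
  1 + |riemConst C G₀ Lxx| + 3 * (Lyx * (1 + C / 2)) + adjBound C G₀ + |G₁| + Λ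

/-- The starting point is already accurate enough when the tolerance is at least one. -/
lemma IsProblem.initial_accuracy (Q : IsProblem f h C Lxx Lxy Lyx Lyy)
    (D : DataBounds f h C G₀ G₁ Mf Mh R) {Λ : ℝ} (hΛ : ∀ y ∈ effDom h, ∃ g ∈ subdiff h y, ‖g‖ ≤ Λ)
    {x : MatSpace d₁ r} (hx : x ∈ stiefel d₁ r) {y : EuclideanSpace ℝ (Fin d₂)}
    (hy : y ∈ effDom h) :
    nearestPts (stiefel d₁ r) x = {x} ∧ ‖riemGradX f x y‖ ≤ adjBound C G₀ ∧
      Metric.infEDist 0 (dualResidual f h x y) ≤ ENNReal.ofReal (|G₁| + Λ) := by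
  have hxn : ‖x‖ ≤ C := by rw [norm_of_mem_stiefel hx]; linarith [Q.C_gt]
  have hxX : x ∈ Metric.closedBall (0 : MatSpace d₁ r) C := mem_closedBall_zero_iff.2 hxn
  have hA := dissolve_of_mem_stiefel hx
  refine ⟨?_, ?_, ?_⟩
  · have hc : ‖constr x‖ = 0 := norm_eq_zero.2 hx
    obtain ⟨q, hq, -, hxq⟩ := exists_unique_nearest_stiefel (x := x) (by rw [hc]; norm_num)
    rw [hc] at hxq
    rwa [sub_eq_zero.1 (norm_le_zero_iff.1 hxq)] at hq ⊢
  · rw [riemGradX_eq f hx]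
    have hg := D.gradX_le x hxX y hy
    rw [hA] at hg
    exact norm_dissolveAdj_le_adjBound (by linarith [Q.C_gt]) hxn hg
  · obtain ⟨g, hg, hgn⟩ := hΛ y hy
    have h1 := D.gradY_le x hxX y hy
    rw [hA] at h1
    refine infEDist_dualResidual_le hg ((norm_sub_le _ _).trans ?_)
    linarith [le_abs_self G₁]

/-- Accuracy of an iterate in terms of the residuals of the iteration. -/
lemma IsProblem.iterate_accuracy (Q : IsProblem f h C Lxx Lxy Lyx Lyy)
    (D : DataBounds f h C G₀ G₁ Mf Mh R) {ρ α θ ε : ℝ} (hρ : 8 * tubeConst C G₀ ≤ ρ) (hα : 0 < α)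
    (hθ : 0 ≤ θ) {x : MatSpace d₁ r} (hx : x ∈ tube d₁ r C G₀ ρ)
    {y y' : EuclideanSpace ℝ (Fin d₂)} (hy : y ∈ effDom h) (hy' : y' ∈ effDom h)
    (hprox : α⁻¹ • (y + α • (gradY (penalized f ρ) x y - θ • y) - y') ∈ subdiff h y')
    (hG : ‖gradX (penalized f ρ) x y'‖ ≤ ε) (hres : (α⁻¹ + Lyy) * ‖y - y'‖ + θ * R ≤ ε) :
    ∃ q, nearestPts (stiefel d₁ r) x = {q} ∧ ‖x - q‖ ≤ 3 / ρ * ε ∧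
      ‖riemGradX f q y'‖ ≤ riemConst C G₀ Lxx * ε ∧
      Metric.infEDist 0 (dualResidual f h q y')
        ≤ ENNReal.ofReal ((1 + 3 * (Lyx * (1 + C / 2))) * ε) := by
  obtain ⟨q, hq, hxq, hriem, hgrad⟩ := Q.exists_projection D hρ hx hy' hG
  refine ⟨q, hq, hxq, hriem, infEDist_dualResidual_le hprox ?_⟩
  have hxX := Q.tube_subset D.G₀_nonneg hρ hx
  have hmem := Set.mem_image_of_mem dissolve hxX
  rw [Q.gradY_penalized ρ hxX hy]
  have h1 := Q.lip.lip_y _ hmem _ hmem y hy y' hy'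
  rw [sub_self, norm_zero, mul_zero, zero_add] at h1
  have h2 := norm_prox_subgradient_sub_le hα hθ h1 (D.norm_le y hy)
  have h3 := norm_add_le (α⁻¹ • (y + α • (gradY f (dissolve x) y - θ • y) - y')
    - gradY f (dissolve x) y') (gradY f (dissolve x) y' - gradY f q y')
  rw [sub_add_sub_cancel] at h3
  linarith

lemma tendsto_regParam {α : ℝ} (hα : 0 < α) : Tendsto (regParam α) atTop (𝓝 0) := by
  have h1 : Tendsto (fun t : ℕ => 1 / √((t : ℝ) + 1)) atTop (𝓝 0) := by
    have h2 : Tendsto (fun t : ℕ => √((t : ℝ) + 1)) atTop atTop :=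
      Real.tendsto_sqrt_atTop.comp (tendsto_natCast_atTop_atTop.atTop_add tendsto_const_nhds)
    simp only [one_div]
    exact h2.inv_tendsto_atTop
  have h3 := (Real.continuous_sqrt.tendsto 0).comp h1
  rw [Real.sqrt_zero] at h3
  have h4 : Tendsto (fun t => 1 / root t) atTop (𝓝 0) := h3.congr fun t => by
    have := root_pos t
    change √(1 / √((t : ℝ) + 1)) = _
    rw [← root_sq, ← _root_.one_div_pow, Real.sqrt_sq (by positivity)]
  refine squeeze_zero (fun t => (regParam_pos hα t).le) (regParam_le hα) ?_
  simpa using h4.const_mul (1 / α)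

end Complexity

end SmMGDA

end

/-! ### The two claims and the assembly of the theorem. -/

noncomputable section

namespace SmMGDA

open Matrix Filter Topology

section Main

variable {d₁ r d₂ : ℕ} {f : MatSpace d₁ r → EuclideanSpace ℝ (Fin d₂) → ℝ}
  {h : EuclideanSpace ℝ (Fin d₂) → EReal} {C Lxx Lxy Lyx Lyy : ℝ} {G₀ G₁ Mf Mh R : ℝ}

lemma le_mul_one_add_abs_log_sq {a ε : ℝ} (ha : 0 ≤ a) : a ≤ a * (1 + |Real.log ε|) ^ 2 :=
  le_mul_of_one_le_right ha (one_le_pow₀ (by linarith [abs_nonneg (Real.log ε)]))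

/-- The rate is proved without the logarithmic factor, which is at least one and is inserted at the
end. When the tolerance is so large that `N` would drop below one, the starting point already
qualifies. -/
lemma IsProblem.complexity (Q : IsProblem f h C Lxx Lxy Lyx Lyy)
    (D : DataBounds f h C G₀ G₁ Mf Mh R) {Λ : ℝ} (hΛ0 : 0 ≤ Λ)
    (hΛ : ∀ y ∈ effDom h, ∃ g ∈ subdiff h y, ‖g‖ ≤ Λ) {ρ α b l lxx lxy lyx : ℝ}
    (hρ : 8 * tubeConst C G₀ ≤ ρ) (hα : 0 < α) (hαL : α * (10 * Lyy) ≤ 1) (hb : 35 ≤ b)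
    (hbl : 2 / (α * l) - 1 < b) (hlρ : 4 / 3 * ρ ≤ l)
    (hl : GradLipschitzOn (penalized f ρ) (Metric.closedBall 0 C) (effDom h) lxx lxy lyx Lyy)
    (hmax : l = max (max lxx lxy) (max lyx Lyy))
    {x₀ : MatSpace d₁ r} (hx₀ : x₀ ∈ stiefel d₁ r) {y₀ : EuclideanSpace ℝ (Fin d₂)}
    (hy₀ : y₀ ∈ effDom h) {s : ℕ → State (MatSpace d₁ r) (EuclideanSpace ℝ (Fin d₂))}
    (hs : s = run f h (concaveParams ρ C α b l) x₀ y₀ x₀) {ε : ℝ} (hε : 0 < ε) :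
    ∃ t : ℕ, ((s t).evals : ℝ) ≤ (8 * complexityConst α b C G₀ Mf Mh R Lyy ^ 2 + 1)
        * l ^ 4 / ε ^ 4 * (1 + |Real.log ε|) ^ 2 ∧
      (s t).x ∈ Metric.closedBall 0 C ∧
      ∃ q, nearestPts (stiefel d₁ r) (s t).x = {q} ∧ ‖(s t).x - q‖ ≤ 3 / ρ * ε ∧
        ‖riemGradX f q (s t).y‖ ≤ accuracyConst C G₀ G₁ Lxx Lyx Λ * ε ∧
        Metric.infEDist 0 (dualResidual f h q (s t).y)
          ≤ ENNReal.ofReal (accuracyConst C G₀ G₁ Lxx Lyx Λ * ε) := by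
  have hB := one_le_tubeConst Q.C_pos.le D.G₀_nonneg
  have hl1 : 1 ≤ l := by linarith
  have hl0 : 0 < l := by linarith
  obtain ⟨n1, n2, n3, n4⟩ := Q.lip.nonneg
  have hA0 := adjBound_nonneg Q.C_pos.le D.G₀_nonneg
  have hC1 : 0 ≤ 3 * (Lyx * (1 + C / 2)) := by have := Q.C_pos; positivity
  obtain ⟨hx, hy, hstep, hprox⟩ := Q.run_spec D hρ hα hb hbl hlρ hx₀ hy₀ hs
  have hev : ∀ t, ((s t).evals : ℝ) = 2 * t := fun t => by rw [hs, run_evals]; push_cast; rfl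
  obtain ⟨z, P, Δ, γ, S, hP, hP0, hd⟩ :=
    Q.exists_descentSystem D hρ hα hαL hb hbl hl0 hl hmax hx hy hstep hprox
  set M := complexityConst α b C G₀ Mf Mh R Lyy with hM
  set K₀ := accuracyConst C G₀ G₁ Lxx Lyx Λ with hK₀
  have hK₀1 : riemConst C G₀ Lxx ≤ K₀ := by
    rw [hK₀]; unfold accuracyConst
    linarith [le_abs_self (riemConst C G₀ Lxx), abs_nonneg G₁]
  have hK₀2 : 1 + 3 * (Lyx * (1 + C / 2)) ≤ K₀ := by
    rw [hK₀]; unfold accuracyConst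
    linarith [abs_nonneg (riemConst C G₀ Lxx), abs_nonneg G₁]
  have hK₀3 : adjBound C G₀ ≤ K₀ := by
    rw [hK₀]; unfold accuracyConst
    linarith [abs_nonneg (riemConst C G₀ Lxx), abs_nonneg G₁]
  have hK₀4 : |G₁| + Λ ≤ K₀ := by
    rw [hK₀]; unfold accuracyConst
    linarith [abs_nonneg (riemConst C G₀ Lxx), abs_nonneg G₁]
  have hratio : 0 ≤ l ^ 4 / ε ^ 4 := by positivity
  by_cases hε1 : 1 ≤ M ^ 2 * l ^ 4 / ε ^ 4
  · obtain ⟨t, ht, hG, hres⟩ := S.exists_residuals_le hα hl1 hb hbl hP hP0 hd n4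
      (K := decayConst α b C G₀ Mf Mh R) rfl (M := M) rfl hε hε1
    have hyy : (α⁻¹ + Lyy) * ‖(s t).y - (s (t + 1)).y‖ + regParam α t * R ≤ ε := by
      refine le_trans (add_le_add_left (mul_le_mul_of_nonneg_left ?_ (by positivity)) _) hres
      rw [← sub_sub_sub_cancel_right (s t).y (s (t + 1)).y (z t)]
      exact norm_sub_le _ _
    obtain ⟨q, hq, hxq, hriem, hdual⟩ := Q.iterate_accuracy D hρ hα (regParam_pos hα t).le
      (hx (t + 1)) (hy t) (hy (t + 1)) (hprox t) hG hyy
    refine ⟨t + 1, ?_, Q.tube_subset D.G₀_nonneg hρ (hx _), q, hq, hxq,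
      hriem.trans (mul_le_mul_of_nonneg_right hK₀1 hε.le), hdual.trans (ENNReal.ofReal_le_ofReal
        (mul_le_mul_of_nonneg_right hK₀2 hε.le))⟩
    rw [hev, mul_div_assoc]
    push_cast
    refine le_trans ?_ (le_mul_one_add_abs_log_sq (by positivity))
    linarith
  · have hM1 : 1 ≤ M := by
      have h1 := S.sum_decrease_le hα hl0 hb hbl hP hP0 hd 0
      rw [Finset.sum_range_zero] at h1
      have : 0 < b := by linarith
      have h2 : 0 ≤ decayConst α b C G₀ Mf Mh R := by unfold decayConst; positivity
      have h3 : 0 ≤ decayConst α b C G₀ Mf Mh R * (1 + 16 * (α⁻¹ + Lyy) ^ 2)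
        + 4 * R ^ 2 / α ^ 2 := by positivity
      rw [hM]; unfold complexityConst; linarith
    -- Failure of the case hypothesis with `M, l ≥ 1` forces a tolerance of at least one, and the
    -- starting point meets fixed bounds.
    have hε1 : 1 ≤ ε := by
      by_contra hcon
      push Not at hcon
      refine hε1 ((one_le_div (by positivity)).2 ?_)
      have h1 : ε ^ 4 ≤ 1 := pow_le_one₀ hε.le hcon.le
      have h2 : 1 * 1 ≤ M ^ 2 * l ^ 4 :=
        mul_le_mul (one_le_pow₀ hM1) (one_le_pow₀ hl1) zero_le_one (sq_nonneg M)
      linarith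
    have hs0 : (s 0).x = x₀ ∧ (s 0).y = y₀ := by rw [hs]; exact ⟨rfl, rfl⟩
    obtain ⟨hq, hriem, hdual⟩ := Q.initial_accuracy D hΛ hx₀ hy₀
    have hK₀0 : 0 ≤ K₀ := hA0.trans hK₀3
    have hK₀ε : K₀ ≤ K₀ * ε := le_mul_of_one_le_right hK₀0 hε1
    refine ⟨0, ?_, Q.tube_subset D.G₀_nonneg hρ (hx _), x₀, ?_, ?_, ?_, ?_⟩
    · rw [hev, Nat.cast_zero, mul_zero]
      positivity
    · rw [hs0.1]; exact hq
    · rw [hs0.1, sub_self, norm_zero]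
      have : 0 < ρ := by linarith
      positivity
    · rw [hs0.2]; exact hriem.trans (hK₀3.trans hK₀ε)
    · rw [hs0.2]; exact hdual.trans (ENNReal.ofReal_le_ofReal (hK₀4.trans hK₀ε))

/-- All residuals vanish along the full sequence, so any convergent subsequence has a stationary
limit by closedness of the subdifferential and continuity of the gradients. -/
lemma IsProblem.stationary_of_mapClusterPt (Q : IsProblem f h C Lxx Lxy Lyx Lyy)
    (D : DataBounds f h C G₀ G₁ Mf Mh R) {ρ α b l lxx lxy lyx : ℝ}
    (hρ : 8 * tubeConst C G₀ ≤ ρ) (hα : 0 < α) (hαL : α * (10 * Lyy) ≤ 1) (hb : 35 ≤ b)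
    (hbl : 2 / (α * l) - 1 < b) (hlρ : 4 / 3 * ρ ≤ l)
    (hl : GradLipschitzOn (penalized f ρ) (Metric.closedBall 0 C) (effDom h) lxx lxy lyx Lyy)
    (hmax : l = max (max lxx lxy) (max lyx Lyy))
    {x₀ : MatSpace d₁ r} (hx₀ : x₀ ∈ stiefel d₁ r) {y₀ : EuclideanSpace ℝ (Fin d₂)}
    (hy₀ : y₀ ∈ effDom h) {s : ℕ → State (MatSpace d₁ r) (EuclideanSpace ℝ (Fin d₂))}
    (hs : s = run f h (concaveParams ρ C α b l) x₀ y₀ x₀) {xs : MatSpace d₁ r}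
    {ys : EuclideanSpace ℝ (Fin d₂)}
    (hcl : MapClusterPt (xs, ys) atTop fun t => ((s t).x, (s t).y)) :
    xs ∈ stiefel d₁ r ∧ riemGradX f xs ys = 0 ∧ 0 ∈ dualResidual f h xs ys := by
  have hB := one_le_tubeConst Q.C_pos.le D.G₀_nonneg
  have hl0 : 0 < l := by linarith
  obtain ⟨hx, hy, hstep, hprox⟩ := Q.run_spec D hρ hα hb hbl hlρ hx₀ hy₀ hs
  obtain ⟨z, P, Δ, γ, S, hP, hP0, hd⟩ :=
    Q.exists_descentSystem D hρ hα hαL hb hbl hl0 hl hmax hx hy hstep hprox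
  obtain ⟨φ, hφ, hlim⟩ := hcl.tendsto_subseq
  -- The subgradient at an iterate comes from the preceding proximal step, so the subsequence is
  -- shifted to make every index a successor `t + 1`.
  have hψ : Tendsto (fun n => φ (n + 1) - 1) atTop atTop :=
    (tendsto_sub_atTop_nat 1).comp (hφ.tendsto_atTop.comp (tendsto_add_atTop_nat 1))
  have hψ1 : ∀ n, φ (n + 1) - 1 + 1 = φ (n + 1) := fun n =>
    Nat.sub_add_cancel ((Nat.succ_le_succ (Nat.zero_le n)).trans (hφ.id_le (n + 1)))
  have hlim' : Tendsto (fun n => ((s (φ (n + 1) - 1 + 1)).x, (s (φ (n + 1) - 1 + 1)).y)) atTop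
      (𝓝 (xs, ys)) := by
    simp only [hψ1]
    exact hlim.comp (tendsto_add_atTop_nat 1)
  have hed := (S.tendsto_e hα hl0 hb hbl hP hP0 hd).add
    ((S.tendsto_d hα hl0 hb hbl hP hP0 hd).comp (tendsto_add_atTop_nat 1))
  have hed' : Tendsto (fun t => ‖(s t).y - z t‖ + ‖(s (t + 1)).y - z t‖) atTop (𝓝 0) := by
    rw [← tendsto_add_atTop_iff_nat 1]
    simpa using hed
  have hres : Tendsto (fun t => (α⁻¹ + Lyy) * (‖(s t).y - z t‖ + ‖(s (t + 1)).y - z t‖)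
      + regParam α t * R) atTop (𝓝 0) := by
    simpa using (hed'.const_mul (α⁻¹ + Lyy)).add ((tendsto_regParam hα).mul_const R)
  refine Q.stationary_of_tendsto D hρ hl (fun n => hx (φ (n + 1) - 1 + 1))
    (fun n => hy (φ (n + 1) - 1 + 1)) ((continuous_fst.tendsto _).comp hlim')
    ((continuous_snd.tendsto _).comp hlim') ((S.tendsto_G hα hl0 hb hbl hP hP0 hd).comp hψ)
    (fun n => hprox (φ (n + 1) - 1))
    (squeeze_zero (fun n => norm_nonneg _) (fun n => ?_) (hres.comp hψ))
  set t := φ (n + 1) - 1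
  have hX := Q.tube_subset D.G₀_nonneg hρ (hx (t + 1))
  have h1 := hl.lip_y _ hX _ hX _ (hy t) _ (hy (t + 1))
  rw [sub_self, norm_zero, mul_zero, zero_add] at h1
  refine (norm_prox_subgradient_sub_le hα (regParam_pos hα t).le h1
    (D.norm_le _ (hy t))).trans (add_le_add_left (mul_le_mul_of_nonneg_left ?_ ?_) _)
  · rw [← sub_sub_sub_cancel_right (s t).y (s (t + 1)).y (z t)]
    exact norm_sub_le _ _
  · have := Q.lip.nonneg.2.2.2
    positivity

end Main

end SmMGDA

end

theorem mainTheorem2 {d₁ r d₂ : ℕ} (hr : 0 < r)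
    (f : SmMGDA.MatSpace d₁ r → EuclideanSpace ℝ (Fin d₂) → ℝ)
    (h : EuclideanSpace ℝ (Fin d₂) → EReal)
    (C : ℝ) (hC : 1 / 2 + sSup ((fun x => ‖x‖) '' SmMGDA.stiefel d₁ r) < C)
    (hh : SmMGDA.IsRegularizer h)
    (hdiff : ∃ U : Set (SmMGDA.MatSpace d₁ r × EuclideanSpace ℝ (Fin d₂)), IsOpen U ∧
      (SmMGDA.dissolve '' Metric.closedBall 0 C) ×ˢ SmMGDA.effDom h ⊆ U ∧
      DifferentiableOn ℝ (Function.uncurry f) U)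
    (Lxx Lxy Lyx Lyy : ℝ)
    (hLip : SmMGDA.GradLipschitzOn f (SmMGDA.dissolve '' Metric.closedBall 0 C)
      (SmMGDA.effDom h) Lxx Lxy Lyx Lyy)
    (hconc : ∀ x ∈ SmMGDA.dissolve '' Metric.closedBall (0 : SmMGDA.MatSpace d₁ r) C,
      ConcaveOn ℝ (SmMGDA.effDom h) (f x)) :
    ∃ ρbar > (0 : ℝ), ∃ K₀ > (0 : ℝ),
      ∀ τ₂ > (0 : ℝ), τ₂ * (10 * Lyy) ≤ 1 → ∀ b : ℝ, ∃ K > (0 : ℝ),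
        ∀ ρ > ρbar, ∀ lxx lxy lyx l : ℝ,
          SmMGDA.GradLipschitzOn (SmMGDA.penalized f ρ) (Metric.closedBall 0 C)
            (SmMGDA.effDom h) lxx lxy lyx Lyy →
          l = max (max lxx lxy) (max lyx Lyy) →
          max (2 / (τ₂ * l) - 1) (32 * 20 ^ 2 / 19 ^ 2) < b →
          ∀ x₀ ∈ SmMGDA.stiefel d₁ r, ∀ y₀ ∈ SmMGDA.effDom h,
            let s := SmMGDA.run f h (SmMGDA.concaveParams ρ C τ₂ b l) x₀ y₀ x₀
            (∀ ε > (0 : ℝ), ∃ t : ℕ,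
              ((s t).evals : ℝ) ≤ K * l ^ 4 / ε ^ 4 * (1 + |Real.log ε|) ^ 2 ∧
              (s t).x ∈ Metric.closedBall 0 C ∧
              ∃ q, SmMGDA.nearestPts (SmMGDA.stiefel d₁ r) (s t).x = {q} ∧
                ‖(s t).x - q‖ ≤ 3 / ρ * ε ∧
                ‖SmMGDA.riemGradX f q (s t).y‖ ≤ K₀ * ε ∧
                Metric.infEDist 0 (SmMGDA.dualResidual f h q (s t).y) ≤
                  ENNReal.ofReal (K₀ * ε)) ∧
            (∀ xs ys, MapClusterPt (xs, ys) Filter.atTop (fun t => ((s t).x, (s t).y)) →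
              xs ∈ SmMGDA.stiefel d₁ r ∧
              SmMGDA.riemGradX f xs ys = 0 ∧
              (0 : EuclideanSpace ℝ (Fin d₂)) ∈ SmMGDA.dualResidual f h xs ys) := by
  -- If the manifold is empty there is no starting point. This case is split off also because the
  -- supremum of the empty set is `0` by convention, so the hypothesis on `C` would not give `√r +
  -- 1/2 < C`.
  rcases (SmMGDA.stiefel d₁ r).eq_empty_or_nonempty with hempty | ⟨x₁, hx₁⟩
  · refine ⟨1, one_pos, 1, one_pos, fun _ _ _ _ => ⟨1, one_pos, ?_⟩⟩
    intro _ _ _ _ _ _ _ _ _ x₀ hx₀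
    rw [hempty] at hx₀
    exact hx₀.elim
  have himage : (fun x => ‖x‖) '' SmMGDA.stiefel d₁ r = {√(r : ℝ)} :=
    Set.Subset.antisymm (by
      rintro _ ⟨x, hx, rfl⟩
      exact SmMGDA.norm_of_mem_stiefel hx)
      (Set.singleton_subset_iff.2 ⟨x₁, hx₁, SmMGDA.norm_of_mem_stiefel hx₁⟩)
  rw [himage, csSup_singleton] at hC
  have Q : SmMGDA.IsProblem f h C Lxx Lxy Lyx Lyy := ⟨hr, by linarith, hh, hdiff, hLip, hconc⟩
  obtain ⟨G₀, G₁, Mf, Mh, R, D⟩ := Q.exists_dataBounds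
  obtain ⟨Λ, hΛ0, hΛ⟩ := hh.exists_bounded_subgradient
  have hB := SmMGDA.one_le_tubeConst Q.C_pos.le D.G₀_nonneg
  refine ⟨8 * SmMGDA.tubeConst C G₀, by linarith, SmMGDA.accuracyConst C G₀ G₁ Lxx Lyx Λ, ?_, ?_⟩
  · have h1 := SmMGDA.adjBound_nonneg Q.C_pos.le D.G₀_nonneg
    have h2 := Q.lip.nonneg.2.2.1
    have h3 := Q.C_pos
    have h4 : 0 ≤ Lyx * (1 + C / 2) := by positivity
    unfold SmMGDA.accuracyConst
    linarith [abs_nonneg (SmMGDA.riemConst C G₀ Lxx), abs_nonneg G₁]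
  intro τ₂ hτ₂ hτL b
  refine ⟨8 * SmMGDA.complexityConst τ₂ b C G₀ Mf Mh R Lyy ^ 2 + 1, by positivity, ?_⟩
  intro ρ hρ lxx lxy lyx l hl hmax hb x₀ hx₀ y₀ hy₀ s
  have hlρ : 4 / 3 * ρ ≤ l := (Q.penalty_le D hρ.le hl hx₀).trans (by
    rw [hmax]; exact (le_max_left _ _).trans (le_max_left _ _))
  -- The bound `32 · 20²/19²` is about `35.46`; the scalar estimates need only `35`.
  have hb35 : 35 ≤ b := by
    have := (le_max_right _ _).trans_lt hb
    norm_num at this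
    linarith
  have hbl := (le_max_left _ _).trans_lt hb
  exact ⟨fun ε hε => Q.complexity D hΛ0 hΛ hρ.le hτ₂ hτL hb35 hbl hlρ hl hmax hx₀ hy₀ rfl hε,
    fun xs ys hcl => Q.stationary_of_mapClusterPt D hρ.le hτ₂ hτL hb35 hbl hlρ hl hmax hx₀ hy₀
      rfl hcl⟩
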